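/- Let $\mathbb{T}=\mathbb{R}/2\pi\mathbb{Z}$, and let $L^2(\mathbb{T})$ be the space of complex-valued square-integrable functions on $\mathbb{T}$. For $l\in\mathbb{Z}\setminus\{0\}$ let $A_l=\partial_y^2-l^2$ with domain $W^{2,2}(\mathbb{T})$ in $L^2(\mathbb{T})$ (so $-A_l$ is positive self-adjoint, and its powers $(-A_l)^{s}$ act on the $k$-th Fourier mode as $(k^2+l^2)^s$), and set $$B_{2,l}=I+A_l^{-1},\qquad \hat\Lambda_l=M_{\sin y}B_{2,l},$$ where $M_g$ denotes multiplication by $g$. Let $Y_l=L^2(\mathbb{T})$ if $l\neq\pm1$ and $Y_l=\{f\in L^2(\mathbb{T}):\int_0^{2\pi}f\,dy=0\}$ if $l=\pm1$, and let $\mathbb{Q}_l$ be the orthogonal projection of $L^2(\mathbb{T})$ onto $Y_l$. For $\kappa\in(0,1)$, $m\ge1$ and $\mu\in\mathbb{R}$ put $$h_1(m,\mu)=\begin{cases}0&\text{if }|\mu|>1+\frac{\kappa}{m},\\ m^{-1/2}&\text{if }1-\frac{\kappa}{m}<|\mu|\le1+\frac{\kappa}{m},\\ m^{-1}(1-|\mu|)^{-1/2}&\text{if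 }|\mu|\le1-\frac{\kappa}{m},\end{cases}$$ $$h_2(m,\mu)=\begin{cases}0&\text{if }|\mu|>1+\frac{\kappa}{m^2},\\ m^{-2}&\text{if }1-\frac{\kappa}{m^2}<|\mu|\le1+\frac{\kappa}{m^2},\\ m^{-1}(1-|\mu|)^{1/2}&\text{if }|\mu|\le1-\frac{\kappa}{m^2},\end{cases}$$ $$h_3(m,\mu)=\begin{cases}0&\text{if }|\mu|>1+\frac{\kappa}{m^2},\\ m^{-2}&\text{if }1-\frac{\kappa}{m^2}<|\mu|\le1+\frac{\kappa}{m^2},\\ m^{-3}(1-|\mu|)^{-1/2}&\text{if }|\mu|\le1-\frac{\kappa}{m^2}.\end{cases}$$ There exist constants $C>0$ and $\kappa\in(0,1)$ such that the following holds for all $\mu\in\mathbb{R}$ and $l\in\mathbb{Z}\setminus\{0\}$, with all norms taken in $L^2(\mathbb{T})$. (i) For all real $m\ge1$: - if $\frac12\le|\mu|\le1+\frac{\kappa}{m}$, then for all $u\in H^1(\mathbb{T})$, $$\|u\|^2\le C\big(m^2\|(\mu-\hat\Lambda_l)u\|^2+h_1(m,\mu)^2\|(-A_l)^{1/2}u\|^2\big);$$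 - if $\frac12\le|\mu|\le1+\frac{\kappa}{m^2}$, then for all $u\in H^1(\mathbb{T})$, $$\|M_{\cos y}B_{2,l}u\|^2\le C\big(m^2\|(\mu-\hat\Lambda_l)u\|^2+h_2(m,\mu)^2\|(-A_l)^{1/2}u\|^2\big),$$ $$\|(-A_l)^{-1/2}u\|^2\le C\big(m^2\|(\mu-\hat\Lambda_l)u\|^2+h_3(m,\mu)^2\|(-A_l)^{1/2}u\|^2\big);$$ - if $|\mu|<\frac12$, then for all $u\in H^1(\mathbb{T})\cap Y_l$, $$\|u\|^2\le C\big(m^2\|\mathbb{Q}_l(\mu-\hat\Lambda_l)u\|^2+h_1(m,\mu)^2\|(-A_l)^{1/2}u\|^2\big),$$ $$\|M_{\cos y}B_{2,l}u\|^2\le C\big(m^2\|\mathbb{Q}_l(\mu-\hat\Lambda_l)u\|^2+h_2(m,\mu)^2\|(-A_l)^{1/2}u\|^2\big),$$ $$\|(-A_l)^{-1/2}u\|^2\le C\big(m^2\|\mathbb{Q}_l(\mu-\hat\Lambda_l)u\|^2+h_3(m,\mu)^2\|(-A_l)^{1/2}u\|^2\big).$$ (ii) If $|\mu|>1$, then for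 all $u\in H^1(\mathbb{T})$, $$\|u\|^2\le\frac{C}{(|\mu|-1)^2}\|(\mu-\hat\Lambda_l)u\|^2,\qquad \|M_{\cos y}B_{2,l}u\|^2\le\frac{C}{|\mu|-1}\|(\mu-\hat\Lambda_l)u\|^2,$$ $$\|(-A_l)^{-1/2}u\|^2\le\frac{C}{|\mu|(|\mu|-1)}\|(\mu-\hat\Lambda_l)u\|^2.$$ -/

import Mathlib

namespace Kolmogorov

open MeasureTheory AddCircle
open scoped Real ContDiff ENNReal

noncomputable section

instance twoPiPos : Fact (0 < 2 * π) := ⟨Real.two_pi_pos⟩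

/-- The torus `𝕋 = ℝ / 2πℤ`. -/
abbrev Torus : Type := AddCircle (2 * π)

/-- The complex Hilbert space `L²(𝕋)`, with respect to the normalized measure `dy / 2π`. -/
abbrev L2 : Type := Lp ℂ 2 (haarAddCircle : Measure Torus)

/-! ### Weak derivatives and `H¹(𝕋)` -/

/-- `g = ∂_y u` in the weak sense on the torus: `∫ u φ' dy = - ∫ g φ dy` for every smooth
`2π`-periodic test function `φ`. -/
def HasWeakDeriv (u g : L2) : Prop :=
  ∀ φ : ℝ → ℂ, ContDiff ℝ ∞ φ → Function.Periodic φ (2 * π) →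
    ∫ y in (0 : ℝ)..(2 * π), u (y : Torus) * deriv φ y =
      - ∫ y in (0 : ℝ)..(2 * π), g (y : Torus) * φ y

/-- `u ∈ H¹(𝕋)`: the function `u ∈ L²(𝕋)` has a weak derivative in `L²(𝕋)`. -/
def MemH1 (u : L2) : Prop := ∃ g : L2, HasWeakDeriv u g

lemma HasWeakDeriv.fourierCoeff {u g : L2} (h : HasWeakDeriv u g) (k : ℤ) :
    fourierCoeff (g : Torus → ℂ) k = Complex.I * k * fourierCoeff (u : Torus → ℂ) k := by
  have hd : ∀ y : ℝ, HasDerivAt (fun y : ℝ => fourier (-k) (y : Torus))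
      (-(Complex.I * k) * fourier (-k) (y : Torus)) y := by
    intro y
    have := hasDerivAt_fourier_neg (2 * π) k y
    convert this using 1
    have hpi : (π : ℂ) ≠ 0 := by exact_mod_cast Real.pi_ne_zero
    push_cast
    field_simp
  have hsm : ContDiff ℝ ∞ (fun y : ℝ => (fourier (-k) (y : Torus) : ℂ)) := by
    have : (fun y : ℝ => (fourier (-k) (y : Torus) : ℂ)) =
        fun y : ℝ => Complex.exp (2 * π * Complex.I * (-k : ℤ) * y / (2 * π : ℝ)) := by
      funext y
      rw [fourier_coe_apply]
    rw [this]
    have h0 : ContDiff ℝ ∞ (fun y : ℝ => (y : ℂ)) := Complex.ofRealCLM.contDiff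
    exact ((contDiff_const.mul h0).div_const _).cexp
  have hper : Function.Periodic (fun y : ℝ => (fourier (-k) (y : Torus) : ℂ)) (2 * π) := by
    intro y
    simp only [AddCircle.coe_add_period]
  have key := h _ hsm hper
  rw [fourierCoeff_eq_intervalIntegral _ _ 0, fourierCoeff_eq_intervalIntegral _ _ 0]
  simp only [zero_add, smul_eq_mul]
  have e1 : ∀ y : ℝ, u (y : Torus) * deriv (fun y : ℝ => (fourier (-k) (y : Torus) : ℂ)) y =
      -(Complex.I * k) * (fourier (-k) (y : Torus) * u (y : Torus)) := by
    intro y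
    rw [(hd y).deriv]
    ring
  simp only [e1, intervalIntegral.integral_const_mul] at key
  have e2 : ∀ y : ℝ, g (y : Torus) * fourier (-k) (y : Torus) =
      fourier (-k) (y : Torus) * g (y : Torus) := fun y => mul_comm _ _
  simp only [e2] at key
  rw [neg_mul, neg_inj] at key
  rw [← key]
  simp only [Complex.real_smul]
  ring

/-! ### Fourier multipliers and the operator `A_l = ∂_y² - l²` -/

/-- The maximal domain in `L²(𝕋)` of the Fourier multiplier `σ`. -/
def multiplierDomain (σ : ℤ → ℂ) : Submodule ℂ L2 where
  carrier := {u | Memℓp (fun k : ℤ => σ k * fourierBasis.repr u k) 2}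
  zero_mem' := by
    have : (fun k : ℤ => σ k * fourierBasis.repr (0 : L2) k) = 0 := by
      funext k; simp
    simp only [Set.mem_ofPred_eq, this]
    exact zero_memℓp
  add_mem' := by
    intro u v hu hv
    have : (fun k : ℤ => σ k * fourierBasis.repr (u + v) k) =
        (fun k : ℤ => σ k * fourierBasis.repr u k) +
          fun k : ℤ => σ k * fourierBasis.repr v k := by
      funext k; simp [mul_add]
    simp only [Set.mem_ofPred_eq, this]
    exact hu.add hv
  smul_mem' := by
    intro c u hu
    have : (fun k : ℤ => σ k * fourierBasis.repr (c • u) k) =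
        c • (fun k : ℤ => σ k * fourierBasis.repr u k) := by
      funext k; simp [mul_left_comm]
    simp only [Set.mem_ofPred_eq, this]
    exact hu.const_smul c

/-- The sequence `σ(k) û(k)` as an element of `ℓ²(ℤ)`. -/
def multiplierSeq (σ : ℤ → ℂ) : multiplierDomain σ →ₗ[ℂ] lp (fun _ : ℤ => ℂ) 2 where
  toFun u := ⟨fun k : ℤ => σ k * fourierBasis.repr u.1 k, u.2⟩
  map_add' u v := by
    refine lp.ext (funext fun k => ?_)
    change σ k * fourierBasis.repr (u.1 + v.1) k =
      σ k * fourierBasis.repr u.1 k + σ k * fourierBasis.repr v.1 k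
    rw [map_add, lp.coeFn_add, Pi.add_apply, mul_add]
  map_smul' c u := by
    refine lp.ext (funext fun k => ?_)
    change σ k * fourierBasis.repr (c • u.1) k = c * (σ k * fourierBasis.repr u.1 k)
    rw [map_smul, lp.coeFn_smul, Pi.smul_apply, smul_eq_mul, mul_left_comm]

/-- The Fourier multiplier `u ↦ ∑ₖ σ(k) û(k) e^{iky}` with its maximal domain in `L²(𝕋)`. -/
def fourierMultiplier (σ : ℤ → ℂ) : L2 →ₗ.[ℂ] L2 where
  domain := multiplierDomain σ
  toFun := fourierBasis.repr.symm.toLinearEquiv.toLinearMap ∘ₗ multiplierSeq σ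

lemma fourierMultiplier_repr (σ : ℤ → ℂ) (u : (fourierMultiplier σ).domain) (k : ℤ) :
    fourierBasis.repr (fourierMultiplier σ u) k = σ k * fourierBasis.repr (u : L2) k := by
  change fourierBasis.repr (fourierBasis.repr.symm (multiplierSeq σ u)) k = _
  rw [LinearIsometryEquiv.apply_symm_apply]
  rfl

lemma repr_ext {u v : L2} (h : ∀ k : ℤ, fourierBasis.repr u k = fourierBasis.repr v k) : u = v :=
  fourierBasis.repr.injective (lp.ext (funext h))

/-- `A_l = ∂_y² - l²`, acting on the `k`-th Fourier mode as `-(k² + l²)`. -/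
def opA (l : ℤ) : L2 →ₗ.[ℂ] L2 := fourierMultiplier fun k => -((k : ℂ) ^ 2 + (l : ℂ) ^ 2)

/-- The power `(-A_l)^s` in the functional calculus of the self-adjoint operator `-A_l`, which is
diagonal in the Fourier basis with eigenvalues `k² + l²`. -/
def negAPow (l : ℤ) (s : ℝ) : L2 →ₗ.[ℂ] L2 :=
  fourierMultiplier fun k => (((k : ℝ) ^ 2 + (l : ℝ) ^ 2) ^ s : ℝ)

lemma memℓp_of_norm_le {f g : ℤ → ℂ} (hg : Memℓp g 2) (h : ∀ k, ‖f k‖ ≤ ‖g k‖) : Memℓp f 2 := by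
  have h2 : (0 : ℝ) < (2 : ℝ≥0∞).toReal := by norm_num
  rw [memℓp_gen_iff h2] at hg ⊢
  refine Summable.of_nonneg_of_le (fun k => by positivity) (fun k => ?_) hg
  exact Real.rpow_le_rpow (norm_nonneg _) (h k) h2.le

/-- The operator `A_l` is `∂_y² - l²` on functions with two weak derivatives in `L²(𝕋)`. -/
lemma opA_apply {u g h : L2} (hg : HasWeakDeriv u g) (hh : HasWeakDeriv g h) (l : ℤ) :
    ∃ hu : u ∈ (opA l).domain, opA l ⟨u, hu⟩ = h - (l : ℂ) ^ 2 • u := by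
  have key : ∀ k : ℤ, -((k : ℂ) ^ 2 + (l : ℂ) ^ 2) * fourierBasis.repr u k =
      fourierBasis.repr (h - (l : ℂ) ^ 2 • u) k := by
    intro k
    have e : fourierBasis.repr h k = -(k : ℂ) ^ 2 * fourierBasis.repr u k := by
      rw [fourierBasis_repr, fourierBasis_repr, hh.fourierCoeff, hg.fourierCoeff]
      linear_combination (k : ℂ) ^ 2 * _root_.fourierCoeff (u : Torus → ℂ) k * Complex.I_sq
    simp only [map_sub, map_smul, lp.coeFn_sub, lp.coeFn_smul, Pi.sub_apply, Pi.smul_apply,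
      smul_eq_mul, e]
    ring
  have hu : u ∈ (opA l).domain := by
    change Memℓp (fun k : ℤ => -((k : ℂ) ^ 2 + (l : ℂ) ^ 2) * fourierBasis.repr u k) 2
    simp only [key]
    exact lp.memℓp _
  exact ⟨hu, repr_ext fun k => (fourierMultiplier_repr _ ⟨u, hu⟩ k).trans (key k)⟩

/-- `H¹(𝕋)` is contained in the domain of `(-A_l)^{1/2}`. -/
lemma MemH1.mem_domain {u : L2} (hu : MemH1 u) (l : ℤ) : u ∈ (negAPow l (1 / 2)).domain := by
  obtain ⟨g, hg⟩ := hu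
  have h2 : (0 : ℝ) < (2 : ℝ≥0∞).toReal := by norm_num
  have s1 := (memℓp_gen_iff h2).1 (lp.memℓp (fourierBasis.repr g))
  have s2 := (memℓp_gen_iff h2).1 (lp.memℓp (fourierBasis.repr u))
  change Memℓp (fun k : ℤ => ((((k : ℝ) ^ 2 + (l : ℝ) ^ 2) ^ (1 / 2 : ℝ) : ℝ) : ℂ) *
    fourierBasis.repr u k) 2
  rw [memℓp_gen_iff h2]
  refine (s1.add (s2.mul_left ((l : ℝ) ^ 2))).congr fun k => ?_
  have e : fourierBasis.repr g k = Complex.I * k * fourierBasis.repr u k := by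
    rw [fourierBasis_repr, fourierBasis_repr, hg.fourierCoeff]
  have hk : (0 : ℝ) ≤ (k : ℝ) ^ 2 + (l : ℝ) ^ 2 := by positivity
  simp only [ENNReal.toReal_ofNat, Real.rpow_ofNat, e, norm_mul, Complex.norm_I, one_mul,
    Complex.norm_intCast, Complex.norm_real, Real.norm_eq_abs, ← Real.sqrt_eq_rpow, mul_pow,
    sq_abs, Real.sq_sqrt hk]
  ring

lemma negAPow_domain (l : ℤ) {s : ℝ} (hs : s ≤ 0) (u : L2) : u ∈ (negAPow l s).domain := by
  change Memℓp (fun k : ℤ => ((((k : ℝ) ^ 2 + (l : ℝ) ^ 2) ^ s : ℝ) : ℂ) *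
    fourierBasis.repr u k) 2
  refine memℓp_of_norm_le (lp.memℓp (fourierBasis.repr u)) fun k => ?_
  rw [norm_mul]
  refine mul_le_of_le_one_left (norm_nonneg _) ?_
  have hk : (0 : ℝ) ≤ (k : ℝ) ^ 2 + (l : ℝ) ^ 2 := by positivity
  rw [Complex.norm_real, Real.norm_eq_abs, abs_of_nonneg (Real.rpow_nonneg hk s)]
  obtain h0 | h1 : k ^ 2 + l ^ 2 = 0 ∨ 1 ≤ k ^ 2 + l ^ 2 := by
    have : 0 ≤ k ^ 2 + l ^ 2 := by positivity
    omega
  · have h0' : (k : ℝ) ^ 2 + (l : ℝ) ^ 2 = 0 := by exact_mod_cast h0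
    rw [h0']
    exact Real.zero_rpow_le_one s
  · exact Real.rpow_le_one_of_one_le_of_nonpos (by exact_mod_cast h1) hs

/-- The everywhere defined operator `(-A_l)^s` for `s ≤ 0`. -/
def negAPowBdd (l : ℤ) (s : ℝ) (hs : s ≤ 0) : L2 →ₗ[ℂ] L2 :=
  (negAPow l s).toFun.comp (LinearMap.id.codRestrict (negAPow l s).domain (negAPow_domain l hs))

/-- `A_l⁻¹ = -(-A_l)⁻¹`. -/
def invA (l : ℤ) : L2 →ₗ[ℂ] L2 := - negAPowBdd l (-1) (by norm_num)

lemma invA_repr (l : ℤ) (u : L2) (k : ℤ) :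
    fourierBasis.repr (invA l u) k = -((k : ℂ) ^ 2 + (l : ℂ) ^ 2)⁻¹ * fourierBasis.repr u k := by
  have e : invA l u = -(negAPow l (-1) ⟨u, negAPow_domain l (by norm_num) u⟩) := rfl
  have h := fourierMultiplier_repr _ (⟨u, negAPow_domain l (by norm_num) u⟩ :
    (negAPow l (-1)).domain) k
  rw [e, map_neg, lp.coeFn_neg, Pi.neg_apply]
  erw [h]
  rw [Real.rpow_neg_one]
  push_cast
  ring

/-- `invA l` is a two-sided inverse of `A_l` for `l ≠ 0`. -/
lemma opA_invA {l : ℤ} (hl : l ≠ 0) :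
    (∀ u : L2, ∃ hu : invA l u ∈ (opA l).domain, opA l ⟨invA l u, hu⟩ = u) ∧
      ∀ u : (opA l).domain, invA l (opA l u) = u := by
  have hne : ∀ k : ℤ, (k : ℂ) ^ 2 + (l : ℂ) ^ 2 ≠ 0 := by
    intro k
    have : k ^ 2 + l ^ 2 ≠ 0 := by positivity
    exact_mod_cast this
  have key : ∀ (u : L2) (k : ℤ), -((k : ℂ) ^ 2 + (l : ℂ) ^ 2) * fourierBasis.repr (invA l u) k =
      fourierBasis.repr u k := by
    intro u k
    rw [invA_repr]
    field_simp [hne k]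
  refine ⟨fun u => ?_, fun u => ?_⟩
  · have hu : invA l u ∈ (opA l).domain := by
      change Memℓp (fun k : ℤ => -((k : ℂ) ^ 2 + (l : ℂ) ^ 2) * fourierBasis.repr (invA l u) k) 2
      simp only [key]
      exact lp.memℓp _
    exact ⟨hu, repr_ext fun k => (fourierMultiplier_repr _ ⟨_, hu⟩ k).trans (key u k)⟩
  · refine repr_ext fun k => ?_
    have h : fourierBasis.repr (opA l u) k =
      -((k : ℂ) ^ 2 + (l : ℂ) ^ 2) * fourierBasis.repr (u : L2) k := fourierMultiplier_repr _ u k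
    rw [invA_repr, h]
    field_simp [hne k]

/-! ### The operators `M_g`, `B_{2,l}`, `Λ̂_l` and the projection `ℚ_l` -/

lemma memLp_mul (g : C(Torus, ℝ)) (u : L2) :
    MemLp (fun y => (g y : ℂ) * u y) 2 (haarAddCircle : Measure Torus) := by
  refine MemLp.of_le_mul (c := ‖g‖) (Lp.memLp u) ?_ (Filter.Eventually.of_forall fun y => ?_)
  · exact (Complex.continuous_ofReal.comp g.continuous).aestronglyMeasurable.mul
      (Lp.aestronglyMeasurable u)
  · rw [norm_mul, Complex.norm_real]
    exact mul_le_mul_of_nonneg_right (g.norm_coe_le_norm y) (norm_nonneg _)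

/-- The multiplication operator `M_g` on `L²(𝕋)`, for a continuous real function `g` on `𝕋`. -/
def mulOp (g : C(Torus, ℝ)) : L2 →ₗ[ℂ] L2 where
  toFun u := (memLp_mul g u).toLp (fun y => (g y : ℂ) * u y)
  map_add' u v := by
    rw [← MemLp.toLp_add]
    refine MemLp.toLp_congr _ _ ?_
    filter_upwards [Lp.coeFn_add u v] with y hy
    rw [hy]
    exact mul_add _ _ _
  map_smul' c u := by
    rw [RingHom.id_apply, ← MemLp.toLp_const_smul]
    refine MemLp.toLp_congr _ _ ?_
    filter_upwards [Lp.coeFn_smul c u] with y hy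
    simp [hy, mul_left_comm]

/-- The function `sin y` on `𝕋`. -/
def sinT : C(Torus, ℝ) :=
  ⟨Real.sin_periodic.lift, continuous_coinduced_dom.mpr Real.continuous_sin⟩

/-- The function `cos y` on `𝕋`. -/
def cosT : C(Torus, ℝ) :=
  ⟨Real.cos_periodic.lift, continuous_coinduced_dom.mpr Real.continuous_cos⟩

/-- `B_{2,l} = I + A_l⁻¹`. -/
def opB2 (l : ℤ) : L2 →ₗ[ℂ] L2 := LinearMap.id + invA l

/-- `Λ̂_l = M_{sin y} (I + A_l⁻¹)`. -/
def opLam (l : ℤ) : L2 →ₗ[ℂ] L2 := mulOp sinT ∘ₗ opB2 l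

lemma integral_eq_repr (f : L2) :
    ∫ y, f y ∂(haarAddCircle : Measure Torus) = fourierBasis.repr f 0 := by
  rw [fourierBasis_repr, fourierCoeff]
  simp

/-- `Y_l`: all of `L²(𝕋)` if `l ≠ ±1`, the functions of mean zero if `l = ±1`. -/
def spaceY (l : ℤ) : Submodule ℂ L2 where
  carrier := {f | l = 1 ∨ l = -1 → ∫ y, f y ∂(haarAddCircle : Measure Torus) = 0}
  zero_mem' := by
    intro _
    rw [integral_eq_repr]
    simp
  add_mem' := by
    intro f g hf hg hl
    have h1 := hf hl
    have h2 := hg hl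
    rw [integral_eq_repr] at h1 h2 ⊢
    simp [h1, h2]
  smul_mem' := by
    intro c f hf hl
    have h1 := hf hl
    rw [integral_eq_repr] at h1 ⊢
    simp [h1]

lemma isClosed_spaceY (l : ℤ) : IsClosed (spaceY l : Set L2) := by
  by_cases hl : l = 1 ∨ l = -1
  · have : (spaceY l : Set L2) = {f | inner ℂ (fourierBasis 0) f = 0} := by
      ext f
      change (l = 1 ∨ l = -1 → ∫ y, f y ∂(haarAddCircle : Measure Torus) = 0) ↔ _
      rw [integral_eq_repr, HilbertBasis.repr_apply_apply]
      exact ⟨fun h => h hl, fun h _ => h⟩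
    rw [this]
    exact isClosed_eq (by fun_prop) continuous_const
  · have : (spaceY l : Set L2) = Set.univ :=
      Set.eq_univ_of_forall fun f h => absurd h hl
    rw [this]
    exact isClosed_univ

instance spaceY_hasOrthogonalProjection (l : ℤ) : (spaceY l).HasOrthogonalProjection :=
  haveI : CompleteSpace (spaceY l) := (isClosed_spaceY l).completeSpace_coe
  inferInstance

/-- The orthogonal projection `ℚ_l` of `L²(𝕋)` onto `Y_l`. -/
def projQ (l : ℤ) : L2 →L[ℂ] L2 := (spaceY l).starProjection

/-! ### The functions `h_j` -/

/-- The function `h₁(m, μ)`, with the parameter `κ`. -/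
def h1 (κ m μ : ℝ) : ℝ :=
  if 1 + κ / m < |μ| then 0
  else if 1 - κ / m < |μ| then m ^ (-(1 / 2) : ℝ)
  else m⁻¹ * (1 - |μ|) ^ (-(1 / 2) : ℝ)

/-- The function `h₂(m, μ)`, with the parameter `κ`. -/
def h2 (κ m μ : ℝ) : ℝ :=
  if 1 + κ / m ^ 2 < |μ| then 0
  else if 1 - κ / m ^ 2 < |μ| then (m ^ 2)⁻¹
  else m⁻¹ * (1 - |μ|) ^ (1 / 2 : ℝ)

/-- The function `h₃(m, μ)`, with the parameter `κ`. -/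
def h3 (κ m μ : ℝ) : ℝ :=
  if 1 + κ / m ^ 2 < |μ| then 0
  else if 1 - κ / m ^ 2 < |μ| then (m ^ 2)⁻¹
  else (m ^ 3)⁻¹ * (1 - |μ|) ^ (-(1 / 2) : ℝ)

end

end Kolmogorov

/-! Put `ψ = A_l⁻¹ u` and `w = B_{2,l} u = u + ψ`. In the variable `z = y - π/2` the residual `g =
(μ - Λ̂_l) u` satisfies the Rayleigh equation `g + μ ψ + (cos z - μ) w = 0`, where `w = ψ'' - (l² -
1) ψ`. The norms to be bounded are those of `u = w - ψ`, of `sin z · w`, and the energy `∫ ψ'² + l²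
ψ²`; the norm of `(-A_l)^{1/2} u` is used only as a bound for `w'`. It suffices to treat
trigonometric polynomials and pass to the limit. Real and imaginary parts, and even and odd parts in
`z`, reduce the problem to real functions on `[0, π]` with Neumann or Dirichlet conditions, and `z ↦
π - z` reduces it to `μ ≥ 0`.

For `0 ≤ μ < 1` write `μ = cos ζ`. The equation determines `w` away from the critical point `ζ`,
where `cos z - μ` has slope of order `ζ`; in a window of width `ε` around `ζ` the derivative `w'`
takes over. The heart is `Rayleigh.energy_le`: the energy is at most a constant times `‖g‖² / (ζ ε)
+ ζ ε³ ‖w'‖²` for every `ε` below a small multiple of `ζ`. Bounds for `w` and `sin z · w` follow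
(`Rayleigh.interior_w_le`), and since `ζ²` is comparable to `1 - μ`, the choices of `ε` proportional
to `1/(m ζ)`, `1/m` and `1/(m² ζ)` produce `h1`, `h2` and `h3`.

The energy estimate tests the equation against `ψ`, with `w` replaced by a regularized quotient `-(g
+ μ ψ)/(cos z - μ)`, and has two regimes. If `cos ζ` is small against `|l| sin ζ`, the term with `μ
ψ` is a perturbation: its principal value is bounded by odd cancellation at `ζ` and Agmon's
inequality (`Rayleigh.key_perturbative`). Otherwise `|l| ζ` is bounded
(`Rayleigh.key_nonperturbative`); the value `ψ ζ` is controlled by averaging the equation over the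
window and is subtracted by means of a lift. Beyond `ζ` the potential `μ/(cos z - μ)` has a
favourable sign. Inside, it is dominated by `cos z/(cos z - μ)`, for which `B = cos z - μ` is a
positive zero mode, so the form is at least `∫ (B (F/B)')²`. For odd functions `F 0 = 0` excludes
the zero mode. For even functions its amplitude is read off from the flux through `ζ`: a test
function for which the principal value of `1/(cos z - μ)` vanishes still sees the slope `-sin ζ` of
`B`.

For `l = ±1` the form `∫ ψ'² + (l² - 1) ψ²` does not see constants. When `|μ| ≥ 1/2` the equation
itself controls them; when `|μ| < 1/2` the projection only gives the equation up to a constant `c₀`,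
and the mean-zero condition on `u` supplies a zero of `ψ`.

Near and beyond the edge `μ = 1` the equation is tested against `w`, and the identity `μ (∫ ψ'² +
(l² - 1) ψ²) + (μ - 1) ∫ w² + ∫ (1 - cos z) w² = ∫ g w` is coercive: directly if `μ > 1`
(`Rayleigh.exterior_le`), and after localizing `w` at `z = 0` if `1 - μ` is small
(`Rayleigh.edge_le`). -/

open MeasureTheory Set
open scoped Real

namespace Kolmogorov

noncomputable section

/-! ### Square integrals on an interval -/

/-- The square of the `L²` norm of `F` on `[a, b]`. -/
def sqInt (F : ℝ → ℝ) (a b : ℝ) : ℝ := ∫ x in a..b, F x ^ 2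

lemma sqInt_nonneg {F : ℝ → ℝ} {a b : ℝ} (hab : a ≤ b) : 0 ≤ sqInt F a b :=
  intervalIntegral.integral_nonneg hab fun _ _ => sq_nonneg _

lemma integral_add_cont {F G : ℝ → ℝ} (hF : Continuous F) (hG : Continuous G) (a b : ℝ) :
    ∫ x in a..b, (F x + G x) = (∫ x in a..b, F x) + ∫ x in a..b, G x :=
  intervalIntegral.integral_add (hF.intervalIntegrable _ _) (hG.intervalIntegrable _ _)

lemma integral_sub_cont {F G : ℝ → ℝ} (hF : Continuous F) (hG : Continuous G) (a b : ℝ) :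
    ∫ x in a..b, (F x - G x) = (∫ x in a..b, F x) - ∫ x in a..b, G x :=
  intervalIntegral.integral_sub (hF.intervalIntegrable _ _) (hG.intervalIntegrable _ _)

lemma integral_adjacent_cont {F : ℝ → ℝ} (hF : Continuous F) (a b c : ℝ) :
    (∫ x in a..b, F x) + ∫ x in b..c, F x = ∫ x in a..c, F x :=
  intervalIntegral.integral_add_adjacent_intervals (hF.intervalIntegrable _ _) (hF.intervalIntegrable _ _)

lemma integral_mono_cont {F G : ℝ → ℝ} {a b : ℝ} (hab : a ≤ b) (hF : Continuous F)
    (hG : Continuous G) (h : ∀ x ∈ Icc a b, F x ≤ G x) :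
    ∫ x in a..b, F x ≤ ∫ x in a..b, G x :=
  intervalIntegral.integral_mono_on hab (hF.intervalIntegrable _ _) (hG.intervalIntegrable _ _) h

lemma integral_subinterval {F : ℝ → ℝ} {a b p q : ℝ} (hap : a ≤ p) (hpq : p ≤ q) (hqb : q ≤ b)
    (hF : ContinuousOn F (Icc a b)) (h0 : ∀ x ∈ Icc a b, 0 ≤ F x) :
    ∫ x in p..q, F x ≤ ∫ x in a..b, F x := by
  refine intervalIntegral.integral_mono_interval hap hpq hqb ?_ ?_
  · filter_upwards [ae_restrict_mem measurableSet_Ioc] with x hx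
    exact h0 x ⟨hx.1.le, hx.2⟩
  · exact hF.intervalIntegrable_of_Icc (hap.trans (hpq.trans hqb))

lemma sqInt_mono_interval {F : ℝ → ℝ} {a b p q : ℝ} (hap : a ≤ p) (hpq : p ≤ q) (hqb : q ≤ b)
    (hF : Continuous F) : sqInt F p q ≤ sqInt F a b :=
  integral_subinterval hap hpq hqb (hF.pow 2).continuousOn fun _ _ => sq_nonneg _

lemma sqInt_add_adjacent {F : ℝ → ℝ} (hF : Continuous F) (a b c : ℝ) :
    sqInt F a b + sqInt F b c = sqInt F a c :=
  intervalIntegral.integral_add_adjacent_intervals ((hF.pow 2).intervalIntegrable _ _)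
    ((hF.pow 2).intervalIntegrable _ _)

lemma sqInt_mono {F G : ℝ → ℝ} {a b : ℝ} (hab : a ≤ b) (hF : Continuous F) (hG : Continuous G)
    (h : ∀ x ∈ Icc a b, F x ^ 2 ≤ G x ^ 2) : sqInt F a b ≤ sqInt G a b :=
  integral_mono_cont hab (hF.pow 2) (hG.pow 2) h

lemma sqInt_const_mul (c : ℝ) (F : ℝ → ℝ) (a b : ℝ) :
    sqInt (fun x => c * F x) a b = c ^ 2 * sqInt F a b := by
  simp only [sqInt, mul_pow, intervalIntegral.integral_const_mul]

lemma sqInt_add_le {F G : ℝ → ℝ} {a b : ℝ} (hab : a ≤ b) (hF : Continuous F)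
    (hG : Continuous G) :
    sqInt (fun x => F x + G x) a b ≤ 2 * sqInt F a b + 2 * sqInt G a b := by
  simp only [sqInt, ← intervalIntegral.integral_const_mul]
  rw [← integral_add_cont (by fun_prop) (by fun_prop)]
  refine integral_mono_cont hab (by fun_prop) (by fun_prop) fun x _ => ?_
  nlinarith [sq_nonneg (F x - G x)]

lemma integral_mul_sq_le {F G : ℝ → ℝ} {a b : ℝ} (hab : a ≤ b) (hF : Continuous F)
    (hG : Continuous G) : (∫ x in a..b, F x * G x) ^ 2 ≤ sqInt F a b * sqInt G a b := by
  have key : ∀ t : ℝ, 0 ≤ sqInt F a b * (t * t) + 2 * (∫ x in a..b, F x * G x) * t +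
      sqInt G a b := by
    intro t
    have h : ∫ x in a..b, (t * F x + G x) ^ 2 =
        sqInt F a b * (t * t) + 2 * (∫ x in a..b, F x * G x) * t + sqInt G a b := by
      have e : ∀ x, (t * F x + G x) ^ 2 = t * t * F x ^ 2 + 2 * t * (F x * G x) + G x ^ 2 := by
        intro x; ring
      simp only [e]
      rw [integral_add_cont (by fun_prop) (by fun_prop),
        integral_add_cont (by fun_prop) (by fun_prop),
        intervalIntegral.integral_const_mul, intervalIntegral.integral_const_mul]
      simp only [sqInt]
      ring
    rw [← h]
    exact intervalIntegral.integral_nonneg hab fun _ _ => sq_nonneg _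
  have := discrim_le_zero key
  simp only [discrim] at this
  nlinarith

lemma abs_integral_mul_le {F G : ℝ → ℝ} {a b : ℝ} (hab : a ≤ b) (hF : Continuous F)
    (hG : Continuous G) :
    |∫ x in a..b, F x * G x| ≤ √(sqInt F a b) * √(sqInt G a b) := by
  rw [← Real.sqrt_mul (sqInt_nonneg hab)]
  exact Real.abs_le_sqrt (integral_mul_sq_le hab hF hG)

lemma integral_abs_mul_le {F G : ℝ → ℝ} {a b : ℝ} (hab : a ≤ b) (hF : Continuous F)
    (hG : Continuous G) :
    ∫ x in a..b, |F x| * |G x| ≤ √(sqInt F a b) * √(sqInt G a b) := by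
  have h := abs_integral_mul_le hab hF.abs hG.abs
  simp only [sqInt, sq_abs] at h ⊢
  exact (le_abs_self _).trans h

/-- A pointwise bound `|H| ≤ M |F| |G|` combined with the Cauchy–Schwarz inequality. -/
lemma abs_integral_le_of_abs_le_mul {H F G : ℝ → ℝ} {a b M : ℝ} (hab : a ≤ b) (hM : 0 ≤ M)
    (hH : Continuous H) (hF : Continuous F) (hG : Continuous G)
    (h : ∀ x ∈ Icc a b, |H x| ≤ M * (|F x| * |G x|)) :
    |∫ x in a..b, H x| ≤ M * (√(sqInt F a b) * √(sqInt G a b)) := by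
  calc |∫ x in a..b, H x| ≤ ∫ x in a..b, |H x| := intervalIntegral.abs_integral_le_integral_abs hab
    _ ≤ ∫ x in a..b, M * (|F x| * |G x|) :=
        integral_mono_cont hab hH.abs (by fun_prop) h
    _ ≤ _ := by
        rw [intervalIntegral.integral_const_mul]
        exact mul_le_mul_of_nonneg_left (integral_abs_mul_le hab hF hG) hM

lemma sqInt_one (a b : ℝ) : sqInt (fun _ => 1) a b = b - a := by
  simp [sqInt]

lemma continuous_of_hasDerivAt {F p : ℝ → ℝ} (h : ∀ x, HasDerivAt F (p x) x) : Continuous F :=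
  continuous_iff_continuousAt.2 fun x => (h x).continuousAt

/-- Cauchy–Schwarz for `F x - F y = ∫ p`. The derivative norm is taken over the whole interval so
that the bound is uniform in the two points. -/
lemma sq_sub_le {F p : ℝ → ℝ} (hF : ∀ x, HasDerivAt F (p x) x) (hp : Continuous p) {a b x y : ℝ}
    (hx : x ∈ Icc a b) (hy : y ∈ Icc a b) : (F x - F y) ^ 2 ≤ |x - y| * sqInt p a b := by
  wlog hyx : y ≤ x generalizing x y
  · have := this hy hx (le_of_not_ge hyx)
    rwa [abs_sub_comm, ← neg_sub, neg_sq] at this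
  have h1 : ∫ t in y..x, 1 * p t = F x - F y := by
    simp only [one_mul]
    exact intervalIntegral.integral_eq_sub_of_hasDerivAt (fun t _ => hF t) (hp.intervalIntegrable _ _)
  have h2 := integral_mul_sq_le hyx (continuous_const (y := (1 : ℝ))) hp
  rw [h1, sqInt_one] at h2
  rw [abs_of_nonneg (sub_nonneg.2 hyx)]
  exact h2.trans (mul_le_mul_of_nonneg_left (sqInt_mono_interval hy.1 hyx hx.2 hp)
    (sub_nonneg.2 hyx))

lemma abs_sub_le_sqrt {F p : ℝ → ℝ} (hF : ∀ x, HasDerivAt F (p x) x) (hp : Continuous p)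
    {a b x y : ℝ} (hx : x ∈ Icc a b) (hy : y ∈ Icc a b) :
    |F x - F y| ≤ √|x - y| * √(sqInt p a b) := by
  rw [← Real.sqrt_mul (abs_nonneg _)]
  exact Real.abs_le_sqrt (sq_sub_le hF hp hx hy)

/-- Poincaré inequality for a function with a zero. -/
lemma sqInt_le_of_zero {F p : ℝ → ℝ} (hF : ∀ x, HasDerivAt F (p x) x) (hp : Continuous p)
    {a b x₀ : ℝ} (hx : x₀ ∈ Icc a b) (h0 : F x₀ = 0) :
    sqInt F a b ≤ (b - a) ^ 2 * sqInt p a b := by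
  have hab : a ≤ b := hx.1.trans hx.2
  have hP := sqInt_nonneg (F := p) hab
  have hFc := continuous_of_hasDerivAt hF
  calc sqInt F a b ≤ ∫ x in a..b, (b - a) * sqInt p a b := by
        refine integral_mono_cont hab (hFc.pow 2) continuous_const fun x hxx => ?_
        have := sq_sub_le hF hp hxx hx
        rw [h0, sub_zero] at this
        refine this.trans (mul_le_mul_of_nonneg_right ?_ hP)
        rw [abs_le]
        constructor <;> linarith [hxx.1, hxx.2, hx.1, hx.2]
    _ = _ := by simp; ring

/-- If `X ≤ 2 √X √Y` then `X ≤ 4 Y`. -/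
lemma le_four_mul_of_le_sqrt {X Y : ℝ} (hX : 0 ≤ X) (hY : 0 ≤ Y) (h : X ≤ 2 * (√X * √Y)) :
    X ≤ 4 * Y := by
  have h1 := Real.sq_sqrt hX
  have h2 := Real.sq_sqrt hY
  nlinarith [sq_nonneg (√X - 2 * √Y), Real.sqrt_nonneg X, Real.sqrt_nonneg Y]

/-- Regularized Hardy inequality at the left end point. -/
lemma hardy_left {F p : ℝ → ℝ} (hF : ∀ x, HasDerivAt F (p x) x) (hp : Continuous p)
    {a b η : ℝ} (hab : a ≤ b) (hη : 0 < η) (h0 : F a = 0) :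
    ∫ x in a..b, (F x / (|x - a| + η)) ^ 2 ≤ 4 * sqInt p a b := by
  have hFc := continuous_of_hasDerivAt hF
  have hne : ∀ x : ℝ, |x - a| + η ≠ 0 := fun x => by positivity
  have hc : Continuous fun x => F x / (|x - a| + η) := by fun_prop (disch := exact hne _)
  have hpos : ∀ x ∈ Icc a b, 0 < x - a + η := fun x hx => by linarith [hx.1]
  set X := sqInt (fun x => F x / (|x - a| + η)) a b with hX
  change X ≤ _
  have hX0 : 0 ≤ X := sqInt_nonneg hab
  refine le_four_mul_of_le_sqrt hX0 (sqInt_nonneg hab) ?_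
  -- Integrating this derivative, the boundary term at `a` vanishes with `F a` and the one at `b`
  -- has the good sign; what remains is `X ≤ 2 ∫ (F / (|x - a| + η)) p`.
  have hder : ∀ x ∈ uIcc a b, HasDerivAt (fun x => -(F x ^ 2 / (x - a + η)))
      ((F x / (|x - a| + η)) ^ 2 - 2 * (F x / (|x - a| + η) * p x)) x := by
    intro x hx
    rw [uIcc_of_le hab] at hx
    have hx' := hpos x hx
    have h1 : HasDerivAt (fun x => -(F x ^ 2 / (x - a + η))) _ x :=
      (((hF x).pow 2).div (((hasDerivAt_id x).sub_const a).add_const η) hx'.ne').neg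
    refine h1.congr_deriv ?_
    rw [abs_of_nonneg (by linarith [hx.1])]
    have := hx'.ne'
    simp only [id, Pi.pow_apply]
    field_simp
    simp
    ring
  have hci : Continuous fun x => (F x / (|x - a| + η)) ^ 2 - 2 * (F x / (|x - a| + η) * p x) :=
    (hc.pow 2).sub (continuous_const.mul (hc.mul hp))
  have hint := intervalIntegral.integral_eq_sub_of_hasDerivAt hder (hci.intervalIntegrable _ _)
  rw [integral_sub_cont (by fun_prop (disch := exact hne _)) (by fun_prop (disch := exact hne _)),
    intervalIntegral.integral_const_mul, h0] at hint
  have hb : 0 ≤ F b ^ 2 / (b - a + η) := div_nonneg (sq_nonneg _) (by linarith)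
  have hcs := (le_abs_self _).trans (abs_integral_mul_le hab hc hp)
  have : X = 2 * (∫ x in a..b, F x / (|x - a| + η) * p x) - F b ^ 2 / (b - a + η) := by
    simp only [hX, sqInt]
    simp at hint
    linarith
  linarith

/-- Regularized Hardy inequality at the right end point. -/
lemma hardy_right {F p : ℝ → ℝ} (hF : ∀ x, HasDerivAt F (p x) x) (hp : Continuous p)
    {a b η : ℝ} (hab : a ≤ b) (hη : 0 < η) (h0 : F b = 0) :
    ∫ x in a..b, (F x / (|x - b| + η)) ^ 2 ≤ 4 * sqInt p a b := by
  have hG : ∀ x, HasDerivAt (fun x => F (-x)) (-p (-x)) x := fun x => by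
    have h1 : HasDerivAt (fun x => F (-x)) _ x := (hF (-x)).comp x (hasDerivAt_neg x)
    exact h1.congr_deriv (by ring)
  have h := hardy_left hG (by fun_prop) (neg_le_neg hab) hη (by simpa using h0)
  have e1 : ∀ x : ℝ, |x - -b| = |-x - b| := fun x => by rw [← abs_neg]; ring_nf
  simp only [sqInt, e1, neg_sq] at h
  rw [intervalIntegral.integral_comp_neg (fun x => (F x / (|x - b| + η)) ^ 2),
    intervalIntegral.integral_comp_neg (fun x => p x ^ 2)] at h
  simpa [sqInt] using h

/-- Hardy inequality for a function vanishing at the left end point, with a weight vanishing at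
the right end point. -/
lemma hardy_weight {h q : ℝ → ℝ} {Z : ℝ} (hZ : 0 ≤ Z) (hhc : Continuous h) (hq : Continuous q)
    (hh : ∀ x ∈ Ioo 0 Z, HasDerivAt h (q x) x) (h0 : h 0 = 0) :
    sqInt h 0 Z ≤ 4 * sqInt (fun x => (Z - x) * q x) 0 Z := by
  -- The boundary terms of `(Z - x) h²` vanish, at `0` because of `h` and at `Z` because of the
  -- weight. Young's inequality then absorbs half of `∫ h²`.
  have hder : ∀ x ∈ Ioo 0 Z, HasDerivAt (fun x => (Z - x) * h x ^ 2)
      (2 * (h x * ((Z - x) * q x)) - h x ^ 2) x := by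
    intro x hx
    have h1 : HasDerivAt (fun x => (Z - x) * h x ^ 2) _ x :=
      ((hasDerivAt_id x).const_sub Z).mul ((hh x hx).pow 2)
    refine h1.congr_deriv ?_
    simp
    ring
  have hint := intervalIntegral.integral_eq_sub_of_hasDerivAt_of_le hZ (by fun_prop) hder
    (Continuous.intervalIntegrable (by fun_prop) _ _)
  have hle : ∫ x in 0..Z, (2 * (h x * ((Z - x) * q x)) - h x ^ 2) ≤
      ∫ x in 0..Z, (2 * ((Z - x) * q x) ^ 2 - 1 / 2 * h x ^ 2) := by
    refine integral_mono_cont hZ (by fun_prop) (by fun_prop) fun x _ => ?_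
    nlinarith [sq_nonneg (h x - 2 * ((Z - x) * q x))]
  rw [hint, h0, integral_sub_cont (by fun_prop) (by fun_prop),
    intervalIntegral.integral_const_mul, intervalIntegral.integral_const_mul] at hle
  simp only [sqInt]
  simp at hle
  linarith

/-- The `L²` norm on an interval is controlled by that on an adjacent one and the derivative. -/
lemma sqInt_le_shell {w v : ℝ → ℝ} (hw : ∀ x, HasDerivAt w (v x) x) (hv : Continuous v)
    {a p b a' b' : ℝ} (hap : a ≤ p) (hpq : p < b) (ha : a' ≤ a) (hb : b ≤ b') :
    sqInt w a p ≤ 2 * ((p - a) / (b - p)) * sqInt w p b +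
      2 * (p - a) * (b - a) * sqInt v a' b' := by
  have hwc := continuous_of_hasDerivAt hw
  have hV : 0 ≤ sqInt v a' b' := sqInt_nonneg (by linarith)
  -- For each `y` in `[p, b]`, `w x ² ≤ 2 w y ² + 2 (w x - w y)²`, and the last square is at most
  -- `(b - a) ∫ v²`; averaging over `y` gives the claim.
  have hpt : ∀ x ∈ Icc a p, w x ^ 2 ≤ 2 / (b - p) * sqInt w p b +
      2 * (b - a) * sqInt v a' b' := by
    intro x hx
    have h1 : ∫ y in p..b, w x ^ 2 ≤ ∫ y in p..b, (2 * w y ^ 2 +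
        2 * ((b - a) * sqInt v a' b')) := by
      refine integral_mono_cont hpq.le continuous_const (by fun_prop) fun y hy => ?_
      have h2 := sq_sub_le hw hv (a := a') (b := b') (x := x) (y := y)
        ⟨by linarith [hx.1], by linarith [hx.2]⟩ ⟨by linarith [hy.1], by linarith [hy.2]⟩
      have h3 : |x - y| ≤ b - a := by
        rw [abs_le]; constructor <;> linarith [hx.1, hx.2, hy.1, hy.2]
      have h4 := h2.trans (mul_le_mul_of_nonneg_right h3 hV)
      nlinarith [sq_nonneg (w x - 2 * w y)]
    rw [integral_add_cont (by fun_prop) (by fun_prop), intervalIntegral.integral_const_mul]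
      at h1
    simp only [intervalIntegral.integral_const, smul_eq_mul] at h1
    have hpos : 0 < b - p := sub_pos.2 hpq
    have : w x ^ 2 = (b - p) * w x ^ 2 / (b - p) := by field_simp
    rw [this, div_le_iff₀ hpos]
    refine h1.trans (le_of_eq ?_)
    simp only [sqInt]
    field_simp
  calc sqInt w a p ≤ ∫ x in a..p, (2 / (b - p) * sqInt w p b +
      2 * (b - a) * sqInt v a' b') :=
        integral_mono_cont hap (hwc.pow 2) continuous_const hpt
    _ = _ := by
        simp only [intervalIntegral.integral_const, smul_eq_mul]
        have : b - p ≠ 0 := (sub_pos.2 hpq).ne'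
        field_simp

/-! ### The function `cos z - cos ζ` -/

/-- The range up to `3π/4` is that of `(z + ζ)/2` for `z ≤ π`, `ζ ≤ π/2`. Up to `π/2` this is
Jordan's inequality; beyond, the sine is at least `√2/2`, which exceeds `0.29 · 3π/4`. -/
lemma mul_le_sin_of_le {x : ℝ} (h0 : 0 ≤ x) (h1 : x ≤ 3 * π / 4) : 29 / 100 * x ≤ Real.sin x := by
  have hpi := Real.pi_lt_d4
  have hpi' := Real.pi_gt_three
  rcases le_total x (π / 2) with h | h
  · refine le_trans (mul_le_mul_of_nonneg_right ?_ h0) (Real.mul_le_sin h0 h)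
    rw [le_div_iff₀ Real.pi_pos]
    linarith
  · have e1 : Real.sin x = Real.sin (π - x) := (Real.sin_pi_sub x).symm
    have e2 : Real.sin (π / 4) ≤ Real.sin (π - x) :=
      Real.sin_le_sin_of_le_of_le_pi_div_two (by linarith) (by linarith) (by linarith)
    rw [Real.sin_pi_div_four] at e2
    have e3 : (1.4 : ℝ) ≤ √2 := Real.le_sqrt_of_sq_le (by norm_num)
    rw [e1]
    norm_num at e3
    linarith

lemma cos_sub_cos_abs (z ζ : ℝ) :
    |Real.cos z - Real.cos ζ| = 2 * |Real.sin ((z + ζ) / 2)| * |Real.sin (|z - ζ| / 2)| := by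
  have : |Real.sin (|z - ζ| / 2)| = |Real.sin ((z - ζ) / 2)| := by
    rcases abs_cases (z - ζ) with ⟨h, _⟩ | ⟨h, _⟩ <;> rw [h]
    rw [neg_div, Real.sin_neg, abs_neg]
  rw [this, Real.cos_sub_cos, abs_mul, abs_mul]
  norm_num

/-- From the product formula for the difference of cosines: the two sine bounds multiply to `2 ·
0.145 · 0.318 > 1/11`. The factor `z + ζ`, rather than only `ζ`, is what later admits the weight
`sin z`. -/
lemma le_abs_cos_sub_cos {z ζ : ℝ} (hz : z ∈ Icc 0 π) (hζ : ζ ∈ Icc 0 (π / 2)) :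
    (z + ζ) * |z - ζ| / 11 ≤ |Real.cos z - Real.cos ζ| := by
  have hpi := Real.pi_lt_d4
  have hpi' := Real.pi_gt_three
  have ht : |z - ζ| ≤ π := by
    rw [abs_le]; constructor <;> linarith [hz.1, hz.2, hζ.1, hζ.2]
  have h1 : 29 / 100 * ((z + ζ) / 2) ≤ Real.sin ((z + ζ) / 2) :=
    mul_le_sin_of_le (by linarith [hz.1, hζ.1]) (by linarith [hz.2, hζ.2])
  have h2 : 2 / π * (|z - ζ| / 2) ≤ Real.sin (|z - ζ| / 2) :=
    Real.mul_le_sin (by positivity) (by linarith)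
  have h3 : 636 / 1000 ≤ 2 / π := by
    rw [le_div_iff₀ Real.pi_pos]; linarith
  have h4 : 636 / 1000 * (|z - ζ| / 2) ≤ Real.sin (|z - ζ| / 2) :=
    (mul_le_mul_of_nonneg_right h3 (by positivity)).trans h2
  have hs : 0 ≤ z + ζ := by linarith [hz.1, hζ.1]
  rw [cos_sub_cos_abs]
  have h5 := mul_le_mul (h1.trans (le_abs_self _)) (h4.trans (le_abs_self _)) (by positivity)
    (abs_nonneg _)
  have h6 : 0 ≤ (z + ζ) * |z - ζ| := by positivity
  nlinarith

lemma mul_abs_le_abs_cos_sub_cos {z ζ : ℝ} (hz : z ∈ Icc 0 π) (hζ : ζ ∈ Icc 0 (π / 2)) :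
    ζ * |z - ζ| / 11 ≤ |Real.cos z - Real.cos ζ| := by
  refine le_trans ?_ (le_abs_cos_sub_cos hz hζ)
  have := mul_nonneg hz.1 (abs_nonneg (z - ζ))
  linarith

/-- From `1 - cos ζ = 2 sin²(ζ/2)` and Jordan's inequality, since `2 · 0.318² > 1/5`. -/
lemma sq_div_five_le {ζ : ℝ} (h0 : 0 ≤ ζ) (h1 : ζ ≤ π) : ζ ^ 2 / 5 ≤ 1 - Real.cos ζ := by
  have hpi := Real.pi_lt_d4
  have hpi' := Real.pi_gt_three
  have h := Real.mul_le_sin (x := ζ / 2) (by linarith) (by linarith)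
  have h3 : 636 / 1000 ≤ 2 / π := by
    rw [le_div_iff₀ Real.pi_pos]; linarith
  have h4 : 636 / 1000 * (ζ / 2) ≤ Real.sin (ζ / 2) :=
    (mul_le_mul_of_nonneg_right h3 (by positivity)).trans h
  have h5 : Real.cos ζ = 1 - 2 * Real.sin (ζ / 2) ^ 2 := by
    have := Real.cos_two_mul (ζ / 2)
    rw [show 2 * (ζ / 2) = ζ by ring] at this
    rw [this, Real.cos_sq']
    ring
  rw [h5]
  nlinarith [sq_nonneg ζ]

lemma half_le_sin {ζ : ℝ} (h0 : 0 ≤ ζ) (h1 : ζ ≤ π / 2) : 3 / 5 * ζ ≤ Real.sin ζ := by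
  refine le_trans (mul_le_mul_of_nonneg_right ?_ h0) (Real.mul_le_sin h0 h1)
  rw [le_div_iff₀ Real.pi_pos]
  linarith [Real.pi_lt_d4]

/-- The points of `[0, ζ]` and `[ζ, π]` at which `cos z - cos ζ = ± σ`. -/
lemma exists_level {ζ σ : ℝ} (hζ : 0 < ζ) (hζ' : ζ ≤ π / 2) (h0 : 0 ≤ σ) (h1 : σ ≤ ζ ^ 2 / 5) :
    ∃ p q : ℝ, 0 ≤ p ∧ p ≤ ζ ∧ ζ ≤ q ∧ q ≤ π ∧ Real.cos p - Real.cos ζ = σ ∧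
      Real.cos q - Real.cos ζ = -σ ∧ ζ - p ≤ 11 * σ / ζ ∧ q - ζ ≤ 11 * σ / ζ := by
  have hpi := Real.pi_gt_three
  have hpi2 := Real.pi_lt_d4
  have hle : ζ ^ 2 / 5 ≤ 1 - Real.cos ζ := sq_div_five_le hζ.le (by linarith)
  have hc0 : 0 ≤ Real.cos ζ := Real.cos_nonneg_of_neg_pi_div_two_le_of_le (by linarith) hζ'
  -- The level `cos ζ + σ` is attained because `σ ≤ ζ²/5 ≤ 1 - cos ζ`; the level `cos ζ - σ` below
  -- because `cos ζ ≥ 0` and `σ ≤ 1`.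
  obtain ⟨p, hp, hp'⟩ := intermediate_value_Icc' hζ.le Real.continuous_cos.continuousOn
    (show Real.cos ζ + σ ∈ Icc (Real.cos ζ) (Real.cos 0) by
      rw [Real.cos_zero]; constructor <;> linarith)
  obtain ⟨q, hq, hq'⟩ := intermediate_value_Icc' (show ζ ≤ π by linarith)
    Real.continuous_cos.continuousOn
    (show Real.cos ζ - σ ∈ Icc (Real.cos π) (Real.cos ζ) by
      rw [Real.cos_pi]; constructor <;> nlinarith)
  have hp1 := mul_abs_le_abs_cos_sub_cos (z := p) (ζ := ζ) ⟨hp.1, by linarith [hp.2]⟩ ⟨hζ.le, hζ'⟩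
  have hq1 := mul_abs_le_abs_cos_sub_cos (z := q) (ζ := ζ) ⟨by linarith [hq.1], hq.2⟩ ⟨hζ.le, hζ'⟩
  rw [hp', add_sub_cancel_left, abs_of_nonneg h0, abs_of_nonpos (by linarith [hp.2])] at hp1
  rw [hq', sub_sub_cancel_left, abs_neg, abs_of_nonneg h0, abs_of_nonneg (by linarith [hq.1])]
    at hq1
  refine ⟨p, q, hp.1, hp.2, hq.1, hq.2, by linarith, by linarith, ?_, ?_⟩
  · rw [le_div_iff₀ hζ]; linarith
  · rw [le_div_iff₀ hζ]; linarith

/-! ### The regularized reciprocal -/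

/-- A continuous regularization of `1 / x` at scale `s`. -/
def regInv (s x : ℝ) : ℝ := x / max (x ^ 2) (s ^ 2)

variable {s : ℝ}

lemma regInv_den_pos (hs : 0 < s) (x : ℝ) : 0 < max (x ^ 2) (s ^ 2) :=
  lt_max_of_lt_right (by positivity)

lemma continuous_regInv (hs : 0 < s) : Continuous (regInv s) := by
  unfold regInv
  fun_prop (disch := exact fun x => (regInv_den_pos hs x).ne')

lemma regInv_neg (x : ℝ) : regInv s (-x) = -regInv s x := by
  simp [regInv, neg_div]

lemma regInv_of_le (hs : 0 < s) {x : ℝ} (hx : s ≤ |x|) : regInv s x = 1 / x := by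
  have h : s ^ 2 ≤ x ^ 2 := by
    rw [← sq_abs x]; exact pow_le_pow_left₀ hs.le hx 2
  have hx0 : x ≠ 0 := by
    rintro rfl; simp at hx; linarith
  rw [regInv, max_eq_left h]
  field_simp

lemma abs_regInv_mul_le (hs : 0 < s) (x : ℝ) : |regInv s x| * |x| ≤ 1 := by
  have h := regInv_den_pos hs x
  rw [regInv, abs_div, abs_of_pos h, div_mul_eq_mul_div, div_le_one h, ← abs_mul, ← sq,
    abs_of_nonneg (sq_nonneg x)]
  exact le_max_left _ _

lemma abs_regInv_mul_scale_le (hs : 0 < s) (x : ℝ) : |regInv s x| * s ≤ 1 := by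
  have h := regInv_den_pos hs x
  rw [regInv, abs_div, abs_of_pos h, div_mul_eq_mul_div, div_le_one h]
  rcases le_total |x| s with hx | hx
  · refine le_trans ?_ (le_max_right _ _)
    rw [sq]; exact mul_le_mul_of_nonneg_right hx hs.le
  · refine le_trans ?_ (le_max_left _ _)
    rw [← sq_abs, sq]; exact mul_le_mul_of_nonneg_left hx (abs_nonneg x)

lemma mul_regInv_mem (hs : 0 < s) (x : ℝ) : 0 ≤ x * regInv s x ∧ x * regInv s x ≤ 1 := by
  have h := regInv_den_pos hs x
  rw [regInv, ← mul_div_assoc, ← sq]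
  exact ⟨by positivity, (div_le_one h).2 (le_max_left _ _)⟩

lemma one_sub_mul_regInv_eq_zero (hs : 0 < s) {x : ℝ} (hx : s ≤ |x|) :
    1 - x * regInv s x = 0 := by
  have hx0 : x ≠ 0 := by
    rintro rfl; simp at hx; linarith
  rw [regInv_of_le hs hx]
  field_simp
  ring

lemma regInv_nonneg (hs : 0 < s) {x : ℝ} (hx : 0 ≤ x) : 0 ≤ regInv s x :=
  div_nonneg hx (regInv_den_pos hs x).le

lemma regInv_nonpos (hs : 0 < s) {x : ℝ} (hx : x ≤ 0) : regInv s x ≤ 0 :=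
  div_nonpos_of_nonpos_of_nonneg hx (regInv_den_pos hs x).le

/-- The regularized reciprocal of `cos z - cos ζ` at scale `ζ ε`. -/
lemma abs_regInv_cos_le {z ζ ε : ℝ} (hz : z ∈ Icc 0 π) (hζ : 0 < ζ) (hζ' : ζ ≤ π / 2)
    (hε : 0 < ε) :
    |regInv (ζ * ε) (Real.cos z - Real.cos ζ)| ≤ 22 / ζ * (1 / (|z - ζ| + ε)) := by
  have hs : 0 < ζ * ε := by positivity
  have h1 := abs_regInv_mul_le hs (Real.cos z - Real.cos ζ)
  have h2 := abs_regInv_mul_scale_le hs (Real.cos z - Real.cos ζ)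
  have h3 := mul_abs_le_abs_cos_sub_cos hz ⟨hζ.le, hζ'⟩
  have h4 := abs_nonneg (regInv (ζ * ε) (Real.cos z - Real.cos ζ))
  set R := |regInv (ζ * ε) (Real.cos z - Real.cos ζ)|
  have h5 : R * (ζ * |z - ζ| / 11) ≤ 1 := (mul_le_mul_of_nonneg_left h3 h4).trans h1
  have hpos : 0 < |z - ζ| + ε := by positivity
  rw [div_mul_div_comm, le_div_iff₀ (by positivity)]
  have h6 : 0 ≤ R * (ζ * ε) := by positivity
  nlinarith

/-- Odd symmetry of the regularized reciprocal around a critical point. -/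
lemma integral_regInv_odd (hs : 0 < s) {H : ℝ → ℝ} (hH : Continuous H) (heven : ∀ x, H (-x) = H x)
    {ζ p q σ : ℝ} (hp : Real.cos p - Real.cos ζ = σ) (hq : Real.cos q - Real.cos ζ = -σ) :
    ∫ z in p..q, regInv s (Real.cos z - Real.cos ζ) *
      (Real.sin z * H (Real.cos z - Real.cos ζ)) = 0 := by
  have hc : Continuous fun x => regInv s x * H x := (continuous_regInv hs).mul hH
  -- The substitution `x = cos z - cos ζ` turns the integral into that of an odd function over the
  -- symmetric interval between `σ` and `-σ`.
  have h1 : ∫ z in p..q, ((fun x => regInv s x * H x) ∘ fun z => Real.cos z - Real.cos ζ) z *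
      (-Real.sin z) = ∫ x in (Real.cos p - Real.cos ζ)..(Real.cos q - Real.cos ζ),
        regInv s x * H x :=
    intervalIntegral.integral_comp_mul_deriv (fun z _ => (Real.hasDerivAt_cos z).sub_const _)
      (by fun_prop) hc
  rw [hp, hq] at h1
  have h2 : ∫ x in σ..(-σ), regInv s x * H x = 0 := by
    have h3 := intervalIntegral.integral_comp_neg (a := σ) (b := -σ) fun x => regInv s x * H x
    simp only [regInv_neg, heven, neg_neg, neg_mul, intervalIntegral.integral_neg] at h3
    linarith
  rw [h2] at h1
  simp only [Function.comp, mul_neg, intervalIntegral.integral_neg, neg_eq_zero] at h1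
  rw [← h1]
  refine intervalIntegral.integral_congr fun z _ => ?_
  ring

/-- The integral of `(|x - c| + η)⁻²`. -/
lemma sqInt_inv_le {a b c η : ℝ} (hac : a ≤ c) (hcb : c ≤ b) (hη : 0 < η) :
    sqInt (fun x => 1 / (|x - c| + η)) a b ≤ 2 / η := by
  have hne : ∀ x : ℝ, |x - c| + η ≠ 0 := fun x => by positivity
  have hc : Continuous fun x => 1 / (|x - c| + η) := by fun_prop (disch := exact hne _)
  have hc2 : Continuous fun x => (1 / (|x - c| + η)) ^ 2 := hc.pow 2
  rw [← sqInt_add_adjacent hc a c b]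
  have h1 : sqInt (fun x => 1 / (|x - c| + η)) a c = 1 / η - 1 / (c - a + η) := by
    have hder : ∀ x ∈ uIcc a c, HasDerivAt (fun x => 1 / (c - x + η))
        ((1 / (|x - c| + η)) ^ 2) x := by
      intro x hx
      rw [uIcc_of_le hac] at hx
      have hx' : 0 < c - x + η := by linarith [hx.2]
      have h1 : HasDerivAt (fun x => 1 / (c - x + η)) _ x :=
        (hasDerivAt_const x (1 : ℝ)).div (((hasDerivAt_id x).const_sub c).add_const η) hx'.ne'
      refine h1.congr_deriv ?_
      rw [abs_of_nonpos (by linarith [hx.2])]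
      simp
    rw [sqInt, intervalIntegral.integral_eq_sub_of_hasDerivAt hder (hc2.intervalIntegrable _ _)]
    simp
  have h2 : sqInt (fun x => 1 / (|x - c| + η)) c b = 1 / η - 1 / (b - c + η) := by
    have hder : ∀ x ∈ uIcc c b, HasDerivAt (fun x => -(1 / (x - c + η)))
        ((1 / (|x - c| + η)) ^ 2) x := by
      intro x hx
      rw [uIcc_of_le hcb] at hx
      have hx' : 0 < x - c + η := by linarith [hx.1]
      have h1 : HasDerivAt (fun x => -(1 / (x - c + η))) _ x :=
        ((hasDerivAt_const x (1 : ℝ)).div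
          (((hasDerivAt_id x).sub_const c).add_const η) hx'.ne').neg
      refine h1.congr_deriv ?_
      rw [abs_of_nonneg (by linarith [hx.1])]
      simp [neg_div]
    rw [sqInt, intervalIntegral.integral_eq_sub_of_hasDerivAt hder (hc2.intervalIntegrable _ _)]
    simp
    ring
  have h3 : 0 ≤ 1 / (c - a + η) := by
    have : 0 < c - a + η := by linarith
    positivity
  have h4 : 0 ≤ 1 / (b - c + η) := by
    have : 0 < b - c + η := by linarith
    positivity
  rw [h1, h2]
  have : 2 / η = 1 / η + 1 / η := by ring
  linarith

/-! ### The Rayleigh equation on a half period -/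

/-- The functions `ψ`, `p = ψ'`, `w = ψ'' + (1 - lam) ψ`, `v = w'` and `g` are related by the
Rayleigh equation `g + (c₀ + μ ψ) + (cos z - μ) w = 0`. -/
structure Rayleigh (μ lam c₀ : ℝ) (ψ p w v g : ℝ → ℝ) : Prop where
  hψ : ∀ x, HasDerivAt ψ (p x) x
  hp : ∀ x, HasDerivAt p (w x + (lam - 1) * ψ x) x
  hw : ∀ x, HasDerivAt w (v x) x
  hv : Continuous v
  eq : ∀ x, g x + (c₀ + μ * ψ x) + (Real.cos x - μ) * w x = 0

/-- Neumann or Dirichlet boundary conditions on `[0, π]`, for even and odd functions. -/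
def BoundaryCond (ψ p : ℝ → ℝ) : Prop := (p 0 = 0 ∧ p π = 0) ∨ (ψ 0 = 0 ∧ ψ π = 0)

/-- The right-hand side of the key estimate at scale `ε`. -/
def rhsT (ζ ε A V : ℝ) : ℝ := A / (ζ * ε) + ζ * ε ^ 3 * V

lemma rhsT_nonneg {ζ ε A V : ℝ} (hζ : 0 < ζ) (hε : 0 < ε) (hA : 0 ≤ A) (hV : 0 ≤ V) :
    0 ≤ rhsT ζ ε A V := by
  unfold rhsT; positivity

namespace Rayleigh

variable {μ lam c₀ ζ ε : ℝ} {ψ p w v g : ℝ → ℝ}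

lemma cψ (h : Rayleigh μ lam c₀ ψ p w v g) : Continuous ψ := continuous_of_hasDerivAt h.hψ
lemma cp (h : Rayleigh μ lam c₀ ψ p w v g) : Continuous p := continuous_of_hasDerivAt h.hp
lemma cw (h : Rayleigh μ lam c₀ ψ p w v g) : Continuous w := continuous_of_hasDerivAt h.hw

lemma g_eq (h : Rayleigh μ lam c₀ ψ p w v g) :
    g = fun x => -(c₀ + μ * ψ x) - (Real.cos x - μ) * w x := by
  funext x; linarith [h.eq x]

lemma cg (h : Rayleigh μ lam c₀ ψ p w v g) : Continuous g := by
  have h1 := h.cψ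
  have h2 := h.cw
  rw [h.g_eq]
  fun_prop

lemma boundary_zero (hB : BoundaryCond ψ p) : p 0 * ψ 0 = 0 ∧ p π * ψ π = 0 := by
  rcases hB with ⟨h1, h2⟩ | ⟨h1, h2⟩ <;> simp [h1, h2]

/-- Integration by parts of `w` against a test function. -/
lemma integral_w_mul (h : Rayleigh μ lam c₀ ψ p w v g) {η η' : ℝ → ℝ}
    (hη : ∀ x, HasDerivAt η (η' x) x) (hη' : Continuous η') (a b : ℝ) :
    ∫ x in a..b, w x * η x = p b * η b - p a * η a -
      ∫ x in a..b, (p x * η' x + (lam - 1) * (ψ x * η x)) := by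
  have hηc := continuous_of_hasDerivAt hη
  have h1 := h.cψ
  have h2 := h.cw
  have h3 := h.cp
  have hder : ∀ x ∈ uIcc a b, HasDerivAt (fun x => p x * η x)
      (w x * η x + (p x * η' x + (lam - 1) * (ψ x * η x))) x := fun x _ =>
    ((h.hp x).mul (hη x)).congr_deriv (by ring)
  have := intervalIntegral.integral_eq_sub_of_hasDerivAt hder
    (Continuous.intervalIntegrable (by fun_prop) _ _)
  rw [integral_add_cont (by fun_prop) (by fun_prop)] at this
  linarith

/-- Either boundary condition kills the boundary term `p ψ`. This is where the quadratic form `∫ ψ'²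
+ (lam - 1) ψ²` comes from. -/
lemma energy_identity (h : Rayleigh μ lam c₀ ψ p w v g) (hB : BoundaryCond ψ p) :
    ∫ x in 0..π, w x * ψ x = -(sqInt p 0 π + (lam - 1) * sqInt ψ 0 π) := by
  have h1 := h.cψ
  have h3 := h.cp
  obtain ⟨b1, b2⟩ := boundary_zero hB
  rw [h.integral_w_mul h.hψ h.cp, b1, b2]
  have e : ∀ x, p x * p x + (lam - 1) * (ψ x * ψ x) = p x ^ 2 + (lam - 1) * ψ x ^ 2 := by
    intro x; ring
  simp only [e]
  rw [integral_add_cont (by fun_prop) (by fun_prop), intervalIntegral.integral_const_mul]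
  simp [sqInt]

/-- Control of `χ = c₀ + μ ψ` at the critical point. -/
lemma critical_value_le (h : Rayleigh (Real.cos ζ) lam c₀ ψ p w v g) (hζ : 0 < ζ)
    (hζ' : ζ ≤ π / 2) (hε : 0 < ε) (hεζ : ε ≤ ζ / 44) :
    (c₀ + Real.cos ζ * ψ ζ) ^ 2 / ζ ≤
      10 ^ 5 * (rhsT ζ ε (sqInt g 0 π) (sqInt v 0 π) + ε / ζ * sqInt p 0 π) := by
  have hpi := Real.pi_gt_three
  -- The equation is tested against `sin` on the window `|cos z - cos ζ| ≤ ζ ε`. Its length is at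
  -- most `22 ε` and the integral of `sin` over it is exactly `2 ζ ε`, so the constant `χ` can be
  -- isolated.
  obtain ⟨a, b, ha0, haζ, hζb, hbπ, hca, hcb, hal, hbl⟩ := exists_level (σ := ζ * ε) hζ hζ'
    (by positivity) (by nlinarith)
  have hal' : ζ - a ≤ 11 * ε := hal.trans (le_of_eq (by field_simp))
  have hbl' : b - ζ ≤ 11 * ε := hbl.trans (le_of_eq (by field_simp))
  have hab : a ≤ b := haζ.trans hζb
  have cψ := h.cψ
  have cw := h.cw
  have cg := h.cg
  have cp := h.cp
  have cv := h.hv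
  set χ := c₀ + Real.cos ζ * ψ ζ with hχ
  have hA := sqInt_nonneg (F := g) Real.pi_pos.le
  have hP := sqInt_nonneg (F := p) Real.pi_pos.le
  have hV := sqInt_nonneg (F := v) Real.pi_pos.le
  set A := sqInt g 0 π
  set P := sqInt p 0 π
  set V := sqInt v 0 π
  have hsin : sqInt Real.sin a b ≤ 22 * ε * (4 * ζ ^ 2) := by
    have h1 : sqInt Real.sin a b ≤ ∫ x in a..b, 4 * ζ ^ 2 := by
      refine integral_mono_cont hab (Real.continuous_sin.pow 2) continuous_const fun x hx => ?_
      have h1 : |Real.sin x| ≤ 2 * ζ := by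
        refine Real.abs_sin_le_abs.trans ?_
        rw [abs_of_nonneg (by linarith [hx.1])]
        linarith [hx.2]
      rw [← sq_abs]
      nlinarith [abs_nonneg (Real.sin x)]
    refine h1.trans ?_
    simp only [intervalIntegral.integral_const, smul_eq_mul]
    exact mul_le_mul_of_nonneg_right (by linarith) (by positivity)
  have i1 : (∫ x in a..b, Real.sin x * g x) ^ 2 ≤ 22 * ε * (4 * ζ ^ 2) * A :=
    (integral_mul_sq_le hab Real.continuous_sin cg).trans
      (mul_le_mul hsin (sqInt_mono_interval ha0 hab hbπ cg) (sqInt_nonneg hab) (by positivity))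
  have i2 : (∫ x in a..b, Real.sin x * (ψ x - ψ ζ)) ^ 2 ≤
      22 * ε * (4 * ζ ^ 2) * (22 * ε * (11 * ε * P)) := by
    refine (integral_mul_sq_le hab Real.continuous_sin (by fun_prop)).trans
      (mul_le_mul hsin ?_ (sqInt_nonneg hab) (by positivity))
    have h1 : sqInt (fun x => ψ x - ψ ζ) a b ≤ ∫ x in a..b, 11 * ε * P := by
      refine integral_mono_cont hab (by fun_prop) continuous_const fun x hx => ?_
      refine (sq_sub_le h.hψ cp (a := 0) (b := π) ⟨by linarith [hx.1], by linarith [hx.2]⟩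
        ⟨hζ.le, by linarith⟩).trans (mul_le_mul_of_nonneg_right ?_ hP)
      rw [abs_le]; constructor <;> linarith [hx.1, hx.2]
    refine h1.trans ?_
    simp only [intervalIntegral.integral_const, smul_eq_mul]
    exact mul_le_mul_of_nonneg_right (by linarith) (by positivity)
  have i3 : (∫ x in a..b, Real.sin x * (Real.cos x - Real.cos ζ) * w x) ^ 2 ≤
      22 * ε * ((ζ * ε) ^ 4 / 4) * V := by
    -- A primitive of `sin x (cos x - cos ζ)` that vanishes at both ends of the window: integration
    -- by parts replaces `w` by `v`, and `0 ≤ G ≤ (ζ ε)²/2` supplies the powers of `ε` in front of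
    -- `V`.
    set G : ℝ → ℝ := fun x => ((ζ * ε) ^ 2 - (Real.cos x - Real.cos ζ) ^ 2) / 2 with hG
    have hGder : ∀ x, HasDerivAt G (Real.sin x * (Real.cos x - Real.cos ζ)) x := by
      intro x
      have h1 : HasDerivAt G _ x :=
        ((((Real.hasDerivAt_cos x).sub_const (Real.cos ζ)).pow 2).const_sub ((ζ * ε) ^ 2)).div_const 2
      refine h1.congr_deriv ?_
      simp
      ring
    have hGc := continuous_of_hasDerivAt hGder
    have hder : ∀ x ∈ uIcc a b, HasDerivAt (fun x => G x * w x)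
        (Real.sin x * (Real.cos x - Real.cos ζ) * w x + G x * v x) x := fun x _ =>
      (hGder x).mul (h.hw x)
    have hint := intervalIntegral.integral_eq_sub_of_hasDerivAt hder
      (Continuous.intervalIntegrable (by fun_prop) _ _)
    rw [integral_add_cont (by fun_prop) (by fun_prop)] at hint
    have ga : G a = 0 := by simp [hG, hca]
    have gb : G b = 0 := by simp [hG, hcb]
    rw [ga, gb] at hint
    have e : ∫ x in a..b, Real.sin x * (Real.cos x - Real.cos ζ) * w x =
      -∫ x in a..b, G x * v x := by linarith
    rw [e, neg_sq]
    refine (integral_mul_sq_le hab hGc cv).trans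
      (mul_le_mul ?_ (sqInt_mono_interval ha0 hab hbπ cv) (sqInt_nonneg hab) (by positivity))
    have h1 : sqInt G a b ≤ ∫ x in a..b, (ζ * ε) ^ 4 / 4 := by
      refine integral_mono_cont hab (by fun_prop) continuous_const fun x hx => ?_
      have hx0 : 0 ≤ x := ha0.trans hx.1
      have hxπ : x ≤ π := hx.2.trans hbπ
      have h1 : Real.cos x ≤ Real.cos a := Real.cos_le_cos_of_nonneg_of_le_pi ha0 hxπ hx.1
      have h2 : Real.cos b ≤ Real.cos x := Real.cos_le_cos_of_nonneg_of_le_pi hx0 hbπ hx.2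
      have h3 : (Real.cos x - Real.cos ζ) ^ 2 ≤ (ζ * ε) ^ 2 := by
        apply sq_le_sq'
        · linarith
        · linarith
      have h4 : 0 ≤ G x := by simp only [hG]; linarith
      have h5 : G x ≤ (ζ * ε) ^ 2 / 2 := by
        simp only [hG]; nlinarith [sq_nonneg (Real.cos x - Real.cos ζ)]
      nlinarith
    refine h1.trans ?_
    simp only [intervalIntegral.integral_const, smul_eq_mul]
    exact mul_le_mul_of_nonneg_right (by linarith) (by positivity)
  have hsum : 2 * (ζ * ε) * χ = -(∫ x in a..b, Real.sin x * g x) -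
      Real.cos ζ * (∫ x in a..b, Real.sin x * (ψ x - ψ ζ)) -
      ∫ x in a..b, Real.sin x * (Real.cos x - Real.cos ζ) * w x := by
    have e0 : ∫ x in a..b, (Real.sin x * g x + Real.cos ζ * (Real.sin x * (ψ x - ψ ζ)) +
        Real.sin x * (Real.cos x - Real.cos ζ) * w x + χ * Real.sin x) = ∫ x in a..b, (0 : ℝ) := by
      refine intervalIntegral.integral_congr fun x _ => ?_
      have := h.eq x
      simp only [hχ]
      linear_combination Real.sin x * this
    rw [integral_add_cont (by fun_prop) (by fun_prop), integral_add_cont (by fun_prop) (by fun_prop),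
      integral_add_cont (by fun_prop) (by fun_prop), intervalIntegral.integral_const_mul,
      intervalIntegral.integral_const_mul, integral_sin, intervalIntegral.integral_zero] at e0
    have : Real.cos a - Real.cos b = 2 * (ζ * ε) := by linarith
    rw [this] at e0
    linarith
  set X := ∫ x in a..b, Real.sin x * g x
  set Y := ∫ x in a..b, Real.sin x * (ψ x - ψ ζ)
  set Z := ∫ x in a..b, Real.sin x * (Real.cos x - Real.cos ζ) * w x
  have hμ : Real.cos ζ ^ 2 ≤ 1 := Real.cos_sq_le_one ζ
  have hsq : (2 * (ζ * ε) * χ) ^ 2 ≤ 3 * (X ^ 2 + Y ^ 2 + Z ^ 2) := by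
    rw [hsum]
    have hY : (Real.cos ζ * Y) ^ 2 ≤ Y ^ 2 := by
      rw [mul_pow]; exact mul_le_of_le_one_left (sq_nonneg _) hμ
    nlinarith [sq_nonneg (X - Real.cos ζ * Y), sq_nonneg (X - Z), sq_nonneg (Real.cos ζ * Y - Z)]
  have hfin : (2 * (ζ * ε) * χ) ^ 2 ≤ 3 * (22 * ε * (4 * ζ ^ 2) * A +
    22 * ε * (4 * ζ ^ 2) * (22 * ε * (11 * ε * P)) + 22 * ε * ((ζ * ε) ^ 4 / 4) * V) := by linarith
  have e1 : χ ^ 2 / ζ = (2 * (ζ * ε) * χ) ^ 2 / (4 * ζ ^ 3 * ε ^ 2) := by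
    field_simp
    ring
  rw [e1, div_le_iff₀ (by positivity)]
  refine hfin.trans ?_
  have e2 : (rhsT ζ ε A V + ε / ζ * P) * (4 * ζ ^ 3 * ε ^ 2) =
      4 * (ζ ^ 2 * ε * A) + 4 * (ζ ^ 4 * ε ^ 5 * V) + 4 * (ζ ^ 2 * ε ^ 3 * P) := by
    unfold rhsT
    field_simp
  rw [mul_assoc (10 ^ 5 : ℝ), e2]
  have k1 : 0 ≤ ζ ^ 2 * ε * A := by positivity
  have k2 : 0 ≤ ζ ^ 4 * ε ^ 5 * V := by positivity
  have k3 : 0 ≤ ζ ^ 2 * ε ^ 3 * P := by positivity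
  linarith

/-- Control of `w` near the critical point, in terms of the critical value. -/
lemma sqInt_w_critical_le (h : Rayleigh (Real.cos ζ) lam c₀ ψ p w v g) (hζ : 0 < ζ)
    (hζ' : ζ ≤ π / 2) (hε : 0 < ε) (hεζ : ε ≤ ζ / 44) :
    ζ * ε * sqInt w (ζ - 11 * ε) (ζ + 11 * ε) ≤
      5000 * (rhsT ζ ε (sqInt g 0 π) (sqInt v 0 π) + (c₀ + Real.cos ζ * ψ ζ) ^ 2 / ζ +
        ε / ζ * sqInt p 0 π) := by
  have hpi := Real.pi_gt_three
  have cψ := h.cψ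
  have cw := h.cw
  have cg := h.cg
  have cp := h.cp
  have cv := h.hv
  -- Inside the window the equation says little about `w`. On the adjacent shell `[ζ + 11 ε, ζ + 33
  -- ε]` one has `|cos x - cos ζ| ≥ ζ ε`, so `w` is read off from the equation there and carried
  -- back with the help of `v`. The hypothesis `ε ≤ ζ/44` keeps both intervals inside `[0, π]`.
  have h1 := sqInt_le_shell h.hw cv (a := ζ - 11 * ε) (p := ζ + 11 * ε) (b := ζ + 33 * ε)
    (a' := 0) (b' := π) (by linarith) (by linarith) (by linarith) (by linarith)
  set χ := c₀ + Real.cos ζ * ψ ζ with hχ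
  have hA := sqInt_nonneg (F := g) Real.pi_pos.le
  have hP := sqInt_nonneg (F := p) Real.pi_pos.le
  have hV := sqInt_nonneg (F := v) Real.pi_pos.le
  have hAm := sqInt_mono_interval (F := g) (a := 0) (b := π) (p := ζ + 11 * ε) (q := ζ + 33 * ε)
    (by linarith) (by linarith) (by linarith) cg
  set A := sqInt g 0 π
  set P := sqInt p 0 π
  set V := sqInt v 0 π
  have hμ : Real.cos ζ ^ 2 ≤ 1 := Real.cos_sq_le_one ζ
  have h2 : (ζ * ε) ^ 2 * sqInt w (ζ + 11 * ε) (ζ + 33 * ε) ≤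
      3 * A + 22 * ε * (3 * χ ^ 2 + 3 * (33 * ε * P)) := by
    rw [← sqInt_const_mul]
    have h3 : sqInt (fun x => ζ * ε * w x) (ζ + 11 * ε) (ζ + 33 * ε) ≤
        ∫ x in (ζ + 11 * ε)..(ζ + 33 * ε), (3 * g x ^ 2 + (3 * χ ^ 2 + 3 * (33 * ε * P))) := by
      refine integral_mono_cont (by linarith) (by fun_prop) (by fun_prop) fun x hx => ?_
      have hxI : x ∈ Icc 0 π := ⟨by linarith [hx.1], by linarith [hx.2]⟩
      have h4 := mul_abs_le_abs_cos_sub_cos hxI ⟨hζ.le, hζ'⟩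
      rw [abs_of_nonneg (show 0 ≤ x - ζ by linarith [hx.1])] at h4
      have h5 : ζ * ε ≤ |Real.cos x - Real.cos ζ| := by
        refine le_trans ?_ h4
        nlinarith [hx.1]
      have h6 : (ζ * ε) ^ 2 ≤ (Real.cos x - Real.cos ζ) ^ 2 := by
        rw [← sq_abs (Real.cos x - Real.cos ζ)]
        exact pow_le_pow_left₀ (by positivity) h5 2
      have h7 : (ψ x - ψ ζ) ^ 2 ≤ 33 * ε * P := by
        refine (sq_sub_le h.hψ cp hxI ⟨hζ.le, by linarith⟩).trans
          (mul_le_mul_of_nonneg_right ?_ hP)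
        rw [abs_of_nonneg (show 0 ≤ x - ζ by linarith [hx.1])]
        linarith [hx.2]
      have h8 : (Real.cos ζ * (ψ x - ψ ζ)) ^ 2 ≤ 33 * ε * P := by
        rw [mul_pow]; exact (mul_le_of_le_one_left (sq_nonneg _) hμ).trans h7
      have h9 : (Real.cos x - Real.cos ζ) * w x = -(g x + χ + Real.cos ζ * (ψ x - ψ ζ)) := by
        have := h.eq x
        simp only [hχ]
        linear_combination this
      have h10 : (ζ * ε * w x) ^ 2 ≤ (g x + χ + Real.cos ζ * (ψ x - ψ ζ)) ^ 2 := by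
        calc (ζ * ε * w x) ^ 2 = (ζ * ε) ^ 2 * w x ^ 2 := by ring
          _ ≤ (Real.cos x - Real.cos ζ) ^ 2 * w x ^ 2 :=
            mul_le_mul_of_nonneg_right h6 (sq_nonneg _)
          _ = ((Real.cos x - Real.cos ζ) * w x) ^ 2 := by ring
          _ = _ := by rw [h9, neg_sq]
      nlinarith [sq_nonneg (g x - χ), sq_nonneg (g x - Real.cos ζ * (ψ x - ψ ζ)),
        sq_nonneg (χ - Real.cos ζ * (ψ x - ψ ζ))]
    refine h3.trans ?_
    rw [integral_add_cont (by fun_prop) (by fun_prop), intervalIntegral.integral_const_mul]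
    simp only [intervalIntegral.integral_const, smul_eq_mul]
    change 3 * sqInt g _ _ + _ ≤ _
    have : ζ + 33 * ε - (ζ + 11 * ε) = 22 * ε := by ring
    rw [this]
    linarith
  have e1 : (ζ + 11 * ε - (ζ - 11 * ε)) / (ζ + 33 * ε - (ζ + 11 * ε)) = 1 := by
    rw [show ζ + 11 * ε - (ζ - 11 * ε) = 22 * ε by ring,
      show ζ + 33 * ε - (ζ + 11 * ε) = 22 * ε by ring, div_self (by positivity)]
  rw [e1] at h1
  set B := sqInt w (ζ + 11 * ε) (ζ + 33 * ε)
  have hB : B ≤ (3 * A + 22 * ε * (3 * χ ^ 2 + 3 * (33 * ε * P))) / (ζ * ε) ^ 2 := by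
    rw [le_div_iff₀ (by positivity)]; linarith
  have h3 : ζ * ε * sqInt w (ζ - 11 * ε) (ζ + 11 * ε) ≤
      ζ * ε * (2 * ((3 * A + 22 * ε * (3 * χ ^ 2 + 3 * (33 * ε * P))) / (ζ * ε) ^ 2) +
        1936 * ε ^ 2 * V) := by
    refine mul_le_mul_of_nonneg_left ?_ (by positivity)
    refine h1.trans ?_
    have : 2 * (ζ + 11 * ε - (ζ - 11 * ε)) * (ζ + 33 * ε - (ζ - 11 * ε)) * V =
      1936 * ε ^ 2 * V := by ring
    rw [this]
    linarith
  refine h3.trans ?_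
  have e2 : ζ * ε * (2 * ((3 * A + 22 * ε * (3 * χ ^ 2 + 3 * (33 * ε * P))) / (ζ * ε) ^ 2) +
        1936 * ε ^ 2 * V) = 6 * (A / (ζ * ε)) + 132 * (χ ^ 2 / ζ) + 4356 * (ε / ζ * P) +
          1936 * (ζ * ε ^ 3 * V) := by
    field_simp
    ring
  rw [e2]
  unfold rhsT
  have k1 : 0 ≤ A / (ζ * ε) := by positivity
  have k2 : 0 ≤ χ ^ 2 / ζ := by positivity
  have k3 : 0 ≤ ε / ζ * P := by positivity
  have k4 : 0 ≤ ζ * ε ^ 3 * V := by positivity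
  linarith

/-- Control of `w` near the critical point. -/
lemma sqInt_w_critical_le' (h : Rayleigh (Real.cos ζ) lam c₀ ψ p w v g) (hζ : 0 < ζ)
    (hζ' : ζ ≤ π / 2) (hε : 0 < ε) (hεζ : ε ≤ ζ / 44) :
    ζ * ε * sqInt w (ζ - 11 * ε) (ζ + 11 * ε) ≤
      10 ^ 9 * (rhsT ζ ε (sqInt g 0 π) (sqInt v 0 π) + ε / ζ * sqInt p 0 π) := by
  have h1 := h.sqInt_w_critical_le hζ hζ' hε hεζ
  have h2 := h.critical_value_le hζ hζ' hε hεζ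
  have hA := sqInt_nonneg (F := g) Real.pi_pos.le
  have hP := sqInt_nonneg (F := p) Real.pi_pos.le
  have hV := sqInt_nonneg (F := v) Real.pi_pos.le
  have hT := rhsT_nonneg hζ hε hA hV
  have k3 : 0 ≤ ε / ζ * sqInt p 0 π := by positivity
  linarith

end Rayleigh

/-! ### Weighted bounds for `w` on the whole half period -/

namespace Rayleigh

variable {μ lam c₀ ζ ε : ℝ} {ψ p w v g : ℝ → ℝ}

set_option maxHeartbeats 800000 in
/-- Weighted estimate of `w` on the half period in terms of the critical value and `ψ'`. -/
lemma sqInt_weight_mul_w_le (h : Rayleigh (Real.cos ζ) lam c₀ ψ p w v g) (hζ : 0 < ζ)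
    (hζ' : ζ ≤ π / 2) (hε : 0 < ε) (hεζ : ε ≤ ζ / 44) {ω : ℝ → ℝ} (hω : Continuous ω)
    (hω1 : ∀ z ∈ Icc (ζ - 11 * ε) (ζ + 11 * ε), |ω z| ≤ 2)
    (hω2 : ∀ z ∈ Icc 0 π, |ω z| * (ζ * |z - ζ|) ≤ 11 * |Real.cos z - Real.cos ζ|) :
    sqInt (fun z => ω z * w z) 0 π ≤ 22000 / (ζ * ε) *
      (rhsT ζ ε (sqInt g 0 π) (sqInt v 0 π) + (c₀ + Real.cos ζ * ψ ζ) ^ 2 / ζ +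
        ε / ζ * sqInt p 0 π) := by
  have hpi := Real.pi_gt_three
  have cψ := h.cψ
  have cw := h.cw
  have cg := h.cg
  have cp := h.cp
  have hZ := h.sqInt_w_critical_le hζ hζ' hε hεζ
  set χ := c₀ + Real.cos ζ * ψ ζ with hχ
  have hA := sqInt_nonneg (F := g) Real.pi_pos.le
  have hP := sqInt_nonneg (F := p) Real.pi_pos.le
  have hV := sqInt_nonneg (F := v) Real.pi_pos.le
  have hT := rhsT_nonneg hζ hε hA hV
  have hμ : Real.cos ζ ^ 2 ≤ 1 := Real.cos_sq_le_one ζ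
  have hne : ∀ x : ℝ, |x - ζ| + ε ≠ 0 := fun x => by positivity
  -- Off the window, `w = -(g + χ + cos ζ (ψ - ψ ζ))/(cos x - cos ζ)`. The three terms of `Q`
  -- majorize the three contributions: `g` by the distance `11 ε`, `χ` by the integrable square of
  -- `1/(|x - ζ| + ε)`, and `ψ - ψ ζ` by Hardy's inequality.
  set Q : ℝ → ℝ := fun x => g x ^ 2 / (144 * ε ^ 2) + χ ^ 2 * (1 / (|x - ζ| + ε)) ^ 2 +
    ((ψ x - ψ ζ) / (|x - ζ| + ε)) ^ 2 with hQ
  have hQc : Continuous Q := by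
    simp only [hQ]; fun_prop (disch := exact hne _)
  have hQ0 : ∀ x, 0 ≤ Q x := fun x => by simp only [hQ]; positivity
  have hpt : ∀ x ∈ Icc 0 π, 11 * ε ≤ |x - ζ| → (ω x * w x) ^ 2 ≤ 432 / ζ ^ 2 * Q x := by
    intro x hx ht
    set t := |x - ζ| with htd
    have ht0 : 0 < t := by linarith
    set b := Real.cos x - Real.cos ζ
    have hb : |b| * |w x| = |g x + χ + Real.cos ζ * (ψ x - ψ ζ)| := by
      rw [← abs_mul, ← abs_neg]
      congr 1
      simp only [hχ, b]
      linear_combination -(h.eq x)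
    have h1 : |ω x| * (ζ * t) ≤ 11 * |b| := hω2 x hx
    have h2 : |ω x * w x| * (ζ * (t + ε)) ≤ 12 * |g x + χ + Real.cos ζ * (ψ x - ψ ζ)| := by
      rw [← hb, abs_mul]
      have h3 : |ω x| * (ζ * (t + ε)) ≤ 12 * |b| := by
        have : |ω x| * (ζ * ε) ≤ |ω x| * (ζ * (t / 11)) := by
          gcongr; linarith
        nlinarith
      have := mul_le_mul_of_nonneg_right h3 (abs_nonneg (w x))
      nlinarith
    have h3 : (ω x * w x) ^ 2 * (ζ * (t + ε)) ^ 2 ≤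
        144 * (g x + χ + Real.cos ζ * (ψ x - ψ ζ)) ^ 2 := by
      have := pow_le_pow_left₀ (by positivity) h2 2
      rw [mul_pow |_|, mul_pow 12, sq_abs, sq_abs] at this
      linarith
    have h4 : (g x + χ + Real.cos ζ * (ψ x - ψ ζ)) ^ 2 ≤
        3 * (g x ^ 2 + χ ^ 2 + (ψ x - ψ ζ) ^ 2) := by
      have : (Real.cos ζ * (ψ x - ψ ζ)) ^ 2 ≤ (ψ x - ψ ζ) ^ 2 := by
        rw [mul_pow]; exact mul_le_of_le_one_left (sq_nonneg _) hμ
      nlinarith [sq_nonneg (g x - χ), sq_nonneg (g x - Real.cos ζ * (ψ x - ψ ζ)),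
        sq_nonneg (χ - Real.cos ζ * (ψ x - ψ ζ))]
    have h5 : g x ^ 2 / (t + ε) ^ 2 ≤ g x ^ 2 / (144 * ε ^ 2) := by
      gcongr
      nlinarith
    have e : (ω x * w x) ^ 2 = (ω x * w x) ^ 2 * (ζ * (t + ε)) ^ 2 / (ζ * (t + ε)) ^ 2 := by
      field_simp
    calc (ω x * w x) ^ 2 = (ω x * w x) ^ 2 * (ζ * (t + ε)) ^ 2 / (ζ * (t + ε)) ^ 2 := e
      _ ≤ (144 * (3 * (g x ^ 2 + χ ^ 2 + (ψ x - ψ ζ) ^ 2))) / (ζ * (t + ε)) ^ 2 := by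
        exact div_le_div_of_nonneg_right (by linarith) (by positivity)
      _ = 432 / ζ ^ 2 * (g x ^ 2 / (t + ε) ^ 2 + χ ^ 2 * (1 / (t + ε)) ^ 2 +
          ((ψ x - ψ ζ) / (t + ε)) ^ 2) := by
        field_simp
        ring
      _ ≤ 432 / ζ ^ 2 * Q x := by
        simp only [hQ]
        gcongr
  have hQi : ∫ x in 0..π, Q x ≤ sqInt g 0 π / (144 * ε ^ 2) + χ ^ 2 * (2 / ε) +
      4 * sqInt p 0 π := by
    have e : ∀ x, Q x = g x ^ 2 / (144 * ε ^ 2) + χ ^ 2 * (1 / (|x - ζ| + ε)) ^ 2 +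
      ((ψ x - ψ ζ) / (|x - ζ| + ε)) ^ 2 := fun x => rfl
    have hsub : ∀ x, HasDerivAt (fun x => ψ x - ψ ζ) (p x) x := fun x => (h.hψ x).sub_const _
    have hr := hardy_right hsub cp hζ.le hε (sub_self _)
    have hl := hardy_left hsub cp (show ζ ≤ π by linarith) hε (sub_self _)
    have hc : Continuous fun x => ((ψ x - ψ ζ) / (|x - ζ| + ε)) ^ 2 := by
      fun_prop (disch := exact hne _)
    have hadj := integral_adjacent_cont hc 0 ζ π
    have hpadj := sqInt_add_adjacent cp 0 ζ π
    have hinv := sqInt_inv_le (a := 0) (b := π) hζ.le (show ζ ≤ π by linarith) hε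
    simp only [e]
    rw [integral_add_cont (by fun_prop (disch := exact hne _)) hc,
      integral_add_cont (by fun_prop) (by fun_prop (disch := exact hne _)),
      intervalIntegral.integral_div, intervalIntegral.integral_const_mul]
    have := mul_le_mul_of_nonneg_left hinv (sq_nonneg χ)
    simp only [sqInt] at *
    linarith
  have hωw : Continuous fun z => ω z * w z := hω.mul cw
  have s1 : sqInt (fun z => ω z * w z) 0 (ζ - 11 * ε) ≤
      432 / ζ ^ 2 * ∫ x in 0..(ζ - 11 * ε), Q x := by
    rw [← intervalIntegral.integral_const_mul]
    refine integral_mono_cont (by linarith) (hωw.pow 2) (by fun_prop) fun x hx => ?_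
    refine hpt x ⟨hx.1, by linarith [hx.2]⟩ ?_
    rw [abs_of_nonpos (by linarith [hx.2])]
    linarith [hx.2]
  have s3 : sqInt (fun z => ω z * w z) (ζ + 11 * ε) π ≤
      432 / ζ ^ 2 * ∫ x in (ζ + 11 * ε)..π, Q x := by
    rw [← intervalIntegral.integral_const_mul]
    refine integral_mono_cont (by linarith) (hωw.pow 2) (by fun_prop) fun x hx => ?_
    refine hpt x ⟨by linarith [hx.1], hx.2⟩ ?_
    rw [abs_of_nonneg (by linarith [hx.1])]
    linarith [hx.1]
  have s2 : sqInt (fun z => ω z * w z) (ζ - 11 * ε) (ζ + 11 * ε) ≤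
      4 * sqInt w (ζ - 11 * ε) (ζ + 11 * ε) := by
    have : sqInt (fun z => ω z * w z) (ζ - 11 * ε) (ζ + 11 * ε) ≤
        sqInt (fun z => 2 * w z) (ζ - 11 * ε) (ζ + 11 * ε) := by
      refine sqInt_mono (by linarith) hωw (by fun_prop) fun x hx => ?_
      rw [mul_pow, mul_pow]
      refine mul_le_mul_of_nonneg_right ?_ (sq_nonneg _)
      rw [← sq_abs]
      exact pow_le_pow_left₀ (abs_nonneg _) (hω1 x hx) 2
    rw [sqInt_const_mul] at this
    linarith
  have q1 := integral_adjacent_cont hQc 0 (ζ - 11 * ε) (ζ + 11 * ε)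
  have q2 := integral_adjacent_cont hQc 0 (ζ + 11 * ε) π
  have q3 : 0 ≤ ∫ x in (ζ - 11 * ε)..(ζ + 11 * ε), Q x :=
    intervalIntegral.integral_nonneg (by linarith) fun x _ => hQ0 x
  have w1 := sqInt_add_adjacent hωw 0 (ζ - 11 * ε) (ζ + 11 * ε)
  have w2 := sqInt_add_adjacent hωw 0 (ζ + 11 * ε) π
  have hζ2 : 0 < 432 / ζ ^ 2 := by positivity
  have hsum : sqInt (fun z => ω z * w z) 0 π ≤ 4 * sqInt w (ζ - 11 * ε) (ζ + 11 * ε) +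
      432 / ζ ^ 2 * (sqInt g 0 π / (144 * ε ^ 2) + χ ^ 2 * (2 / ε) + 4 * sqInt p 0 π) := by
    have : 432 / ζ ^ 2 * (∫ x in 0..(ζ - 11 * ε), Q x) +
        432 / ζ ^ 2 * (∫ x in (ζ + 11 * ε)..π, Q x) ≤
        432 / ζ ^ 2 * (sqInt g 0 π / (144 * ε ^ 2) + χ ^ 2 * (2 / ε) + 4 * sqInt p 0 π) := by
      rw [← mul_add]
      exact mul_le_mul_of_nonneg_left (by linarith) hζ2.le
    linarith
  have hZ' : sqInt w (ζ - 11 * ε) (ζ + 11 * ε) ≤ 5000 / (ζ * ε) *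
      (rhsT ζ ε (sqInt g 0 π) (sqInt v 0 π) + χ ^ 2 / ζ + ε / ζ * sqInt p 0 π) := by
    rw [div_mul_eq_mul_div, le_div_iff₀ (by positivity)]
    linarith
  refine hsum.trans ?_
  set A := sqInt g 0 π
  set P := sqInt p 0 π
  set V := sqInt v 0 π
  have e1 : 432 / ζ ^ 2 * (A / (144 * ε ^ 2) + χ ^ 2 * (2 / ε) + 4 * P) =
      1 / (ζ * ε) * (3 * (A / (ζ * ε)) + 864 * (χ ^ 2 / ζ) + 1728 * (ε / ζ * P)) := by
    field_simp
    ring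
  have e2 : A / (ζ * ε) ≤ rhsT ζ ε A V := by
    unfold rhsT
    have : 0 ≤ ζ * ε ^ 3 * V := by positivity
    linarith
  have k1 : 0 ≤ χ ^ 2 / ζ := by positivity
  have k2 : 0 ≤ ε / ζ * P := by positivity
  have e3 : 1 / (ζ * ε) * (3 * (A / (ζ * ε)) + 864 * (χ ^ 2 / ζ) + 1728 * (ε / ζ * P)) ≤
      1 / (ζ * ε) * (2000 * (rhsT ζ ε A V + χ ^ 2 / ζ + ε / ζ * P)) := by
    refine mul_le_mul_of_nonneg_left ?_ (by positivity)
    linarith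
  rw [e1]
  have e4 : 22000 / (ζ * ε) * (rhsT ζ ε A V + χ ^ 2 / ζ + ε / ζ * P) =
    4 * (5000 / (ζ * ε) * (rhsT ζ ε A V + χ ^ 2 / ζ + ε / ζ * P)) +
      1 / (ζ * ε) * (2000 * (rhsT ζ ε A V + χ ^ 2 / ζ + ε / ζ * P)) := by ring
  rw [e4]
  linarith

lemma sqInt_w_le (h : Rayleigh (Real.cos ζ) lam c₀ ψ p w v g) (hζ : 0 < ζ)
    (hζ' : ζ ≤ π / 2) (hε : 0 < ε) (hεζ : ε ≤ ζ / 44) :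
    sqInt w 0 π ≤ 22000 / (ζ * ε) *
      (rhsT ζ ε (sqInt g 0 π) (sqInt v 0 π) + (c₀ + Real.cos ζ * ψ ζ) ^ 2 / ζ +
        ε / ζ * sqInt p 0 π) := by
  have := h.sqInt_weight_mul_w_le hζ hζ' hε hεζ (ω := fun _ => 1) continuous_const
    (fun z _ => by norm_num) fun z hz => by
      have := mul_abs_le_abs_cos_sub_cos hz ⟨hζ.le, hζ'⟩
      rw [abs_one]; linarith
  simpa using this

/-- The weight is `sin z / ζ`. Its growth in `z` is compensated by the factor `z + ζ` of
`le_abs_cos_sub_cos`, so the bound gains `ζ²` over the unweighted one. -/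
lemma sqInt_sin_mul_w_le (h : Rayleigh (Real.cos ζ) lam c₀ ψ p w v g) (hζ : 0 < ζ)
    (hζ' : ζ ≤ π / 2) (hε : 0 < ε) (hεζ : ε ≤ ζ / 44) :
    sqInt (fun z => Real.sin z * w z) 0 π ≤ ζ ^ 2 * (22000 / (ζ * ε) *
      (rhsT ζ ε (sqInt g 0 π) (sqInt v 0 π) + (c₀ + Real.cos ζ * ψ ζ) ^ 2 / ζ +
        ε / ζ * sqInt p 0 π)) := by
  have hb : ∀ z : ℝ, 0 ≤ z → |ζ⁻¹ * Real.sin z| ≤ z / ζ := fun z hz => by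
    rw [abs_mul, abs_of_pos (inv_pos.2 hζ), ← div_eq_inv_mul]
    gcongr
    exact Real.abs_sin_le_abs.trans (le_of_eq (abs_of_nonneg hz))
  have := h.sqInt_weight_mul_w_le hζ hζ' hε hεζ (ω := fun z => ζ⁻¹ * Real.sin z) (by fun_prop)
    (fun z hz => (hb z (by linarith [hz.1])).trans (by
      rw [div_le_iff₀ hζ]; linarith [hz.2])) fun z hz => by
      have h1 := le_abs_cos_sub_cos hz ⟨hζ.le, hζ'⟩
      have h2 := hb z hz.1
      calc |ζ⁻¹ * Real.sin z| * (ζ * |z - ζ|) ≤ z / ζ * (ζ * |z - ζ|) := by gcongr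
        _ = z * |z - ζ| := by field_simp
        _ ≤ _ := by nlinarith [mul_nonneg hζ.le (abs_nonneg (z - ζ))]
  have e : sqInt (fun z => Real.sin z * w z) 0 π =
      ζ ^ 2 * sqInt (fun z => ζ⁻¹ * Real.sin z * w z) 0 π := by
    rw [← sqInt_const_mul]
    congr 1
    funext z
    field_simp
  rw [e]
  exact mul_le_mul_of_nonneg_left this (by positivity)

end Rayleigh

/-- The vanishing is required only when the outer interval is nondegenerate: for `p = a` the
function need not vanish at `a`. This is the situation when the window around `ζ` sticks out of `[a,
b]`. -/
lemma integral_eq_of_zero_outside {H : ℝ → ℝ} (hH : Continuous H) {a b p q : ℝ} (hap : a ≤ p)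
    (hqb : q ≤ b) (h1 : a < p → ∀ x ∈ Icc a p, H x = 0)
    (h2 : q < b → ∀ x ∈ Icc q b, H x = 0) :
    ∫ x in a..b, H x = ∫ x in p..q, H x := by
  have e1 : ∫ x in a..p, H x = 0 := by
    rcases hap.eq_or_lt with rfl | hlt
    · exact intervalIntegral.integral_same
    rw [intervalIntegral.integral_congr (g := fun _ => 0), intervalIntegral.integral_zero]
    intro x hx
    rw [uIcc_of_le hap] at hx
    exact h1 hlt x hx
  have e2 : ∫ x in q..b, H x = 0 := by
    rcases hqb.eq_or_lt with rfl | hlt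
    · exact intervalIntegral.integral_same
    rw [intervalIntegral.integral_congr (g := fun _ => 0), intervalIntegral.integral_zero]
    intro x hx
    rw [uIcc_of_le hqb] at hx
    exact h2 hlt x hx
  have := integral_adjacent_cont hH a p q
  have := integral_adjacent_cont hH a q b
  linarith

/-- Both-sided regularized Hardy inequality around an interior point. -/
lemma hardy_interior {F p : ℝ → ℝ} (hF : ∀ x, HasDerivAt F (p x) x) (hp : Continuous p)
    {a b c η : ℝ} (hac : a ≤ c) (hcb : c ≤ b) (hη : 0 < η) :
    sqInt (fun x => (F x - F c) / (|x - c| + η)) a b ≤ 4 * sqInt p a b := by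
  have hFc := continuous_of_hasDerivAt hF
  have hne : ∀ x : ℝ, |x - c| + η ≠ 0 := fun x => by positivity
  have hc : Continuous fun x => (F x - F c) / (|x - c| + η) := by
    fun_prop (disch := exact hne _)
  have hsub : ∀ x, HasDerivAt (fun x => F x - F c) (p x) x := fun x => (hF x).sub_const _
  have hr := hardy_right hsub hp hac hη (sub_self _)
  have hl := hardy_left hsub hp hcb hη (sub_self _)
  have h1 := sqInt_add_adjacent hc a c b
  have h2 := sqInt_add_adjacent hp a c b
  simp only [sqInt] at *
  linarith

/-- Agmon's inequality on `[0, π]` for the norm `∫ ψ'² + l⁻² ψ²`. -/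
lemma abs_le_of_energy {ψ p : ℝ → ℝ} (hψ : ∀ x, HasDerivAt ψ (p x) x) (hp : Continuous p)
    {l e : ℝ} (hl : 0 < l) (hl1 : l ≤ 1) (he : 0 ≤ e) (hP : sqInt p 0 π ≤ e ^ 2)
    (hΨ : sqInt ψ 0 π ≤ l ^ 2 * e ^ 2) {x : ℝ} (hx : x ∈ Icc 0 π) :
    |ψ x| ≤ 2 * √l * e := by
  have hpi := Real.pi_gt_three
  have cψ := continuous_of_hasDerivAt hψ
  -- The difference `ψ x ² - ψ y ²` is `2 ∫ ψ p`, at most `2 (l e) e`. Averaging over `y` adds the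
  -- mean of `ψ²`, which is at most `l e²` since `l ≤ 1`.
  have h1 : ∀ y ∈ Icc 0 π, ψ x ^ 2 ≤ ψ y ^ 2 + 2 * (l * e ^ 2) := by
    intro y hy
    have hd : ∀ t ∈ uIcc y x, HasDerivAt (fun t => ψ t ^ 2) (2 * (ψ t * p t)) t := fun t _ => by
      have h1 : HasDerivAt (fun t => ψ t ^ 2) _ t := (hψ t).pow 2
      refine h1.congr_deriv ?_
      simp; ring
    have hint := intervalIntegral.integral_eq_sub_of_hasDerivAt hd
      (Continuous.intervalIntegrable (by fun_prop) _ _)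
    rw [intervalIntegral.integral_const_mul] at hint
    have h2 : |∫ t in y..x, ψ t * p t| ≤ l * e ^ 2 := by
      calc |∫ t in y..x, ψ t * p t| ≤ |(∫ t in y..x, |ψ t * p t|)| :=
            by simpa only [Real.norm_eq_abs] using
              intervalIntegral.norm_integral_le_abs_integral_norm (f := fun t => ψ t * p t)
        _ ≤ ∫ t in 0..π, |ψ t| * |p t| := by
            simp only [abs_mul]
            have hc : Continuous fun t => |ψ t| * |p t| := by fun_prop
            rcases le_total y x with hyx | hyx
            · rw [abs_of_nonneg (intervalIntegral.integral_nonneg hyx fun t _ => by positivity)]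
              exact integral_subinterval hy.1 hyx hx.2 hc.continuousOn fun t _ => by positivity
            · rw [intervalIntegral.integral_symm, abs_neg,
                abs_of_nonneg (intervalIntegral.integral_nonneg hyx fun t _ => by positivity)]
              exact integral_subinterval hx.1 hyx hy.2 hc.continuousOn fun t _ => by positivity
        _ ≤ √(sqInt ψ 0 π) * √(sqInt p 0 π) := integral_abs_mul_le Real.pi_pos.le cψ hp
        _ ≤ (l * e) * e := by
            refine mul_le_mul ?_ ?_ (Real.sqrt_nonneg _) (by positivity)
            · exact Real.sqrt_le_iff.2 ⟨by positivity, by rw [mul_pow]; exact hΨ⟩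
            · exact Real.sqrt_le_iff.2 ⟨he, hP⟩
        _ = l * e ^ 2 := by ring
    have := (abs_le.1 h2).2
    nlinarith
  have h2 : ∫ y in 0..π, ψ x ^ 2 ≤ ∫ y in 0..π, (ψ y ^ 2 + 2 * (l * e ^ 2)) :=
    integral_mono_cont Real.pi_pos.le continuous_const (by fun_prop) h1
  rw [integral_add_cont (by fun_prop) (by fun_prop)] at h2
  simp only [intervalIntegral.integral_const, smul_eq_mul, sub_zero] at h2
  have h3 : ψ x ^ 2 ≤ 3 * (l * e ^ 2) := by
    have h4 : sqInt ψ 0 π ≤ l * e ^ 2 := hΨ.trans (by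
      refine mul_le_mul_of_nonneg_right ?_ (sq_nonneg e)
      nlinarith)
    simp only [sqInt] at h4
    have h5 : 0 ≤ l * e ^ 2 := by positivity
    nlinarith
  refine abs_le_of_sq_le_sq ?_ (by positivity)
  rw [mul_pow, mul_pow, Real.sq_sqrt hl.le]
  nlinarith [mul_nonneg hl.le (sq_nonneg e)]

/-! ### The regularized form: the part localized at the critical point -/

namespace Rayleigh

variable {μ lam c₀ ζ ε l e : ℝ} {ψ p w v g : ℝ → ℝ}

/-- The localized part of `w` tested against a bounded function. -/
lemma abs_integral_cutoff_le (h : Rayleigh (Real.cos ζ) lam c₀ ψ p w v g) (hζ : 0 < ζ)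
    (hζ' : ζ ≤ π / 2) (hε : 0 < ε) {η : ℝ → ℝ} (hη : Continuous η) {a b M : ℝ}
    (ha : 0 ≤ a) (hb : b ≤ π) (haζ : a ≤ ζ) (hζb : ζ ≤ b) (hM : 0 ≤ M)
    (hηM : ∀ x ∈ Icc a b, |x - ζ| ≤ 11 * ε → |η x| ≤ M) :
    |∫ x in a..b, (1 - (Real.cos x - Real.cos ζ) *
        regInv (ζ * ε) (Real.cos x - Real.cos ζ)) * w x * η x| ≤
      M * (√(22 * ε) * √(sqInt w (ζ - 11 * ε) (ζ + 11 * ε))) := by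
  have cw := h.cw
  have hs : 0 < ζ * ε := by positivity
  have cr := continuous_regInv hs
  set k : ℝ → ℝ := fun x => 1 - (Real.cos x - Real.cos ζ) *
    regInv (ζ * ε) (Real.cos x - Real.cos ζ) with hk
  have ck : Continuous k := by simp only [hk]; fun_prop
  -- At distance `11 ε` from `ζ`, `|cos x - cos ζ|` has reached the scale `ζ ε`, beyond which
  -- `regInv` is the exact reciprocal.
  have hk0 : ∀ x ∈ Icc a b, 11 * ε ≤ |x - ζ| → k x = 0 := by
    intro x hx ht
    refine one_sub_mul_regInv_eq_zero hs ?_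
    have h4 := mul_abs_le_abs_cos_sub_cos (z := x) ⟨by linarith [hx.1], by linarith [hx.2]⟩
      ⟨hζ.le, hζ'⟩
    refine le_trans ?_ h4
    nlinarith
  have hk1 : ∀ x, |k x| ≤ 1 := by
    intro x
    have := mul_regInv_mem hs (Real.cos x - Real.cos ζ)
    simp only [hk]
    rw [abs_le]
    constructor <;> linarith [this.1, this.2]
  change |∫ x in a..b, k x * w x * η x| ≤ _
  have hap : a ≤ max a (ζ - 11 * ε) := le_max_left _ _
  have hqb : min b (ζ + 11 * ε) ≤ b := min_le_left _ _
  have hpq : max a (ζ - 11 * ε) ≤ min b (ζ + 11 * ε) := by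
    refine max_le (le_min ?_ ?_) (le_min ?_ ?_) <;> linarith
  rw [integral_eq_of_zero_outside (by fun_prop) hap hqb]
  · have h1 : |∫ x in (max a (ζ - 11 * ε))..(min b (ζ + 11 * ε)), k x * w x * η x| ≤
        M * (√(sqInt (fun _ => 1) (max a (ζ - 11 * ε)) (min b (ζ + 11 * ε))) *
          √(sqInt w (max a (ζ - 11 * ε)) (min b (ζ + 11 * ε)))) := by
      refine abs_integral_le_of_abs_le_mul hpq hM (by fun_prop) continuous_const cw
        fun x hx => ?_
      have hx1 : a ≤ x := hap.trans hx.1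
      have hx2 : x ≤ b := hx.2.trans hqb
      have hx3 : ζ - 11 * ε ≤ x := (le_max_right _ _).trans hx.1
      have hx4 : x ≤ ζ + 11 * ε := hx.2.trans (min_le_right _ _)
      have h2 := hηM x ⟨hx1, hx2⟩ (by rw [abs_le]; constructor <;> linarith)
      rw [abs_mul, abs_mul, abs_one, one_mul]
      calc |k x| * |w x| * |η x| ≤ 1 * |w x| * M := by
            gcongr
            exact hk1 x
        _ = M * |w x| := by ring
    refine h1.trans (mul_le_mul_of_nonneg_left ?_ hM)
    refine mul_le_mul ?_ ?_ (Real.sqrt_nonneg _) (Real.sqrt_nonneg _)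
    · rw [sqInt_one]
      refine Real.sqrt_le_sqrt ?_
      linarith [min_le_right b (ζ + 11 * ε), le_max_right a (ζ - 11 * ε)]
    · exact Real.sqrt_le_sqrt (sqInt_mono_interval (le_max_right _ _) hpq (min_le_right _ _) cw)
  · intro hlt x hx
    have h5 : x ≤ ζ - 11 * ε := by
      rcases lt_max_iff.1 hlt with h5 | h5
      · exact absurd h5 (lt_irrefl _)
      · exact hx.2.trans (le_of_eq (max_eq_right h5.le))
    rw [hk0 x ⟨hx.1, hx.2.trans (hpq.trans hqb)⟩, zero_mul, zero_mul]
    rw [abs_of_nonpos (by linarith)]; linarith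
  · intro hlt x hx
    have h5 : ζ + 11 * ε ≤ x := by
      rcases min_lt_iff.1 hlt with h5 | h5
      · exact absurd h5 (lt_irrefl _)
      · exact (le_of_eq (min_eq_right h5.le).symm).trans hx.1
    rw [hk0 x ⟨hap.trans (hpq.trans hx.1), hx.2⟩, zero_mul, zero_mul]
    rw [abs_of_nonneg (by linarith)]; linarith

end Rayleigh

/-! ### The regularized form: the principal value -/

namespace Rayleigh

variable {μ lam c₀ ζ ε l e : ℝ} {ψ p w v g : ℝ → ℝ}

set_option maxHeartbeats 800000 in
/-- Principal value part of the regularized form, near the critical point. -/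
lemma abs_integral_pv_inner_le (h : Rayleigh (Real.cos ζ) lam c₀ ψ p w v g) (hζ : 0 < ζ)
    (hζ' : ζ ≤ π / 2) (hε : 0 < ε) (hl : 0 < l) (hlζ : l ≤ ζ) (he : 0 ≤ e)
    (hP : sqInt p 0 π ≤ e ^ 2) {S : ℝ} (hS0 : 0 ≤ S) (hSl : S ≤ 2 * √l * e)
    (hS : ∀ x ∈ Icc 0 π, |ψ x| ≤ S) {a b : ℝ} (ha : 0 ≤ a) (haζ : a ≤ ζ) (hζb : ζ ≤ b)
    (hb : b ≤ π) (hal : ζ - a ≤ l / 4) (hbl : b - ζ ≤ l / 4)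
    (hca : Real.cos a - Real.cos ζ = ζ * l / 44) (hcb : Real.cos b - Real.cos ζ = -(ζ * l / 44)) :
    |∫ x in a..b, regInv (ζ * ε) (Real.cos x - Real.cos ζ) *
      ((c₀ + Real.cos ζ * ψ x) * ψ x)| ≤
      22 / ζ * (|c₀ + Real.cos ζ * ψ ζ| + 3 * Real.cos ζ * S) * (4 * (√l * e)) := by
  have hpi := Real.pi_gt_three
  have cψ := h.cψ
  have cp := h.cp
  have hs : 0 < ζ * ε := by positivity
  have cr := continuous_regInv hs
  have hab : a ≤ b := haζ.trans hζb
  have hne : ∀ x : ℝ, |x - ζ| + ε ≠ 0 := fun x => by positivity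
  have hζI : ζ ∈ Icc 0 π := ⟨hζ.le, by linarith⟩
  have hμ0 : 0 ≤ Real.cos ζ := Real.cos_nonneg_of_neg_pi_div_two_le_of_le (by linarith) hζ'
  have hβ : 3 / 5 * ζ ≤ Real.sin ζ := half_le_sin hζ.le hζ'
  have hβ0 : 0 < Real.sin ζ := lt_of_lt_of_le (by positivity) hβ
  set χ := c₀ + Real.cos ζ * ψ ζ with hχ
  set β := Real.sin ζ with hβd
  set μ := Real.cos ζ with hμd
  set M := |χ| + 3 * μ * S with hM
  have hM0 : 0 ≤ M := by positivity
  -- By oddness a multiple of `sin x` can be subtracted at no cost. Taking `χ ψ(ζ) sin x / sin ζ`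
  -- makes the remaining factor vanish at `ζ`: it is bounded by `|ψ x - ψ ζ|`, to which Hardy
  -- applies, and by `|x - ζ|`, which cancels the singularity.
  have hzero := integral_regInv_odd hs (H := fun _ => 1) continuous_const (fun _ => rfl) hca hcb
  have e1 : ∫ x in a..b, regInv (ζ * ε) (Real.cos x - μ) * ((c₀ + μ * ψ x) * ψ x) =
      ∫ x in a..b, regInv (ζ * ε) (Real.cos x - μ) *
        ((c₀ + μ * ψ x) * ψ x - χ * ψ ζ * (Real.sin x / β)) := by
    have e2 : ∀ x, regInv (ζ * ε) (Real.cos x - μ) *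
        ((c₀ + μ * ψ x) * ψ x - χ * ψ ζ * (Real.sin x / β)) =
        regInv (ζ * ε) (Real.cos x - μ) * ((c₀ + μ * ψ x) * ψ x) -
          χ * ψ ζ / β * (regInv (ζ * ε) (Real.cos x - μ) * (Real.sin x * 1)) := by
      intro x; ring
    simp only [e2]
    rw [integral_sub_cont (by fun_prop) (by fun_prop), intervalIntegral.integral_const_mul, hzero]
    ring
  rw [e1]
  set F : ℝ → ℝ := fun x => (ψ x - ψ ζ) / (|x - ζ| + ε) with hF
  have cF : Continuous F := by simp only [hF]; fun_prop (disch := exact hne _)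
  have hpt : ∀ x ∈ Icc a b, |regInv (ζ * ε) (Real.cos x - μ) *
      ((c₀ + μ * ψ x) * ψ x - χ * ψ ζ * (Real.sin x / β))| ≤
      22 / ζ * M * (|F x| * |(1 : ℝ)|) + 22 / ζ * M * (S / β) := by
    intro x hx
    have hxI : x ∈ Icc 0 π := ⟨ha.trans hx.1, hx.2.trans hb⟩
    have hr := abs_regInv_cos_le hxI hζ hζ' hε
    set t := |x - ζ| with ht
    have ht0 : 0 ≤ t := abs_nonneg _
    have hsx := hS x hxI
    have hsζ := hS ζ hζI
    have hd : (c₀ + μ * ψ x) * ψ x - χ * ψ ζ * (Real.sin x / β) =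
        (χ + μ * ψ x) * (ψ x - ψ ζ) +
        χ * ψ ζ * ((β - Real.sin x) / β) := by
      have : β ≠ 0 := hβ0.ne'
      simp only [hχ]
      field_simp
      ring
    have hs1 : |(β - Real.sin x) / β| ≤ t / β := by
      rw [abs_div, abs_of_pos hβ0]
      gcongr
      rw [ht, abs_sub_comm x ζ]
      have := Real.abs_sin_sub_sin_le ζ x
      exact this
    have hb1 : |χ + μ * ψ x| ≤ M := by
      refine (abs_add_le _ _).trans ?_
      rw [abs_mul, abs_of_nonneg hμ0]
      nlinarith [mul_le_mul_of_nonneg_left hsx hμ0, mul_nonneg hμ0 hS0]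
    have hχM : |χ| ≤ M := by
      rw [hM]; nlinarith [mul_nonneg hμ0 hS0]
    have hb2 : |(c₀ + μ * ψ x) * ψ x - χ * ψ ζ * (Real.sin x / β)| ≤
        M * |ψ x - ψ ζ| + M * (S * (t / β)) := by
      rw [hd]
      refine (abs_add_le _ _).trans ?_
      rw [abs_mul, abs_mul, abs_mul, mul_assoc |χ|]
      gcongr
    rw [abs_mul]
    have h3 : |F x| = |ψ x - ψ ζ| / (t + ε) := by
      rw [hF, abs_div, abs_of_pos (show 0 < |x - ζ| + ε by positivity)]
    have h4 : t / (t + ε) ≤ 1 := (div_le_one (by positivity)).2 (by linarith)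
    calc _ ≤ 22 / ζ * (1 / (t + ε)) * (M * |ψ x - ψ ζ| + M * (S * (t / β))) := by
          gcongr
      _ = 22 / ζ * M * (|F x| * |(1 : ℝ)|) + 22 / ζ * M * (S / β) * (t / (t + ε)) := by
          rw [h3, abs_one]
          field_simp
      _ ≤ _ := by
          have : 22 / ζ * M * (S / β) * (t / (t + ε)) ≤ 22 / ζ * M * (S / β) * 1 := by
            gcongr
          linarith
  have hlen : b - a ≤ l / 2 := by linarith
  have hH := hardy_interior h.hψ cp (a := 0) (b := π) hζ.le hζI.2 hε
  have hFi : ∫ x in a..b, |F x| * |(1 : ℝ)| ≤ 2 * (√l * e) := by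
    refine (integral_abs_mul_le hab cF continuous_const).trans ?_
    have h5 : √(sqInt F a b) ≤ 2 * e := by
      refine Real.sqrt_le_iff.2 ⟨by positivity, ?_⟩
      refine (sqInt_mono_interval ha hab hb cF).trans (hH.trans ?_)
      nlinarith
    have h6 : √(sqInt (fun _ => (1 : ℝ)) a b) ≤ √l := by
      rw [sqInt_one]; exact Real.sqrt_le_sqrt (by linarith)
    calc _ ≤ 2 * e * √l := mul_le_mul h5 h6 (Real.sqrt_nonneg _) (by positivity)
      _ = _ := by ring
  have hSi : (b - a) * (S / β) ≤ 2 * (√l * e) := by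
    have h7 : S / β ≤ 2 * √l * e / (3 / 5 * ζ) := by gcongr
    have h8 : (b - a) * (S / β) ≤ ζ / 2 * (2 * √l * e / (3 / 5 * ζ)) :=
      mul_le_mul (by linarith) h7 (by positivity) (by positivity)
    have h9 : ζ / 2 * (2 * √l * e / (3 / 5 * ζ)) = 5 / 3 * (√l * e) := by
      field_simp
    have : 0 ≤ √l * e := by positivity
    linarith
  calc _ ≤ ∫ x in a..b, |regInv (ζ * ε) (Real.cos x - μ) *
      ((c₀ + μ * ψ x) * ψ x - χ * ψ ζ * (Real.sin x / β))| :=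
        intervalIntegral.abs_integral_le_integral_abs hab
    _ ≤ ∫ x in a..b, (22 / ζ * M * (|F x| * |(1 : ℝ)|) + 22 / ζ * M * (S / β)) :=
        integral_mono_cont hab (by fun_prop) (by fun_prop) hpt
    _ = 22 / ζ * M * ((∫ x in a..b, |F x| * |(1 : ℝ)|) + (b - a) * (S / β)) := by
        rw [integral_add_cont (by fun_prop) (by fun_prop), intervalIntegral.integral_const_mul]
        simp only [intervalIntegral.integral_const, smul_eq_mul]
        ring
    _ ≤ 22 / ζ * M * (4 * (√l * e)) := by
        refine mul_le_mul_of_nonneg_left ?_ (by positivity)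
        exact (add_le_add hFi hSi).trans (le_of_eq (by ring))

/-- The regularized form away from the critical point. -/
lemma abs_integral_pv_outer_le (h : Rayleigh (Real.cos ζ) lam c₀ ψ p w v g) (hζ : 0 < ζ)
    (hζ' : ζ ≤ π / 2) (hε : 0 < ε) (hl : 0 < l) (he : 0 ≤ e)
    (hΨ : sqInt ψ 0 π ≤ l ^ 2 * e ^ 2) {S : ℝ} (hS0 : 0 ≤ S)
    (hS : ∀ x ∈ Icc 0 π, |ψ x| ≤ S) {a b : ℝ} (ha : 0 ≤ a) (hab : a ≤ b)
    (hb : b ≤ π) (hout : ∀ x ∈ Icc a b, ζ * l / 44 ≤ |Real.cos x - Real.cos ζ|) :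
    |∫ x in a..b, regInv (ζ * ε) (Real.cos x - Real.cos ζ) *
      ((c₀ + Real.cos ζ * ψ x) * ψ x)| ≤
      55 / ζ * (|c₀ + Real.cos ζ * ψ ζ| + 3 * Real.cos ζ * S) * (2 * (√l * e)) := by
  have hpi := Real.pi_gt_three
  have cψ := h.cψ
  have hs : 0 < ζ * ε := by positivity
  have cr := continuous_regInv hs
  have hζI : ζ ∈ Icc 0 π := ⟨hζ.le, by linarith⟩
  have hμ0 : 0 ≤ Real.cos ζ := Real.cos_nonneg_of_neg_pi_div_two_le_of_le (by linarith) hζ'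
  have hne : ∀ x : ℝ, |x - ζ| + l ≠ 0 := fun x => by positivity
  set χ := c₀ + Real.cos ζ * ψ ζ with hχ
  set μ := Real.cos ζ with hμd
  set M := |χ| + 3 * μ * S with hM
  have hM0 : 0 ≤ M := by positivity
  have cG : Continuous fun x => 1 / (|x - ζ| + l) := by fun_prop (disch := exact hne _)
  have hmain : |∫ x in a..b, regInv (ζ * ε) (Real.cos x - μ) * ((c₀ + μ * ψ x) * ψ x)| ≤
      55 / ζ * M * (√(sqInt ψ a b) * √(sqInt (fun x => 1 / (|x - ζ| + l)) a b)) := by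
    refine abs_integral_le_of_abs_le_mul hab (by positivity) (by fun_prop) cψ cG fun x hx => ?_
    have hxI : x ∈ Icc 0 π := ⟨ha.trans hx.1, hx.2.trans hb⟩
    have h1 := abs_regInv_mul_le hs (Real.cos x - μ)
    have h2 := hout x hx
    have h3 := mul_abs_le_abs_cos_sub_cos hxI ⟨hζ.le, hζ'⟩
    set R := |regInv (ζ * ε) (Real.cos x - μ)|
    set t := |x - ζ|
    -- `55 = 11 + 44`: `ζ t` is at most `11 |cos x - cos ζ|` everywhere, and `ζ l` is at most `44
    -- |cos x - cos ζ|` by `hout`.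
    have h4 : R ≤ 55 / ζ * (1 / (t + l)) := by
      have h5 : R * (ζ * (t + l)) ≤ 55 := by
        have h6 : ζ * (t + l) ≤ 55 * |Real.cos x - μ| := by linarith
        have := mul_le_mul_of_nonneg_left h6 (abs_nonneg (regInv (ζ * ε) (Real.cos x - μ)))
        nlinarith
      rw [div_mul_div_comm, le_div_iff₀ (by positivity)]
      linarith
    have hsx := hS x hxI
    have hsζ := hS ζ hζI
    have h7 : |c₀ + μ * ψ x| ≤ M := by
      have : c₀ + μ * ψ x = χ + μ * ψ x - μ * ψ ζ := by rw [hχ]; ring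
      rw [this]
      refine (abs_sub _ _).trans ?_
      have h8 := abs_add_le χ (μ * ψ x)
      rw [abs_mul μ (ψ x), abs_of_nonneg hμ0] at h8
      rw [abs_mul, abs_of_nonneg hμ0, hM]
      nlinarith [mul_le_mul_of_nonneg_left hsx hμ0, mul_le_mul_of_nonneg_left hsζ hμ0,
        mul_nonneg hμ0 hS0]
    rw [abs_mul, abs_mul, abs_of_pos (show 0 < 1 / (t + l) by positivity)]
    calc R * (|c₀ + μ * ψ x| * |ψ x|) ≤ 55 / ζ * (1 / (t + l)) * (M * |ψ x|) := by gcongr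
      _ = _ := by ring
  refine hmain.trans (mul_le_mul_of_nonneg_left ?_ (by positivity))
  have h9 : √(sqInt ψ a b) ≤ l * e := by
    refine Real.sqrt_le_iff.2 ⟨by positivity, ?_⟩
    rw [mul_pow]
    exact (sqInt_mono_interval ha hab hb cψ).trans hΨ
  have h10 : √(sqInt (fun x => 1 / (|x - ζ| + l)) a b) ≤ 2 / √l := by
    refine Real.sqrt_le_iff.2 ⟨by positivity, ?_⟩
    refine (sqInt_mono_interval ha hab hb cG).trans
      ((sqInt_inv_le hζ.le hζI.2 hl).trans ?_)
    rw [div_pow, Real.sq_sqrt hl.le]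
    gcongr
    norm_num
  calc _ ≤ l * e * (2 / √l) := mul_le_mul h9 h10 (Real.sqrt_nonneg _) (by positivity)
    _ = 2 * (√l * e) := by
        have h11 : √l ≠ 0 := (Real.sqrt_pos.2 hl).ne'
        have h12 := Real.mul_self_sqrt hl.le
        field_simp
        nlinarith

/-- The whole regularized form. -/
lemma abs_integral_pv_le (h : Rayleigh (Real.cos ζ) lam c₀ ψ p w v g) (hζ : 0 < ζ)
    (hζ' : ζ ≤ π / 2) (hε : 0 < ε) (hl : 0 < l) (hl1 : l ≤ 1) (hlζ : l ≤ ζ) (he : 0 ≤ e)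
    (hP : sqInt p 0 π ≤ e ^ 2) (hΨ : sqInt ψ 0 π ≤ l ^ 2 * e ^ 2) :
    |∫ x in 0..π, regInv (ζ * ε) (Real.cos x - Real.cos ζ) *
      ((c₀ + Real.cos ζ * ψ x) * ψ x)| ≤
      310 / ζ * (|c₀ + Real.cos ζ * ψ ζ| + 3 * Real.cos ζ * (2 * √l * e)) * (√l * e) := by
  have hpi := Real.pi_gt_three
  have cψ := h.cψ
  have hs : 0 < ζ * ε := by positivity
  have cr := continuous_regInv hs
  have hS : ∀ x ∈ Icc 0 π, |ψ x| ≤ 2 * √l * e := fun x hx =>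
    abs_le_of_energy h.hψ h.cp hl hl1 he hP hΨ hx
  -- Cancellation is used at the length scale `l`, not `ε`: the window between the levels `± ζ l /
  -- 44` extends at most `l / 4` to each side of `ζ`, and outside it plain Cauchy–Schwarz with `∫
  -- (|x - ζ| + l)⁻² ≤ 2 / l` suffices.
  obtain ⟨a, b, ha0, haζ, hζb, hbπ, hca, hcb, hal, hbl⟩ := exists_level (σ := ζ * l / 44) hζ hζ'
    (by positivity) (by nlinarith)
  have hal' : ζ - a ≤ l / 4 := hal.trans (le_of_eq (by field_simp; norm_num))
  have hbl' : b - ζ ≤ l / 4 := hbl.trans (le_of_eq (by field_simp; norm_num))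
  have h1 := h.abs_integral_pv_inner_le hζ hζ' hε hl hlζ he hP (by positivity) le_rfl hS ha0 haζ
    hζb hbπ hal' hbl' hca hcb
  have h2 := h.abs_integral_pv_outer_le hζ hζ' hε hl he hΨ (by positivity) hS le_rfl ha0
    (by linarith) fun x hx => by
      have h3 : Real.cos a ≤ Real.cos x :=
        Real.cos_le_cos_of_nonneg_of_le_pi hx.1 (by linarith) hx.2
      exact le_trans (by linarith) (le_abs_self _)
  have h3 := h.abs_integral_pv_outer_le hζ hζ' hε hl he hΨ (by positivity) hS
    (show 0 ≤ b by linarith) hbπ le_rfl fun x hx => by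
      have h3 : Real.cos x ≤ Real.cos b :=
        Real.cos_le_cos_of_nonneg_of_le_pi (by linarith) hx.2 hx.1
      exact le_trans (by linarith) (neg_le_abs _)
  have hc : Continuous fun x => regInv (ζ * ε) (Real.cos x - Real.cos ζ) *
      ((c₀ + Real.cos ζ * ψ x) * ψ x) := by fun_prop
  rw [← integral_adjacent_cont hc 0 a π, ← integral_adjacent_cont hc a b π]
  set M := |c₀ + Real.cos ζ * ψ ζ| + 3 * Real.cos ζ * (2 * √l * e)
  have e1 : 310 / ζ * M * (√l * e) = 22 / ζ * M * (4 * (√l * e)) +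
    (55 / ζ * M * (2 * (√l * e)) + 55 / ζ * M * (2 * (√l * e))) + 2 / ζ * M * (√l * e) := by ring
  have hμ0 : 0 ≤ Real.cos ζ := Real.cos_nonneg_of_neg_pi_div_two_le_of_le (by linarith) hζ'
  have hpos : 0 ≤ 2 / ζ * M * (√l * e) := by positivity
  rw [e1]
  have t1 := abs_add_le (∫ x in 0..a, regInv (ζ * ε) (Real.cos x - Real.cos ζ) *
      ((c₀ + Real.cos ζ * ψ x) * ψ x)) ((∫ x in a..b, regInv (ζ * ε) (Real.cos x - Real.cos ζ) *
      ((c₀ + Real.cos ζ * ψ x) * ψ x)) + ∫ x in b..π, regInv (ζ * ε) (Real.cos x - Real.cos ζ) *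
      ((c₀ + Real.cos ζ * ψ x) * ψ x))
  have t2 := abs_add_le (∫ x in a..b, regInv (ζ * ε) (Real.cos x - Real.cos ζ) *
      ((c₀ + Real.cos ζ * ψ x) * ψ x)) (∫ x in b..π, regInv (ζ * ε) (Real.cos x - Real.cos ζ) *
      ((c₀ + Real.cos ζ * ψ x) * ψ x))
  linarith

end Rayleigh

/-! ### The perturbative regime -/

namespace Rayleigh

variable {μ lam c₀ ζ ε l e : ℝ} {ψ p w v g : ℝ → ℝ}

/-- Testing the equation against `η`: `w` is replaced by the regularized quotient, up to a term
localized near the critical point. -/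
lemma integral_w_mul_eq (h : Rayleigh (Real.cos ζ) lam c₀ ψ p w v g) (hζ : 0 < ζ) (hε : 0 < ε)
    {η : ℝ → ℝ} (hη : Continuous η) (a b : ℝ) :
    ∫ x in a..b, w x * η x =
      (∫ x in a..b, (1 - (Real.cos x - Real.cos ζ) *
        regInv (ζ * ε) (Real.cos x - Real.cos ζ)) * w x * η x) -
      (∫ x in a..b, regInv (ζ * ε) (Real.cos x - Real.cos ζ) * (g x * η x)) -
      ∫ x in a..b, regInv (ζ * ε) (Real.cos x - Real.cos ζ) *
        ((c₀ + Real.cos ζ * ψ x) * η x) := by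
  have cψ := h.cψ
  have cw := h.cw
  have cg := h.cg
  have cr := continuous_regInv (show 0 < ζ * ε by positivity)
  rw [← integral_sub_cont (by fun_prop) (by fun_prop),
    ← integral_sub_cont (by fun_prop) (by fun_prop)]
  refine intervalIntegral.integral_congr fun x _ => ?_
  have := h.eq x
  linear_combination regInv (ζ * ε) (Real.cos x - Real.cos ζ) * η x * this

/-- Cauchy–Schwarz against `1/(|x - ζ| + ε)`, whose square has integral at most `2 / ε`; the powers
of `ε` cancel those in the bound for `g`. -/
lemma abs_integral_regInv_g_le (h : Rayleigh (Real.cos ζ) lam c₀ ψ p w v g) (hζ : 0 < ζ)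
    (hζ' : ζ ≤ π / 2) (hε : 0 < ε) {η : ℝ → ℝ} (hη : Continuous η) {a b M y : ℝ} (hab : a ≤ b)
    (ha : 0 ≤ a) (hb : b ≤ π) (hM : 0 ≤ M) (hηM : ∀ x ∈ Icc a b, |η x| ≤ M) (hy : 0 ≤ y)
    (hA : sqInt g 0 π ≤ ζ * ε * y ^ 2) :
    |∫ x in a..b, regInv (ζ * ε) (Real.cos x - Real.cos ζ) * (g x * η x)| ≤
      44 / √ζ * M * y := by
  have hpi := Real.pi_gt_three
  have cg := h.cg
  have cr := continuous_regInv (show 0 < ζ * ε by positivity)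
  have hne : ∀ x : ℝ, |x - ζ| + ε ≠ 0 := fun x => by positivity
  have cG : Continuous fun x => 1 / (|x - ζ| + ε) := by fun_prop (disch := exact hne _)
  have h1 : |∫ x in a..b, regInv (ζ * ε) (Real.cos x - Real.cos ζ) * (g x * η x)| ≤
      22 / ζ * M * (√(sqInt g a b) * √(sqInt (fun x => 1 / (|x - ζ| + ε)) a b)) := by
    refine abs_integral_le_of_abs_le_mul hab (by positivity) (by fun_prop) cg cG fun x hx => ?_
    have hr := abs_regInv_cos_le (z := x) ⟨ha.trans hx.1, hx.2.trans hb⟩ hζ hζ' hε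
    have h2 := hηM x hx
    have h3 : 0 < 1 / (|x - ζ| + ε) := by positivity
    rw [abs_mul, abs_mul, abs_of_pos h3]
    calc _ ≤ 22 / ζ * (1 / (|x - ζ| + ε)) * (|g x| * M) := by gcongr
      _ = _ := by ring
  refine h1.trans ?_
  have h2 : √(sqInt g a b) ≤ √ζ * √ε * y := by
    refine Real.sqrt_le_iff.2 ⟨by positivity, ?_⟩
    rw [mul_pow, mul_pow, Real.sq_sqrt hζ.le, Real.sq_sqrt hε.le]
    exact (sqInt_mono_interval ha hab hb cg).trans hA
  have h3 : √(sqInt (fun x => 1 / (|x - ζ| + ε)) a b) ≤ 2 / √ε := by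
    refine Real.sqrt_le_iff.2 ⟨by positivity, ?_⟩
    refine (sqInt_mono_interval ha hab hb cG).trans
      ((sqInt_inv_le hζ.le (by linarith) hε).trans ?_)
    rw [div_pow, Real.sq_sqrt hε.le]
    gcongr
    norm_num
  calc _ ≤ 22 / ζ * M * (√ζ * √ε * y * (2 / √ε)) := by gcongr
    _ = 44 / √ζ * M * y := by
        have h4 : √ε ≠ 0 := (Real.sqrt_pos.2 hε).ne'
        have h5 : √ζ ≠ 0 := (Real.sqrt_pos.2 hζ).ne'
        have h6 : ζ = √ζ * √ζ := (Real.mul_self_sqrt hζ.le).symm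
        nth_rewrite 1 [h6]
        field_simp
        ring

set_option maxHeartbeats 1000000 in
/-- The key estimate when the nonlocal term is a perturbation. -/
lemma key_perturbative (h : Rayleigh (Real.cos ζ) lam c₀ ψ p w v g) (hB : BoundaryCond ψ p)
    (hζ : 0 < ζ) (hζ' : ζ ≤ π / 2) (hlam : 1 ≤ lam)
    (hN : sqInt p 0 π + lam * sqInt ψ 0 π ≤
      11 * (sqInt p 0 π + (lam - 1) * sqInt ψ 0 π))
    (hθ : Real.cos ζ ≤ 1 / 10 ^ 5 * √lam * Real.sin ζ) (hε : 0 < ε) (hεζ : ε ≤ ζ / 10 ^ 16) :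
    sqInt p 0 π + lam * sqInt ψ 0 π ≤
      10 ^ 16 * rhsT ζ ε (sqInt g 0 π) (sqInt v 0 π) := by
  have hpi := Real.pi_gt_three
  have cψ := h.cψ
  have cw := h.cw
  have cg := h.cg
  have hεζ' : ε ≤ ζ / 44 := hεζ.trans (by gcongr; norm_num)
  have hA := sqInt_nonneg (F := g) Real.pi_pos.le
  have hP := sqInt_nonneg (F := p) Real.pi_pos.le
  have hV := sqInt_nonneg (F := v) Real.pi_pos.le
  have hΨ := sqInt_nonneg (F := ψ) Real.pi_pos.le
  have hT := rhsT_nonneg hζ hε hA hV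
  have hχ := h.critical_value_le hζ hζ' hε hεζ'
  have hZ := h.sqInt_w_critical_le' hζ hζ' hε hεζ'
  have hμ0 : 0 ≤ Real.cos ζ := Real.cos_nonneg_of_neg_pi_div_two_le_of_le (by linarith) hζ'
  set E := sqInt p 0 π + lam * sqInt ψ 0 π with hE
  set T := rhsT ζ ε (sqInt g 0 π) (sqInt v 0 π) with hTd
  have hE0 : 0 ≤ E := by positivity
  set Y := T + ε / ζ * E with hY
  have hPE : sqInt p 0 π ≤ E := by rw [hE]; linarith [mul_nonneg (by linarith : 0 ≤ lam) hΨ]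
  have hPY : T + ε / ζ * sqInt p 0 π ≤ Y := by rw [hY]; gcongr
  have hY0 : 0 ≤ Y := by positivity
  set y := √Y with hy
  set e := √E with he
  have hy2 : y ^ 2 = Y := Real.sq_sqrt hY0
  have he2 : e ^ 2 = E := Real.sq_sqrt hE0
  have hy0 : 0 ≤ y := Real.sqrt_nonneg _
  have he0 : 0 ≤ e := Real.sqrt_nonneg _
  have hsl : 1 ≤ √lam := Real.one_le_sqrt.2 hlam
  -- The length at which the two terms of the energy balance; it is the `l` of `abs_le_of_energy`.
  set l := 1 / √lam with hl
  have hl0 : 0 < l := by positivity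
  have hl1 : l ≤ 1 := by rw [hl, div_le_one (by positivity)]; exact hsl
  have hlam2 : l ^ 2 * lam = 1 := by
    rw [hl, div_pow, Real.sq_sqrt (by linarith)]; field_simp
  clear_value l e y Y T E
  have hμl : Real.cos ζ * l ≤ 1 / 10 ^ 5 * ζ := by
    have h1 : Real.sin ζ ≤ ζ := Real.sin_le hζ.le
    rw [hl, mul_one_div, div_le_iff₀ (by positivity)]
    calc _ ≤ 1 / 10 ^ 5 * √lam * Real.sin ζ := hθ
      _ ≤ 1 / 10 ^ 5 * √lam * ζ := by gcongr
      _ = _ := by ring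
  -- If `cos ζ ≥ 1/2` this comes from `cos ζ · l ≤ ζ / 10⁵`; otherwise `ζ ≥ 1 ≥ l`.
  have hlζ : l ≤ ζ := by
    rcases le_total (1 / 2) (Real.cos ζ) with h1 | h1
    · linarith [mul_le_mul_of_nonneg_right h1 hl0.le]
    · have h2 : 1 ≤ ζ := by
        by_contra hc
        push Not at hc
        have h3 : Real.cos 1 < Real.cos ζ :=
          Real.cos_lt_cos_of_nonneg_of_le_pi hζ.le (by linarith) hc
        have h4 := Real.cos_one_pos
        have h5 : 1 - 1 ^ 2 / 2 ≤ Real.cos 1 := Real.one_sub_sq_div_two_le_cos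
        norm_num at h5
        linarith
      linarith
  have hP' : sqInt p 0 π ≤ e ^ 2 := by rw [he2]; exact hPE
  have hΨ' : sqInt ψ 0 π ≤ l ^ 2 * e ^ 2 := by
    rw [he2]
    have : lam * sqInt ψ 0 π ≤ E := by rw [hE]; linarith
    calc sqInt ψ 0 π = l ^ 2 * (lam * sqInt ψ 0 π) := by
          rw [← mul_assoc, hlam2, one_mul]
      _ ≤ _ := by gcongr
  have hS : ∀ x ∈ Icc 0 π, |ψ x| ≤ 2 * √l * e := fun x hx =>
    abs_le_of_energy h.hψ h.cp hl0 hl1 he0 hP' hΨ' hx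
  have hsqζ : 0 < √ζ := Real.sqrt_pos.2 hζ
  have hsqlζ : √l ≤ √ζ := Real.sqrt_le_sqrt hlζ
  have hζζ : √ζ * √ζ = ζ := Real.mul_self_sqrt hζ.le
  have hll : √l * √l = l := Real.mul_self_sqrt hl0.le
  have ta : |∫ x in 0..π, regInv (ζ * ε) (Real.cos x - Real.cos ζ) * (g x * ψ x)| ≤
      88 * (y * e) := by
    refine (h.abs_integral_regInv_g_le hζ hζ' hε cψ Real.pi_pos.le le_rfl le_rfl
      (by positivity) hS hy0 ?_).trans ?_
    · rw [hy2]
      have h1 : sqInt g 0 π / (ζ * ε) ≤ Y := by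
        have : sqInt g 0 π / (ζ * ε) ≤ T := by
          rw [hTd, rhsT]
          have : 0 ≤ ζ * ε ^ 3 * sqInt v 0 π := by positivity
          linarith
        have : 0 ≤ ε / ζ * E := by positivity
        linarith
      rw [div_le_iff₀ (by positivity)] at h1
      linarith
    · calc 44 / √ζ * (2 * √l * e) * y ≤ 44 / √ζ * (2 * √ζ * e) * y := by gcongr
        _ = 88 * (y * e) := by field_simp; ring
  have tc : |∫ x in 0..π, (1 - (Real.cos x - Real.cos ζ) *
        regInv (ζ * ε) (Real.cos x - Real.cos ζ)) * w x * ψ x| ≤ 10 ^ 6 * (y * e) := by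
    refine (h.abs_integral_cutoff_le hζ hζ' hε cψ le_rfl le_rfl hζ.le (by linarith)
      (by positivity) fun x hx _ => hS x hx).trans ?_
    have h1 : √ζ * √(22 * ε) * √(sqInt w (ζ - 11 * ε) (ζ + 11 * ε)) ≤ 5 * 10 ^ 5 * y := by
      rw [← Real.sqrt_mul hζ.le, ← Real.sqrt_mul (by positivity)]
      refine Real.sqrt_le_iff.2 ⟨by positivity, ?_⟩
      rw [mul_pow, hy2]
      linarith
    calc _ ≤ 2 * √ζ * e * (√(22 * ε) * √(sqInt w (ζ - 11 * ε) (ζ + 11 * ε))) := by gcongr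
      _ = 2 * e * (√ζ * √(22 * ε) * √(sqInt w (ζ - 11 * ε) (ζ + 11 * ε))) := by ring
      _ ≤ 2 * e * (5 * 10 ^ 5 * y) := by gcongr
      _ = 10 ^ 6 * (y * e) := by ring
  have tb : |∫ x in 0..π, regInv (ζ * ε) (Real.cos x - Real.cos ζ) *
      ((c₀ + Real.cos ζ * ψ x) * ψ x)| ≤ 10 ^ 6 * (y * e) + 1 / 50 * E := by
    refine (h.abs_integral_pv_le hζ hζ' hε hl0 hl1 hlζ he0 hP' hΨ').trans ?_
    set χ := c₀ + Real.cos ζ * ψ ζ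
    have h1 : |χ| ≤ √ζ * (400 * y) := by
      refine abs_le_of_sq_le_sq ?_ (by positivity)
      rw [mul_pow, Real.sq_sqrt hζ.le, mul_pow, hy2]
      have h2 : χ ^ 2 / ζ ≤ 10 ^ 5 * Y := hχ.trans (by gcongr)
      rw [div_le_iff₀ hζ] at h2
      linarith [mul_nonneg hY0 hζ.le]
    have h3 : 310 / ζ * |χ| * (√l * e) ≤ 10 ^ 6 * (y * e) := by
      calc 310 / ζ * |χ| * (√l * e) ≤ 310 / ζ * (√ζ * (400 * y)) * (√ζ * e) := by gcongr
        _ = 124000 / ζ * (√ζ * √ζ) * (y * e) := by ring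
        _ = 124000 * (y * e) := by rw [hζζ]; field_simp
        _ ≤ _ := by linarith [mul_nonneg hy0 he0]
    -- The only contribution without a factor `y`. Smallness of `cos ζ · l / ζ` makes it at most `E
    -- / 50`, so that it can be absorbed even after multiplication by the `11` of `hN`.
    have h4 : 310 / ζ * (3 * Real.cos ζ * (2 * √l * e)) * (√l * e) ≤ 1 / 50 * E := by
      have : 310 / ζ * (3 * Real.cos ζ * (2 * √l * e)) * (√l * e) =
          1860 / ζ * (Real.cos ζ * (√l * √l)) * e ^ 2 := by ring
      rw [this, hll, he2]
      calc 1860 / ζ * (Real.cos ζ * l) * E ≤ 1860 / ζ * (1 / 10 ^ 5 * ζ) * E := by gcongr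
        _ = 1860 / 10 ^ 5 * E := by field_simp
        _ ≤ _ := by linarith
    calc _ = 310 / ζ * |χ| * (√l * e) + 310 / ζ * (3 * Real.cos ζ * (2 * √l * e)) * (√l * e) := by
          ring
      _ ≤ _ := add_le_add h3 h4
  have hid := h.energy_identity hB
  rw [h.integral_w_mul_eq hζ hε cψ] at hid
  have hfin : E ≤ 11 * (3 * 10 ^ 6 * (y * e) + 1 / 50 * E) := by
    refine hN.trans ?_
    have a1 := abs_le.1 ta
    have a2 := abs_le.1 tb
    have a3 := abs_le.1 tc
    have a4 : 0 ≤ y * e := by positivity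
    linarith
  have h5 : e ^ 2 ≤ 5 * 10 ^ 7 * (y * e) := by
    have : 0 ≤ y * e := by positivity
    rw [he2]; linarith
  have h6 : e ≤ 5 * 10 ^ 7 * y := by
    by_contra hc
    push Not at hc
    have : 0 < e := lt_of_le_of_lt (by positivity) hc
    linarith [mul_lt_mul_of_pos_right hc this]
  have h7 : E ≤ 25 * 10 ^ 14 * Y := by
    have := pow_le_pow_left₀ he0 h6 2
    rw [mul_pow, he2, hy2] at this
    linarith
  -- The energy hidden in `Y` carries the factor `(5 · 10⁷)² = 25 · 10¹⁴`; with `ε ≤ ζ / 10¹⁶` it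
  -- amounts to a quarter of `E` and is absorbed.
  have h8 : ε / ζ * E ≤ 1 / 10 ^ 16 * E := by
    refine mul_le_mul_of_nonneg_right ?_ hE0
    rw [div_le_iff₀ hζ]; linarith
  rw [hY] at h7
  linarith

end Rayleigh

/-! ### The ground state substitution between the critical points -/

/-- The function `cos z - cos ζ + τ` for `|z| ≤ ζ`, continued by the constant `τ`. -/
def groundState (ζ τ z : ℝ) : ℝ := max (Real.cos z - Real.cos ζ) 0 + τ

variable {ζ τ : ℝ}

lemma groundState_pos (hτ : 0 < τ) (z : ℝ) : 0 < groundState ζ τ z :=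
  add_pos_of_nonneg_of_pos (le_max_right _ _) hτ

@[fun_prop]
lemma continuous_groundState : Continuous (groundState ζ τ) := by
  unfold groundState; fun_prop

lemma cos_sub_cos_nonneg (hζ' : ζ ≤ π / 2) {z : ℝ} (hz : z ∈ Icc 0 ζ) :
    0 ≤ Real.cos z - Real.cos ζ :=
  sub_nonneg.2 (Real.cos_le_cos_of_nonneg_of_le_pi hz.1 (by linarith [Real.pi_pos]) hz.2)

lemma groundState_eq (hζ' : ζ ≤ π / 2) {z : ℝ} (hz : z ∈ Icc 0 ζ) :
    groundState ζ τ z = Real.cos z - Real.cos ζ + τ := by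
  rw [groundState, max_eq_left (cos_sub_cos_nonneg hζ' hz)]

lemma hasDerivAt_groundState (hζ' : ζ ≤ π / 2) {z : ℝ} (hz : z ∈ Ioo 0 ζ) :
    HasDerivAt (groundState ζ τ) (-Real.sin z) z := by
  have h1 : HasDerivAt (fun z => Real.cos z - Real.cos ζ + τ) (-Real.sin z) z :=
    ((Real.hasDerivAt_cos z).sub_const _).add_const _
  refine h1.congr_of_eventuallyEq ?_
  filter_upwards [Ioo_mem_nhds hz.1 hz.2] with x hx
  exact groundState_eq hζ' ⟨hx.1.le, hx.2.le⟩

/-- `d = F' + (sin z / B) F`, which is `B (F / B)'` for the ground state `B`. -/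
def groundDeriv (ζ τ : ℝ) (F F' : ℝ → ℝ) (z : ℝ) : ℝ :=
  F' z + Real.sin z / groundState ζ τ z * F z

lemma continuous_groundDeriv (hτ : 0 < τ) {F F' : ℝ → ℝ} (hF : Continuous F)
    (hF' : Continuous F') : Continuous (groundDeriv ζ τ F F') := by
  unfold groundDeriv
  have := fun z => (groundState_pos (ζ := ζ) hτ z).ne'
  fun_prop (disch := exact this _)

/-- Jacobi's substitution: `B = cos z - cos ζ + τ` satisfies `B'' = -cos z`, so it is a positive
zero mode of the form with potential `cos z / B`, which therefore is a perfect square. The boundary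
term `(sin / B) F²` vanishes at `0` by the sine and at `ζ` by `F`. -/
lemma ground_identity (hζ : 0 < ζ) (hζ' : ζ ≤ π / 2) (hτ : 0 < τ) {F F' : ℝ → ℝ}
    (hF : ∀ x, HasDerivAt F (F' x) x) (hF' : Continuous F') (h0 : F ζ = 0) :
    sqInt F' 0 ζ - ∫ z in 0..ζ, Real.cos z / groundState ζ τ z * F z ^ 2 =
      sqInt (groundDeriv ζ τ F F') 0 ζ := by
  have cF := continuous_of_hasDerivAt hF
  have hne := fun z => (groundState_pos (ζ := ζ) hτ z).ne'
  have cd := continuous_groundDeriv (ζ := ζ) hτ cF hF'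
  have hder : ∀ x ∈ Ioo 0 ζ, HasDerivAt
      (fun x => -(Real.sin x / groundState ζ τ x * F x ^ 2))
      (F' x ^ 2 - Real.cos x / groundState ζ τ x * F x ^ 2 - groundDeriv ζ τ F F' x ^ 2) x := by
    intro x hx
    have h1 : HasDerivAt (fun x => -(Real.sin x / groundState ζ τ x * F x ^ 2)) _ x :=
      (((Real.hasDerivAt_sin x).div (hasDerivAt_groundState hζ' hx) (hne x)).mul
        ((hF x).pow 2)).neg
    refine h1.congr_deriv ?_
    have := hne x
    simp only [groundDeriv, Pi.pow_apply, Pi.div_apply]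
    field_simp
    simp
    ring
  have hint := intervalIntegral.integral_eq_sub_of_hasDerivAt_of_le hζ.le
    (Continuous.continuousOn (by fun_prop (disch := exact hne _))) hder
    (Continuous.intervalIntegrable (by fun_prop (disch := exact hne _)) _ _)
  rw [integral_sub_cont (by fun_prop (disch := exact hne _)) (by fun_prop),
    integral_sub_cont (by fun_prop) (by fun_prop (disch := exact hne _)), h0] at hint
  simp only [sqInt]
  simp at hint
  linarith

lemma le_groundState (hζ : 0 < ζ) (hζ' : ζ ≤ π / 2) (hτ : 0 < τ) {z : ℝ} (hz : z ∈ Icc 0 ζ) :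
    ζ * (ζ - z) / 11 ≤ groundState ζ τ z := by
  have h1 := mul_abs_le_abs_cos_sub_cos (z := z) (ζ := ζ)
    ⟨hz.1, by linarith [hz.2, Real.pi_pos]⟩ ⟨hζ.le, hζ'⟩
  rw [abs_of_nonneg (cos_sub_cos_nonneg hζ' hz), abs_of_nonpos (by linarith [hz.2])] at h1
  rw [groundState_eq hζ' hz]
  linarith

/-- Deviation of `F / B` from its value at the centre. -/
lemma sqInt_ground_quotient_le (hζ : 0 < ζ) (hζ' : ζ ≤ π / 2) (hτ : 0 < τ) {F F' : ℝ → ℝ}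
    (hF : ∀ x, HasDerivAt F (F' x) x) (hF' : Continuous F') :
    sqInt (fun z => F z / groundState ζ τ z - F 0 / groundState ζ τ 0) 0 ζ ≤
      484 / ζ ^ 2 * sqInt (groundDeriv ζ τ F F') 0 ζ := by
  have cF := continuous_of_hasDerivAt hF
  have hne := fun z => (groundState_pos (ζ := ζ) hτ z).ne'
  have cd := continuous_groundDeriv (ζ := ζ) hτ cF hF'
  -- The derivative of `F / B` is `d / B`, and `(ζ - z)/B ≤ 11/ζ` because `B` is at least of slope
  -- `ζ / 11` at `ζ`. The weight `ζ - z` in this Hardy inequality thus matches the degeneracy of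
  -- `B`.
  have h1 := hardy_weight (h := fun z => F z / groundState ζ τ z - F 0 / groundState ζ τ 0)
    (q := fun z => groundDeriv ζ τ F F' z / groundState ζ τ z) hζ.le
    (by fun_prop (disch := exact hne _)) (by fun_prop (disch := exact hne _)) (fun x hx => by
      have h1 : HasDerivAt (fun z => F z / groundState ζ τ z - F 0 / groundState ζ τ 0) _ x :=
        ((hF x).div (hasDerivAt_groundState hζ' hx) (hne x)).sub_const _
      refine h1.congr_deriv ?_
      have := hne x
      simp only [groundDeriv]
      field_simp
      ring) (sub_self _)
  refine h1.trans ?_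
  have h2 : sqInt (fun z => (ζ - z) * (groundDeriv ζ τ F F' z / groundState ζ τ z)) 0 ζ ≤
      sqInt (fun z => 11 / ζ * groundDeriv ζ τ F F' z) 0 ζ := by
    refine sqInt_mono hζ.le (by fun_prop (disch := exact hne _)) (by fun_prop) fun z hz => ?_
    have h3 := le_groundState hζ hζ' hτ hz
    have h4 := groundState_pos (ζ := ζ) hτ z
    have h5 : (ζ - z) / groundState ζ τ z ≤ 11 / ζ := by
      rw [div_le_div_iff₀ h4 hζ]
      linarith
    have h6 : 0 ≤ (ζ - z) / groundState ζ τ z := div_nonneg (by linarith [hz.2]) h4.le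
    have e : (ζ - z) * (groundDeriv ζ τ F F' z / groundState ζ τ z) =
      (ζ - z) / groundState ζ τ z * groundDeriv ζ τ F F' z := by ring
    rw [e, mul_pow, mul_pow]
    exact mul_le_mul_of_nonneg_right (pow_le_pow_left₀ h6 h5 2) (sq_nonneg _)
  rw [sqInt_const_mul] at h2
  calc _ ≤ 4 * ((11 / ζ) ^ 2 * sqInt (groundDeriv ζ τ F F') 0 ζ) := by gcongr
    _ = _ := by ring

/-- The derivative is controlled by the ground state form and the value at the centre. -/
lemma sqInt_deriv_le_ground (hζ : 0 < ζ) (hζ' : ζ ≤ π / 2) (hτ : 0 < τ) {F F' : ℝ → ℝ}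
    (hF : ∀ x, HasDerivAt F (F' x) x) (hF' : Continuous F') :
    sqInt F' 0 ζ ≤ 2000 * sqInt (groundDeriv ζ τ F F') 0 ζ +
      4 * ζ ^ 3 * (F 0 / groundState ζ τ 0) ^ 2 := by
  have cF := continuous_of_hasDerivAt hF
  have hne := fun z => (groundState_pos (ζ := ζ) hτ z).ne'
  have cd := continuous_groundDeriv (ζ := ζ) hτ cF hF'
  have hq := sqInt_ground_quotient_le hζ hζ' hτ hF hF'
  have hD : 0 ≤ sqInt (groundDeriv ζ τ F F') 0 ζ := sqInt_nonneg hζ.le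
  set φ₀ := F 0 / groundState ζ τ 0
  set h : ℝ → ℝ := fun z => F z / groundState ζ τ z - φ₀ with hh
  have ch : Continuous h := by simp only [hh]; fun_prop (disch := exact hne _)
  have h1 : sqInt F' 0 ζ ≤ ∫ z in 0..ζ, (2 * groundDeriv ζ τ F F' z ^ 2 +
      (4 * ζ ^ 2 * h z ^ 2 + 4 * ζ ^ 2 * φ₀ ^ 2)) := by
    refine integral_mono_cont hζ.le (by fun_prop) (by fun_prop) fun z hz => ?_
    have e1 : F' z = groundDeriv ζ τ F F' z - Real.sin z * (h z + φ₀) := by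
      simp only [groundDeriv, hh]
      ring
    have h2 : Real.sin z ^ 2 ≤ ζ ^ 2 := by
      have h3 : |Real.sin z| ≤ ζ := Real.abs_sin_le_abs.trans (by
        rw [abs_of_nonneg hz.1]; exact hz.2)
      rw [← sq_abs]
      exact pow_le_pow_left₀ (abs_nonneg _) h3 2
    have h4 : (Real.sin z * (h z + φ₀)) ^ 2 ≤ ζ ^ 2 * (2 * h z ^ 2 + 2 * φ₀ ^ 2) := by
      rw [mul_pow]
      refine mul_le_mul h2 ?_ (sq_nonneg _) (sq_nonneg _)
      linarith [sq_nonneg (h z - φ₀), add_sq (h z) φ₀, sub_sq (h z) φ₀]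
    rw [e1]
    set D := groundDeriv ζ τ F F' z
    set s := Real.sin z * (h z + φ₀)
    linarith [sq_nonneg (D + s), add_sq D s, sub_sq D s]
  rw [integral_add_cont (by fun_prop) (by fun_prop),
    integral_add_cont (by fun_prop) (by fun_prop), intervalIntegral.integral_const_mul,
    intervalIntegral.integral_const_mul] at h1
  simp only [intervalIntegral.integral_const, smul_eq_mul, sub_zero] at h1
  change _ ≤ 2 * sqInt (groundDeriv ζ τ F F') 0 ζ + (4 * ζ ^ 2 * sqInt h 0 ζ + _) at h1
  have h5 : 4 * ζ ^ 2 * sqInt h 0 ζ ≤ 1936 * sqInt (groundDeriv ζ τ F F') 0 ζ := by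
    calc 4 * ζ ^ 2 * sqInt h 0 ζ ≤
          4 * ζ ^ 2 * (484 / ζ ^ 2 * sqInt (groundDeriv ζ τ F F') 0 ζ) := by gcongr
      _ = _ := by field_simp; ring
  linarith

/-- The regularized potential is dominated by that of the ground state. -/
lemma cos_mul_regInv_le {s : ℝ} (hs : 0 < s) (hζ : 0 < ζ) (hζ' : ζ ≤ π / 2) {z : ℝ}
    (hz : z ∈ Icc 0 ζ) :
    Real.cos ζ * regInv s (Real.cos z - Real.cos ζ) ≤ Real.cos z / groundState ζ (s ^ 2) z := by
  have hμ0 : 0 ≤ Real.cos ζ :=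
    Real.cos_nonneg_of_neg_pi_div_two_le_of_le (by linarith [Real.pi_pos]) hζ'
  have hμ1 : Real.cos ζ ≤ 1 := Real.cos_le_one ζ
  have hb := cos_sub_cos_nonneg hζ' hz
  rw [groundState_eq hζ' hz]
  have e : Real.cos z = Real.cos ζ + (Real.cos z - Real.cos ζ) := by ring
  set b := Real.cos z - Real.cos ζ
  set μ := Real.cos ζ
  rw [e, le_div_iff₀ (by positivity)]
  have h1 := mul_regInv_mem hs b
  have h2 := abs_regInv_mul_scale_le hs b
  rw [abs_of_nonneg (regInv_nonneg hs hb)] at h2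
  have hr0 := regInv_nonneg hs hb
  set r := regInv s b with hr
  -- This is the reason for the shift `τ = s²`. With `cos z = cos ζ + b`, the product with `b + s²`
  -- splits into `cos ζ · (b r) ≤ cos ζ` and `cos ζ · (r s²) ≤ b`; only the second inequality
  -- depends on whether `b` exceeds `s`.
  rcases le_total s b with hsb | hsb
  · have h3 : r = 1 / b := regInv_of_le hs (by rw [abs_of_nonneg hb]; exact hsb)
    have hb0 : 0 < b := hs.trans_le hsb
    have h4 : r * s ^ 2 ≤ b := by
      rw [h3, one_div_mul_eq_div, div_le_iff₀ hb0]
      nlinarith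
    calc μ * r * (b + s ^ 2) = μ * (b * r) + μ * (r * s ^ 2) := by ring
      _ ≤ μ * 1 + 1 * b := by
          refine add_le_add (mul_le_mul_of_nonneg_left h1.2 hμ0) ?_
          exact mul_le_mul hμ1 h4 (by positivity) (by norm_num)
      _ = _ := by ring
  · have h3 : r * s ^ 2 ≤ b := by
      have : r = b / s ^ 2 := by
        rw [hr, regInv, max_eq_right (pow_le_pow_left₀ hb hsb 2)]
      rw [this]
      field_simp
      exact le_rfl
    calc μ * r * (b + s ^ 2) = μ * (b * r) + μ * (r * s ^ 2) := by ring
      _ ≤ μ * 1 + 1 * b := by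
          refine add_le_add (mul_le_mul_of_nonneg_left h1.2 hμ0) ?_
          exact mul_le_mul hμ1 h3 (by positivity) (by norm_num)
      _ = _ := by ring

/-! ### The key estimate when the nonlocal term is not a perturbation -/

/-- The size `m` controls the critical value of `ψ`, the forcing, and `w` near the critical point,
while `K` bounds the frequency relative to the critical point. -/
structure CriticalBound (ζ ε lam m K : ℝ) (ψ w g : ℝ → ℝ) : Prop where
  hζ : 0 < ζ
  hζ' : ζ ≤ π / 2
  hε : 0 < ε
  hεζ : ε ≤ ζ / 10 ^ 4
  hlam : 1 ≤ lam
  hm : 0 ≤ m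
  hK : 1 ≤ K
  value : |ψ ζ| ≤ √ζ * m
  force : sqInt g 0 π ≤ ζ * ε * m ^ 2
  local_w : ζ * ε * sqInt w (ζ - 11 * ε) (ζ + 11 * ε) ≤ m ^ 2
  freq : (lam - 1) * ζ ^ 2 ≤ K ^ 2

namespace CriticalBound

variable {lam ζ ε m K : ℝ} {ψ w g : ℝ → ℝ}

lemma sqrt_local_w (c : CriticalBound ζ ε lam m K ψ w g) :
    ε * √(sqInt w (ζ - 11 * ε) (ζ + 11 * ε)) ≤ m := by
  have h1 := c.hε
  have h2 := c.hζ
  have h3 : ε ≤ ζ := c.hεζ.trans (by linarith)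
  have h4 : 0 ≤ sqInt w (ζ - 11 * ε) (ζ + 11 * ε) := sqInt_nonneg (by linarith)
  refine abs_le_of_sq_le_sq' ?_ c.hm |>.2
  rw [mul_pow, Real.sq_sqrt h4]
  refine le_trans ?_ c.local_w
  rw [sq]
  gcongr

end CriticalBound

namespace Rayleigh

variable {lam ζ ε m K : ℝ} {ψ p w v g : ℝ → ℝ}

set_option maxHeartbeats 1000000 in
/-- The energy of `ψ` with its critical value lifted by a profile `L`. -/
lemma lifted_energy_le (h : Rayleigh (Real.cos ζ) lam 0 ψ p w v g)
    (c : CriticalBound ζ ε lam m K ψ w g) {a b : ℝ} (ha : 0 ≤ a) (haζ : a ≤ ζ) (hζb : ζ ≤ b)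
    (hb : b ≤ π) {L L' F F' : ℝ → ℝ} (hL : ∀ x, HasDerivAt L (L' x) x) (hL' : Continuous L')
    (hLζ : L ζ = 1) (hL2 : sqInt L a b ≤ ζ) (hL2' : sqInt L' a b ≤ 4 / ζ)
    (hF : ∀ x, F x = ψ x - ψ ζ * L x) (hF' : ∀ x, F' x = p x - ψ ζ * L' x)
    (hbd : p b * F b - p a * F a = 0) :
    sqInt F' a b + (lam - 1) * sqInt F a b -
        Real.cos ζ * (∫ x in a..b, regInv (ζ * ε) (Real.cos x - Real.cos ζ) * F x ^ 2) ≤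
      106 * m * √(sqInt F' a b) + K * m * √((lam - 1) * sqInt F a b) := by
  have hζ := c.hζ
  have hε := c.hε
  have hm := c.hm
  have hK := c.hK
  have hεζ : ε ≤ ζ := c.hεζ.trans (by linarith)
  have hab : a ≤ b := haζ.trans hζb
  have hlam : 0 ≤ lam - 1 := by linarith [c.hlam]
  have cψ := h.cψ
  have cp := h.cp
  have cw := h.cw
  have cg := h.cg
  have cL := continuous_of_hasDerivAt hL
  have cr := continuous_regInv (show 0 < ζ * ε by positivity)
  have hne : ∀ x : ℝ, |x - ζ| + ε ≠ 0 := fun x => by positivity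
  have dF : ∀ x, HasDerivAt F (F' x) x := fun x => by
    rw [funext hF, hF' x]
    exact (h.hψ x).sub ((hL x).const_mul _)
  have cF := continuous_of_hasDerivAt dF
  have cF' : Continuous F' := by rw [funext hF']; fun_prop
  -- The purpose of the lift: since `F` vanishes at `ζ`, Hardy's inequality bounds `regInv · F` in
  -- `L²` uniformly in `ε`. The errors it creates are paid by the bounds on `L` and `L'`.
  have hFζ : F ζ = 0 := by rw [hF, hLζ]; ring
  have hμ0 : 0 ≤ Real.cos ζ :=
    Real.cos_nonneg_of_neg_pi_div_two_le_of_le (by linarith [Real.pi_pos]) c.hζ'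
  have hμ1 := Real.cos_le_one ζ
  have hsζ : √ζ * √ζ = ζ := Real.mul_self_sqrt hζ.le
  have hsζ0 : 0 < √ζ := Real.sqrt_pos.2 hζ
  set κ := ψ ζ
  set X := √(sqInt F' a b) with hX
  have hX0 : 0 ≤ X := Real.sqrt_nonneg _
  have cH : Continuous fun x => (F x - F ζ) / (|x - ζ| + ε) := by fun_prop (disch := exact hne _)
  have hH : √(sqInt (fun x => (F x - F ζ) / (|x - ζ| + ε)) a b) ≤ 2 * X := by
    refine Real.sqrt_le_iff.2 ⟨by positivity, ?_⟩
    rw [mul_pow, hX, Real.sq_sqrt (sqInt_nonneg hab)]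
    linarith [hardy_interior dF cF' haζ hζb hε]
  have hrF : ∀ x ∈ Icc a b, |regInv (ζ * ε) (Real.cos x - Real.cos ζ)| * |F x| ≤
      22 / ζ * |(F x - F ζ) / (|x - ζ| + ε)| := by
    intro x hx
    have hr := abs_regInv_cos_le (z := x) ⟨ha.trans hx.1, hx.2.trans hb⟩ hζ c.hζ' hε
    have h3 : 0 < |x - ζ| + ε := by positivity
    rw [hFζ, sub_zero, abs_div, abs_of_pos h3]
    calc _ ≤ 22 / ζ * (1 / (|x - ζ| + ε)) * |F x| := by gcongr
      _ = _ := by ring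
  have hsL : √(sqInt L a b) ≤ √ζ := Real.sqrt_le_sqrt hL2
  have hsL' : √(sqInt L' a b) ≤ 2 / √ζ := by
    refine Real.sqrt_le_iff.2 ⟨by positivity, ?_⟩
    rw [div_pow, Real.sq_sqrt hζ.le]
    linarith
  have t1 : |∫ x in a..b, L' x * F' x| ≤ 2 / √ζ * X :=
    (abs_integral_mul_le hab hL' cF').trans (by gcongr)
  have t2 : |∫ x in a..b, L x * F x| ≤ √ζ * √(sqInt F a b) :=
    (abs_integral_mul_le hab cL cF).trans (by gcongr)
  have t3 : |∫ x in a..b, (1 - (Real.cos x - Real.cos ζ) *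
        regInv (ζ * ε) (Real.cos x - Real.cos ζ)) * w x * F x| ≤ 16 * m * X := by
    refine (h.abs_integral_cutoff_le hζ c.hζ' hε cF (M := √(11 * ε) * X) ha hb haζ hζb
      (by positivity) fun x hx hxε => ?_).trans ?_
    · have := abs_sub_le_sqrt dF cF' hx ⟨haζ, hζb⟩
      rw [hFζ, sub_zero] at this
      refine this.trans ?_
      gcongr
    · have h1 : √(11 * ε) * √(22 * ε) ≤ 16 * ε := by
        rw [← Real.sqrt_mul (by positivity)]
        refine Real.sqrt_le_iff.2 ⟨by positivity, ?_⟩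
        nlinarith [mul_pos hε hε]
      have h2 := c.sqrt_local_w
      calc _ = √(11 * ε) * √(22 * ε) * √(sqInt w (ζ - 11 * ε) (ζ + 11 * ε)) * X := by ring
        _ ≤ 16 * ε * √(sqInt w (ζ - 11 * ε) (ζ + 11 * ε)) * X := by gcongr
        _ = 16 * (ε * √(sqInt w (ζ - 11 * ε) (ζ + 11 * ε))) * X := by ring
        _ ≤ _ := by gcongr
  have t4 : |∫ x in a..b, regInv (ζ * ε) (Real.cos x - Real.cos ζ) * (g x * F x)| ≤
      44 * m * X := by
    have h1 := abs_integral_le_of_abs_le_mul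
      (H := fun x => regInv (ζ * ε) (Real.cos x - Real.cos ζ) * (g x * F x)) (M := 22 / ζ)
      hab (by positivity) (by fun_prop) cg cH fun x hx => by
        rw [abs_mul, abs_mul]
        calc _ = |g x| * (|regInv (ζ * ε) (Real.cos x - Real.cos ζ)| * |F x|) := by ring
          _ ≤ |g x| * (22 / ζ * |(F x - F ζ) / (|x - ζ| + ε)|) := by
              exact mul_le_mul_of_nonneg_left (hrF x hx) (abs_nonneg _)
          _ = _ := by ring
    refine h1.trans ?_
    have h2 : √(sqInt g a b) ≤ ζ * m := by
      refine Real.sqrt_le_iff.2 ⟨by positivity, ?_⟩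
      refine (sqInt_mono_interval ha hab hb cg).trans (c.force.trans ?_)
      calc ζ * ε * m ^ 2 ≤ ζ * ζ * m ^ 2 := by gcongr
        _ = _ := by ring
    calc _ ≤ 22 / ζ * (ζ * m * (2 * X)) := by gcongr
      _ = _ := by field_simp; ring
  have t5 : |∫ x in a..b, regInv (ζ * ε) (Real.cos x - Real.cos ζ) * (L x * F x)| ≤
      44 / √ζ * X := by
    have h1 := abs_integral_le_of_abs_le_mul
      (H := fun x => regInv (ζ * ε) (Real.cos x - Real.cos ζ) * (L x * F x)) (M := 22 / ζ)
      hab (by positivity) (by fun_prop) cL cH fun x hx => by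
        rw [abs_mul, abs_mul]
        calc _ = |L x| * (|regInv (ζ * ε) (Real.cos x - Real.cos ζ)| * |F x|) := by ring
          _ ≤ |L x| * (22 / ζ * |(F x - F ζ) / (|x - ζ| + ε)|) := by
              exact mul_le_mul_of_nonneg_left (hrF x hx) (abs_nonneg _)
          _ = _ := by ring
    refine h1.trans ?_
    calc _ ≤ 22 / ζ * (√ζ * (2 * X)) := by gcongr
      _ = 44 / (√ζ * √ζ) * √ζ * X := by rw [hsζ]; ring
      _ = _ := by field_simp
  have hid := h.integral_w_mul dF cF' a b
  rw [hbd, h.integral_w_mul_eq hζ hε cF] at hid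
  have e1 : ∫ x in a..b, (p x * F' x + (lam - 1) * (ψ x * F x)) =
      sqInt F' a b + (lam - 1) * sqInt F a b + κ * (∫ x in a..b, L' x * F' x) +
        (lam - 1) * (κ * ∫ x in a..b, L x * F x) := by
    simp only [sqInt, ← intervalIntegral.integral_const_mul]
    rw [← integral_add_cont (by fun_prop) (by fun_prop),
      ← integral_add_cont (by fun_prop) (by fun_prop),
      ← integral_add_cont (by fun_prop) (by fun_prop)]
    refine intervalIntegral.integral_congr fun x _ => ?_
    simp only [hF x, hF' x]
    ring
  have e2 : ∫ x in a..b, regInv (ζ * ε) (Real.cos x - Real.cos ζ) *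
        ((0 + Real.cos ζ * ψ x) * F x) =
      Real.cos ζ * (∫ x in a..b, regInv (ζ * ε) (Real.cos x - Real.cos ζ) * F x ^ 2) +
      Real.cos ζ * (κ * ∫ x in a..b, regInv (ζ * ε) (Real.cos x - Real.cos ζ) * (L x * F x)) := by
    simp only [← intervalIntegral.integral_const_mul]
    rw [← integral_add_cont (by fun_prop) (by fun_prop)]
    refine intervalIntegral.integral_congr fun x _ => ?_
    simp only [hF x]
    ring
  rw [e1, e2] at hid
  have b1 : |κ * ∫ x in a..b, L' x * F' x| ≤ 2 * m * X := by
    rw [abs_mul]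
    calc _ ≤ √ζ * m * (2 / √ζ * X) := by gcongr; exact c.value
      _ = _ := by field_simp
  have b2 : |(lam - 1) * (κ * ∫ x in a..b, L x * F x)| ≤ K * m * √((lam - 1) * sqInt F a b) := by
    rw [abs_mul, abs_mul, abs_of_nonneg hlam, Real.sqrt_mul hlam]
    have h1 : √(lam - 1) * ζ ≤ K := by
      refine abs_le_of_sq_le_sq' ?_ (by linarith) |>.2
      rw [mul_pow, Real.sq_sqrt hlam]
      exact c.freq
    calc _ ≤ (lam - 1) * (√ζ * m * (√ζ * √(sqInt F a b))) := by gcongr; exact c.value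
      _ = (√(lam - 1) * √(lam - 1)) * (√ζ * √ζ) * m * √(sqInt F a b) := by
          rw [Real.mul_self_sqrt hlam]; ring
      _ = (√(lam - 1) * ζ) * m * (√(lam - 1) * √(sqInt F a b)) := by rw [hsζ]; ring
      _ ≤ _ := by gcongr
  have b5 : |Real.cos ζ * (κ * ∫ x in a..b,
      regInv (ζ * ε) (Real.cos x - Real.cos ζ) * (L x * F x))| ≤ 44 * m * X := by
    rw [abs_mul, abs_mul, abs_of_nonneg hμ0]
    calc _ ≤ 1 * (√ζ * m * (44 / √ζ * X)) := by gcongr; exact c.value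
      _ = _ := by field_simp
  linarith [abs_le.1 b1, abs_le.1 b2, abs_le.1 b5, abs_le.1 t3, abs_le.1 t4]

/-- Undoing the lift. -/
lemma unlift_le (h : Rayleigh (Real.cos ζ) lam 0 ψ p w v g)
    (c : CriticalBound ζ ε lam m K ψ w g) {a b : ℝ} (hab : a ≤ b) {L L' F F' : ℝ → ℝ}
    (cL : Continuous L) (cL' : Continuous L') (hL2 : sqInt L a b ≤ ζ) (hL2' : sqInt L' a b ≤ 4 / ζ)
    (hF : ∀ x, F x = ψ x - ψ ζ * L x) (hF' : ∀ x, F' x = p x - ψ ζ * L' x) :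
    sqInt p a b ≤ 2 * sqInt F' a b + 8 * m ^ 2 ∧
      (lam - 1) * sqInt ψ a b ≤ 2 * ((lam - 1) * sqInt F a b) + 2 * K ^ 2 * m ^ 2 := by
  have hζ := c.hζ
  have hlam : 0 ≤ lam - 1 := by linarith [c.hlam]
  have cψ := h.cψ
  have cp := h.cp
  have cF : Continuous F := by rw [funext hF]; fun_prop
  have cF' : Continuous F' := by rw [funext hF']; fun_prop
  have hκ : ψ ζ ^ 2 ≤ ζ * m ^ 2 := by
    have := pow_le_pow_left₀ (abs_nonneg _) c.value 2
    rwa [sq_abs, mul_pow, Real.sq_sqrt hζ.le] at this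
  have h1 := sqInt_add_le hab cF' (cL'.const_mul (ψ ζ))
  have h2 := sqInt_add_le hab cF (cL.const_mul (ψ ζ))
  rw [sqInt_const_mul] at h1 h2
  have e1 : (fun x => F' x + ψ ζ * L' x) = p := by funext x; rw [hF']; ring
  have e2 : (fun x => F x + ψ ζ * L x) = ψ := by funext x; rw [hF]; ring
  rw [e1] at h1
  rw [e2] at h2
  constructor
  · have h3 : ψ ζ ^ 2 * sqInt L' a b ≤ ζ * m ^ 2 * (4 / ζ) := by
      gcongr
      exact sqInt_nonneg hab
    have h4 : ζ * m ^ 2 * (4 / ζ) = 4 * m ^ 2 := by field_simp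
    linarith
  · have h3 : ψ ζ ^ 2 * sqInt L a b ≤ ζ * m ^ 2 * ζ := by
      gcongr
      exact sqInt_nonneg hab
    have h4 : (lam - 1) * (ψ ζ ^ 2 * sqInt L a b) ≤ K ^ 2 * m ^ 2 := by
      calc _ ≤ (lam - 1) * (ζ * m ^ 2 * ζ) := by gcongr
        _ = (lam - 1) * ζ ^ 2 * m ^ 2 := by ring
        _ ≤ _ := by gcongr; exact c.freq
    linarith [mul_le_mul_of_nonneg_left h2 hlam]

set_option maxHeartbeats 800000 in
/-- Beyond the critical point the nonlocal term has a favourable sign. -/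
lemma outer_le (h : Rayleigh (Real.cos ζ) lam 0 ψ p w v g) (hB : BoundaryCond ψ p)
    (c : CriticalBound ζ ε lam m K ψ w g) :
    sqInt p ζ π ≤ 25000 * K ^ 2 * m ^ 2 ∧ (lam - 1) * sqInt ψ ζ π ≤ 25000 * K ^ 2 * m ^ 2 := by
  have hζ := c.hζ
  have hζ' := c.hζ'
  have hpi := Real.pi_gt_three
  have hm := c.hm
  have hK := c.hK
  have hlam : 0 ≤ lam - 1 := by linarith [c.hlam]
  have hζπ : ζ ≤ π := by linarith
  have hd : 0 < π - ζ := by linarith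
  have hs : 0 < ζ * ε := mul_pos hζ c.hε
  have cr := continuous_regInv hs
  -- Exponential decay at length `ζ` yields the norms `ζ` and `4/ζ` asked of a profile; the linear
  -- factor makes `L π = 0`, so that `p π · F π = p π · ψ π` vanishes under either boundary
  -- condition.
  set L : ℝ → ℝ := fun z => Real.exp (-(z - ζ) / ζ) * ((π - z) / (π - ζ)) with hLd
  set L' : ℝ → ℝ := fun z => -(Real.exp (-(z - ζ) / ζ) *
    (1 / ζ * ((π - z) / (π - ζ)) + 1 / (π - ζ))) with hLd'
  have hL : ∀ x, HasDerivAt L (L' x) x := fun x => by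
    have h1 : HasDerivAt (fun z : ℝ => -(z - ζ) / ζ) (-1 / ζ) x :=
      (((hasDerivAt_id x).sub_const ζ).neg).div_const ζ
    have h2 : HasDerivAt (fun z : ℝ => (π - z) / (π - ζ)) (-1 / (π - ζ)) x :=
      ((hasDerivAt_id x).const_sub π).div_const _
    refine (h1.exp.mul h2).congr_deriv ?_
    simp only [hLd']
    ring
  have cL := continuous_of_hasDerivAt hL
  have cL' : Continuous L' := by simp only [hLd']; fun_prop
  have hexp : sqInt (fun z => Real.exp (-(z - ζ) / ζ)) ζ π ≤ ζ / 2 := by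
    have hder : ∀ x ∈ uIcc ζ π, HasDerivAt (fun z => -(ζ / 2) * Real.exp (-(z - ζ) / ζ) ^ 2)
        (Real.exp (-(x - ζ) / ζ) ^ 2) x := fun x _ => by
      have h1 : HasDerivAt (fun z : ℝ => -(z - ζ) / ζ) (-1 / ζ) x :=
        (((hasDerivAt_id x).sub_const ζ).neg).div_const ζ
      have h2 : HasDerivAt (fun z => -(ζ / 2) * Real.exp (-(z - ζ) / ζ) ^ 2) _ x :=
        ((h1.exp).pow 2).const_mul _
      refine h2.congr_deriv ?_
      field_simp
      simp
    rw [sqInt, intervalIntegral.integral_eq_sub_of_hasDerivAt hder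
      (Continuous.intervalIntegrable (by fun_prop) _ _)]
    simp only [sub_self, neg_zero, zero_div, Real.exp_zero]
    have : 0 ≤ ζ / 2 * Real.exp (-(π - ζ) / ζ) ^ 2 := by positivity
    linarith
  have hfrac : ∀ z ∈ Icc ζ π, 0 ≤ (π - z) / (π - ζ) ∧ (π - z) / (π - ζ) ≤ 1 := fun z hz =>
    ⟨div_nonneg (by linarith [hz.2]) hd.le, (div_le_one hd).2 (by linarith [hz.1])⟩
  have hL2 : sqInt L ζ π ≤ ζ := by
    refine (sqInt_mono hζπ cL (G := fun z => Real.exp (-(z - ζ) / ζ)) (by fun_prop)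
      fun z hz => ?_).trans (hexp.trans (by linarith))
    obtain ⟨h1, h2⟩ := hfrac z hz
    refine pow_le_pow_left₀ (by positivity) ?_ 2
    exact mul_le_of_le_one_right (Real.exp_pos _).le h2
  have hL2' : sqInt L' ζ π ≤ 4 / ζ := by
    have h1 : sqInt L' ζ π ≤ sqInt (fun z => 2 / ζ * Real.exp (-(z - ζ) / ζ)) ζ π := by
      refine sqInt_mono hζπ cL' (by fun_prop) fun z hz => ?_
      obtain ⟨h1, h2⟩ := hfrac z hz
      simp only [hLd', neg_sq]
      refine pow_le_pow_left₀ (by positivity) ?_ 2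
      rw [mul_comm (2 / ζ)]
      refine mul_le_mul_of_nonneg_left ?_ (Real.exp_pos _).le
      have h3 : 1 / (π - ζ) ≤ 1 / ζ := one_div_le_one_div_of_le hζ (by linarith)
      have h4 : 1 / ζ * ((π - z) / (π - ζ)) ≤ 1 / ζ :=
        mul_le_of_le_one_right (by positivity) h2
      calc _ ≤ 1 / ζ + 1 / ζ := add_le_add h4 h3
        _ = _ := by ring
    rw [sqInt_const_mul] at h1
    calc _ ≤ (2 / ζ) ^ 2 * (ζ / 2) := h1.trans (by gcongr)
      _ = 2 / ζ := by field_simp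
      _ ≤ _ := by gcongr; norm_num
  have hLζ : L ζ = 1 := by simp [hLd, div_self hd.ne']
  have hLπ : L π = 0 := by simp [hLd]
  obtain ⟨F, hF⟩ : ∃ F : ℝ → ℝ, ∀ x, F x = ψ x - ψ ζ * L x := ⟨_, fun _ => rfl⟩
  obtain ⟨F', hF'⟩ : ∃ F' : ℝ → ℝ, ∀ x, F' x = p x - ψ ζ * L' x := ⟨_, fun _ => rfl⟩
  have hbd : p π * F π - p ζ * F ζ = 0 := by
    rw [hF, hF, hLπ, hLζ]
    linear_combination (boundary_zero hB).2
  have hmain := h.lifted_energy_le c hζ.le le_rfl hζπ le_rfl hL cL' hLζ hL2 hL2' hF hF' hbd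
  have hun := h.unlift_le c hζπ cL cL' hL2 hL2' hF hF'
  have cψ := h.cψ
  have cp := h.cp
  have cF : Continuous F := by rw [funext hF]; fun_prop
  have hμ0 : 0 ≤ Real.cos ζ :=
    Real.cos_nonneg_of_neg_pi_div_two_le_of_le (by linarith) hζ'
  have hneg : ∫ x in ζ..π, regInv (ζ * ε) (Real.cos x - Real.cos ζ) * F x ^ 2 ≤ 0 := by
    have := integral_mono_cont (G := fun _ => 0) hζπ
      (show Continuous fun x => regInv (ζ * ε) (Real.cos x - Real.cos ζ) * F x ^ 2 by fun_prop)
      continuous_const fun x hx => by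
        refine mul_nonpos_of_nonpos_of_nonneg (regInv_nonpos hs (sub_nonpos.2 ?_)) (sq_nonneg _)
        exact Real.cos_le_cos_of_nonneg_of_le_pi hζ.le hx.2 hx.1
    simpa using this
  have hμr := mul_nonpos_of_nonneg_of_nonpos hμ0 hneg
  have hX2 := Real.sq_sqrt (sqInt_nonneg (F := F') hζπ)
  have hY2 := Real.sq_sqrt (mul_nonneg hlam (sqInt_nonneg (F := F) hζπ))
  set X := √(sqInt F' ζ π)
  set Y := √((lam - 1) * sqInt F ζ π)
  have h1 : X ^ 2 + Y ^ 2 ≤ 11236 * m ^ 2 + K ^ 2 * m ^ 2 := by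
    linarith [sq_nonneg (X - 106 * m), sq_nonneg (Y - K * m), sub_sq X (106 * m),
      sub_sq Y (K * m), mul_pow K m 2]
  have hKm : m ^ 2 ≤ K ^ 2 * m ^ 2 :=
    le_mul_of_one_le_left (sq_nonneg _) (one_le_pow₀ hK)
  have hX := sq_nonneg X
  have hY := sq_nonneg Y
  constructor <;> linarith [hun.1, hun.2]

/-- The ground state form controls the lifted function inside the critical point. -/
lemma inner_form_le (h : Rayleigh (Real.cos ζ) lam 0 ψ p w v g)
    (c : CriticalBound ζ ε lam m K ψ w g) {L L' F F' : ℝ → ℝ} (hL : ∀ x, HasDerivAt L (L' x) x)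
    (hL' : Continuous L') (hLζ : L ζ = 1) (hL2 : sqInt L 0 ζ ≤ ζ) (hL2' : sqInt L' 0 ζ ≤ 4 / ζ)
    (hF : ∀ x, F x = ψ x - ψ ζ * L x) (hF' : ∀ x, F' x = p x - ψ ζ * L' x)
    (hbd : p 0 * F 0 = 0) :
    sqInt (groundDeriv ζ ((ζ * ε) ^ 2) F F') 0 ζ + (lam - 1) * sqInt F 0 ζ ≤
      212 * m * √(sqInt F' 0 ζ) + K ^ 2 * m ^ 2 := by
  have hζ := c.hζ
  have hζ' := c.hζ'
  have hpi := Real.pi_gt_three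
  have hlam : 0 ≤ lam - 1 := by linarith [c.hlam]
  have hs : 0 < ζ * ε := mul_pos hζ c.hε
  have cr := continuous_regInv hs
  have cψ := h.cψ
  have cp := h.cp
  have dF : ∀ x, HasDerivAt F (F' x) x := fun x => by
    rw [funext hF, hF' x]
    exact (h.hψ x).sub ((hL x).const_mul _)
  have cF := continuous_of_hasDerivAt dF
  have cF' : Continuous F' := by rw [funext hF']; fun_prop
  have hFζ : F ζ = 0 := by rw [hF, hLζ]; ring
  have hmain := h.lifted_energy_le c le_rfl hζ.le le_rfl (by linarith) hL hL' hLζ hL2 hL2' hF hF'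
    (by rw [hFζ, hbd]; ring)
  have hτ : 0 < (ζ * ε) ^ 2 := by positivity
  have hne := fun z => (groundState_pos (ζ := ζ) hτ z).ne'
  have hg := ground_identity hζ hζ' hτ dF cF' hFζ
  -- Replacing the regularized potential by the larger `cos z / B` with `τ = (ζ ε)²` only weakens
  -- the form, and then `ground_identity` applies.
  have hcmp : Real.cos ζ * (∫ x in 0..ζ, regInv (ζ * ε) (Real.cos x - Real.cos ζ) * F x ^ 2) ≤
      ∫ z in 0..ζ, Real.cos z / groundState ζ ((ζ * ε) ^ 2) z * F z ^ 2 := by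
    rw [← intervalIntegral.integral_const_mul]
    refine integral_mono_cont hζ.le (by fun_prop) (by fun_prop (disch := exact hne _))
      fun z hz => ?_
    rw [← mul_assoc]
    exact mul_le_mul_of_nonneg_right (cos_mul_regInv_le hs hζ hζ' hz) (sq_nonneg _)
  have hY2 := Real.sq_sqrt (mul_nonneg hlam (sqInt_nonneg (F := F) hζ.le))
  have hD := sqInt_nonneg (F := groundDeriv ζ ((ζ * ε) ^ 2) F F') hζ.le
  set Y := √((lam - 1) * sqInt F 0 ζ)
  linarith [sq_nonneg (Y - K * m), sub_sq Y (K * m), mul_pow K m 2]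

end Rayleigh

/-! ### Crossing the critical point -/

/-- A test function crossing the critical point `ζ`, odd-symmetric with respect to the singular
potential. -/
structure CrossingTest (ζ a q : ℝ) (η η' : ℝ → ℝ) : Prop where
  ha : 0 ≤ a
  haζ : a ≤ ζ
  hζq : ζ ≤ q
  hq : q ≤ π
  len : q - ζ ≤ 11 / 5 * ζ
  deriv : ∀ x, HasDerivAt η (η' x) x
  cont : Continuous η'
  left : η a = 0
  right : η q = 0
  mid : η ζ = 1
  bound : ∀ z ∈ Icc a q, |η z| ≤ 2
  bound' : ∀ z ∈ Icc a q, |η' z| ≤ 25 / ζ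
  nonneg : ∀ z ∈ Icc a ζ, 0 ≤ η z
  le_one : ∀ z ∈ Icc a ζ, η z ≤ 1
  level : ∀ z ∈ Icc a ζ, Real.cos z - Real.cos ζ ≤ Real.sin ζ ^ 2 / 5
  odd : ∀ s > 0, ∫ z in a..q, regInv s (Real.cos z - Real.cos ζ) * η z = 0

/-- The test function is `sin z` times a bump that is even in `cos z - cos ζ`, on the window where
this difference is at most `σ = sin² ζ / 5` in modulus. As `sin z` is the Jacobian of the variable
`cos z`, the regularized reciprocal integrates to zero against it at every scale `s`. -/
lemma exists_crossingTest {ζ : ℝ} (hζ : 0 < ζ) (hζ' : ζ ≤ π / 2) :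
    ∃ (a q : ℝ) (η η' : ℝ → ℝ), CrossingTest ζ a q η η' := by
  have hpi := Real.pi_gt_three
  have hβ1 : Real.sin ζ ≤ ζ := Real.sin_le hζ.le
  have hβ2 := half_le_sin hζ.le hζ'
  have hβ0 : 0 < Real.sin ζ := by linarith
  have hμ0 : 0 ≤ Real.cos ζ := Real.cos_nonneg_of_neg_pi_div_two_le_of_le (by linarith) hζ'
  have hβμ := Real.sin_sq_add_cos_sq ζ
  set β := Real.sin ζ with hβ
  set μ := Real.cos ζ with hμ
  have hβζ : β ^ 2 ≤ ζ ^ 2 := pow_le_pow_left₀ hβ0.le hβ1 2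
  set σ := β ^ 2 / 5 with hσ
  have hσ0 : 0 < σ := by positivity
  obtain ⟨a, q, ha, haζ, hζq, hq, hca, hcq, -, hlen⟩ :=
    exists_level hζ hζ' hσ0.le (by rw [hσ]; gcongr)
  have hmem : ∀ z ∈ Icc a q, |Real.cos z - μ| ≤ σ := fun z hz => by
    rw [abs_le]
    constructor
    · have := Real.cos_le_cos_of_nonneg_of_le_pi (ha.trans hz.1) hq hz.2
      linarith
    · have := Real.cos_le_cos_of_nonneg_of_le_pi ha (hz.2.trans hq) hz.1
      linarith
  have hsin0 : ∀ z ∈ Icc a q, 0 ≤ Real.sin z := fun z hz =>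
    Real.sin_nonneg_of_nonneg_of_le_pi (ha.trans hz.1) (hz.2.trans hq)
  -- The difference `sin² z - sin² ζ` equals `-(cos z - μ)(cos z + μ)`, of modulus at most `2 σ = 2
  -- β² / 5`.
  have hsin : ∀ z ∈ Icc a q, Real.sin z ^ 2 ≤ 7 / 5 * β ^ 2 := fun z hz => by
    have h1 := Real.sin_sq_add_cos_sq z
    have h2 := abs_le.1 (hmem z hz)
    have h3 := Real.cos_le_one z
    have h4 := Real.cos_le_one ζ
    have h5 := Real.neg_one_le_cos z
    have h6 : |(Real.cos z - μ) * (Real.cos z + μ)| ≤ σ * 2 := by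
      rw [abs_mul]
      refine mul_le_mul (hmem z hz) ?_ (abs_nonneg _) hσ0.le
      rw [abs_le]; constructor <;> linarith
    have h7 := (abs_le.1 h6).1
    have h8 : (Real.cos z - μ) * (Real.cos z + μ) = Real.cos z ^ 2 - μ ^ 2 := by ring
    rw [hσ] at h7
    linarith
  have hq1 : ∀ z ∈ Icc a q, 0 ≤ 1 - ((Real.cos z - μ) / σ) ^ 2 ∧
      1 - ((Real.cos z - μ) / σ) ^ 2 ≤ 1 := fun z hz => by
    refine ⟨?_, by linarith [sq_nonneg ((Real.cos z - μ) / σ)]⟩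
    rw [sub_nonneg, ← sq_abs, abs_div, abs_of_pos hσ0]
    exact pow_le_one₀ (by positivity) ((div_le_one hσ0).2 (hmem z hz))
  refine ⟨a, q, fun z => Real.sin z * (1 - ((Real.cos z - μ) / σ) ^ 2) / β,
    fun z => (Real.cos z * (1 - ((Real.cos z - μ) / σ) ^ 2) +
      2 * Real.sin z ^ 2 * (Real.cos z - μ) / σ ^ 2) / β, ha, haζ, hζq, hq, ?_, ?_, by fun_prop,
    ?_, ?_, ?_, ?_, ?_, ?_, ?_, ?_, ?_⟩
  · refine hlen.trans ?_
    rw [div_le_iff₀ hζ, hσ]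
    linarith
  · intro x
    have h1 : HasDerivAt (fun z => Real.sin z * (1 - ((Real.cos z - μ) / σ) ^ 2) / β) _ x :=
      ((Real.hasDerivAt_sin x).mul (((((Real.hasDerivAt_cos x).sub_const μ).div_const σ).pow
        2).const_sub 1)).div_const β
    refine h1.congr_deriv ?_
    simp
    field_simp
  · simp only [hμ, hca]; rw [div_self hσ0.ne']; ring
  · simp only [hμ, hcq]; rw [neg_div, div_self hσ0.ne']; ring
  · simp only [← hμ, ← hβ]; simp [hβ0.ne']
  · intro z hz
    obtain ⟨h1, h2⟩ := hq1 z hz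
    have h3 := hsin0 z hz
    rw [abs_of_nonneg (by positivity), div_le_iff₀ hβ0]
    have h4 : Real.sin z ≤ 2 * β := by
      refine abs_le_of_sq_le_sq' ?_ (by positivity) |>.2
      linarith [hsin z hz, mul_pow 2 β 2, sq_nonneg β]
    exact (mul_le_of_le_one_right h3 h2).trans h4
  · intro z hz
    obtain ⟨h1, h2⟩ := hq1 z hz
    rw [abs_div, abs_of_pos hβ0]
    -- The second summand is at most `2 (7/5) β² / σ = 14`; dividing the total `15` by `β ≥ 3 ζ / 5`
    -- gives `25 / ζ`.
    have h3 : |Real.cos z * (1 - ((Real.cos z - μ) / σ) ^ 2) +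
      2 * Real.sin z ^ 2 * (Real.cos z - μ) / σ ^ 2| ≤ 1 * 1 + 14 := by
      refine (abs_add_le _ _).trans (add_le_add ?_ ?_)
      · rw [abs_mul, abs_of_nonneg h1]
        exact mul_le_mul (Real.abs_cos_le_one z) h2 h1 (by norm_num)
      · rw [abs_div, abs_mul, abs_of_nonneg (by positivity), abs_of_pos (by positivity : 0 < σ ^ 2),
          div_le_iff₀ (by positivity)]
        calc 2 * Real.sin z ^ 2 * |Real.cos z - μ| ≤ 2 * (7 / 5 * β ^ 2) * σ := by
              gcongr
              · exact hsin z hz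
              · exact hmem z hz
          _ = _ := by rw [hσ]; ring
    calc _ ≤ (1 * 1 + 14) / β := by gcongr
      _ ≤ (1 * 1 + 14) / (3 / 5 * ζ) := by gcongr
      _ = _ := by field_simp; norm_num
  · intro z hz
    have hz' : z ∈ Icc a q := ⟨hz.1, hz.2.trans hζq⟩
    have h3 := hsin0 z hz'
    have h4 := (hq1 z hz').1
    positivity
  · intro z hz
    have hz' : z ∈ Icc a q := ⟨hz.1, hz.2.trans hζq⟩
    have h3 := hsin0 z hz'
    rw [div_le_one hβ0]
    refine (mul_le_of_le_one_right h3 (hq1 z hz').2).trans ?_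
    exact Real.sin_le_sin_of_le_of_le_pi_div_two (by linarith [ha.trans hz.1]) hζ' hz.2
  · intro z hz
    exact (le_abs_self _).trans (hmem z ⟨hz.1, hz.2.trans hζq⟩)
  · intro s hs
    have h1 := integral_regInv_odd hs (H := fun x => (1 - (x / σ) ^ 2) / β) (by fun_prop)
      (fun x => by ring) hca hcq
    rw [← h1]
    refine intervalIntegral.integral_congr fun x _ => ?_
    ring

namespace Rayleigh

variable {lam ζ ε m K a q : ℝ} {ψ p w v g η η' : ℝ → ℝ}

/-- The flux identity across the critical point. -/
lemma crossing_identity (h : Rayleigh (Real.cos ζ) lam 0 ψ p w v g)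
    (c : CriticalBound ζ ε lam m K ψ w g) (t : CrossingTest ζ a q η η') :
    |∫ z in a..q, (p z * η' z + (lam - 1) * (ψ z * η z) - Real.cos ζ *
      (regInv (ζ * ε) (Real.cos z - Real.cos ζ) * ((ψ z - ψ ζ) * η z)))| ≤ 98 * m / √ζ := by
  have hζ := c.hζ
  have hζ' := c.hζ'
  have hε := c.hε
  have hm := c.hm
  have hs : 0 < ζ * ε := by positivity
  have cr := continuous_regInv hs
  have cη := continuous_of_hasDerivAt t.deriv
  have cη' := t.cont
  have cψ := h.cψ
  have cp := h.cp
  have hsζ : 0 < √ζ := Real.sqrt_pos.2 hζ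
  have haq := t.haζ.trans t.hζq
  have hid := h.integral_w_mul t.deriv cη' a q
  rw [h.integral_w_mul_eq hζ hε cη, t.left, t.right] at hid
  have e1 : ∫ z in a..q, (p z * η' z + (lam - 1) * (ψ z * η z) - Real.cos ζ *
      (regInv (ζ * ε) (Real.cos z - Real.cos ζ) * ((ψ z - ψ ζ) * η z))) =
      (∫ z in a..q, (p z * η' z + (lam - 1) * (ψ z * η z))) -
      (∫ z in a..q, regInv (ζ * ε) (Real.cos z - Real.cos ζ) *
        ((0 + Real.cos ζ * ψ z) * η z)) := by
    -- By `odd`, `ψ z` may be replaced by `ψ z - ψ ζ` in the singular term. After this the two sides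
    -- of `ζ` can be estimated separately with Hardy's inequality.
    have h0 : (∫ z in a..q, Real.cos ζ * ψ ζ *
        (regInv (ζ * ε) (Real.cos z - Real.cos ζ) * η z)) = 0 := by
      rw [intervalIntegral.integral_const_mul, t.odd _ hs, mul_zero]
    rw [← integral_sub_cont (by fun_prop) (by fun_prop)]
    refine Eq.trans ?_ ((congrArg (_ + ·) h0).trans (add_zero _))
    rw [← integral_add_cont (by fun_prop) (by fun_prop)]
    refine intervalIntegral.integral_congr fun x _ => ?_
    ring
  have t1 : |∫ x in a..q, (1 - (Real.cos x - Real.cos ζ) *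
        regInv (ζ * ε) (Real.cos x - Real.cos ζ)) * w x * η x| ≤ 10 * m / √ζ := by
    refine (h.abs_integral_cutoff_le hζ hζ' hε cη t.ha t.hq t.haζ t.hζq (M := 2) (by norm_num)
      fun x hx _ => t.bound x hx).trans ?_
    have h1 : √(22 * ε) * √(sqInt w (ζ - 11 * ε) (ζ + 11 * ε)) ≤ 5 * m / √ζ := by
      rw [le_div_iff₀ hsζ, ← Real.sqrt_mul (by positivity), ← Real.sqrt_mul (by
        have : 0 ≤ sqInt w (ζ - 11 * ε) (ζ + 11 * ε) := sqInt_nonneg (by linarith)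
        positivity)]
      refine Real.sqrt_le_iff.2 ⟨by positivity, ?_⟩
      linarith [c.local_w, mul_pow 5 m 2, sq_nonneg m]
    calc _ ≤ 2 * (5 * m / √ζ) := by gcongr
      _ = _ := by ring
  have t2 := h.abs_integral_regInv_g_le hζ hζ' hε cη haq t.ha t.hq (M := 2) (by norm_num)
    t.bound hm c.force
  have e2 : 44 / √ζ * 2 * m = 88 * m / √ζ := by ring
  have e3 : 98 * m / √ζ = 10 * m / √ζ + 88 * m / √ζ := by ring
  rw [e1, abs_le]
  have a1 := abs_le.1 t1
  have a2 := abs_le.1 t2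
  constructor <;> linarith

set_option maxHeartbeats 800000 in
/-- The contribution of the outer side to the flux. -/
lemma crossing_outer_le (h : Rayleigh (Real.cos ζ) lam 0 ψ p w v g) (hB : BoundaryCond ψ p)
    (c : CriticalBound ζ ε lam m K ψ w g) (t : CrossingTest ζ a q η η') :
    |∫ z in ζ..q, (p z * η' z + (lam - 1) * (ψ z * η z) - Real.cos ζ *
      (regInv (ζ * ε) (Real.cos z - Real.cos ζ) * ((ψ z - ψ ζ) * η z)))| ≤
      28000 * K ^ 2 * m / √ζ := by
  have hζ := c.hζ
  have hζ' := c.hζ'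
  have hε := c.hε
  have hm := c.hm
  have hK := c.hK
  have hlam : 0 ≤ lam - 1 := by linarith [c.hlam]
  have hs : 0 < ζ * ε := by positivity
  have cr := continuous_regInv hs
  have cη := continuous_of_hasDerivAt t.deriv
  have cη' := t.cont
  have cψ := h.cψ
  have cp := h.cp
  have hsζ : 0 < √ζ := Real.sqrt_pos.2 hζ
  have hζζ : √ζ * √ζ = ζ := Real.mul_self_sqrt hζ.le
  have hne : ∀ x : ℝ, |x - ζ| + ε ≠ 0 := fun x => by positivity
  have cH : Continuous fun x => (ψ x - ψ ζ) / (|x - ζ| + ε) := by fun_prop (disch := exact hne _)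
  have hμ0 : 0 ≤ Real.cos ζ :=
    Real.cos_nonneg_of_neg_pi_div_two_le_of_le (by linarith [Real.pi_pos]) hζ'
  have hμ1 := Real.cos_le_one ζ
  obtain ⟨hP, hΨ⟩ := h.outer_le hB c
  have hP1 := sqInt_mono_interval le_rfl t.hζq t.hq cp
  have hΨ1 := mul_le_mul_of_nonneg_left (sqInt_mono_interval le_rfl t.hζq t.hq cψ) hlam
  have hsP : √(sqInt p ζ q) ≤ 159 * (K * m) := by
    refine Real.sqrt_le_iff.2 ⟨by positivity, ?_⟩
    linarith [mul_pow 159 (K * m) 2, mul_pow K m 2, sq_nonneg (K * m)]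
  have hsl : √(lam - 1) * ζ ≤ K := by
    refine abs_le_of_sq_le_sq' ?_ (by linarith) |>.2
    rw [mul_pow, Real.sq_sqrt hlam]
    exact c.freq
  have hsΨ : √(lam - 1) * √(sqInt ψ ζ q) ≤ 159 * (K * m) := by
    rw [← Real.sqrt_mul hlam]
    refine Real.sqrt_le_iff.2 ⟨by positivity, ?_⟩
    linarith [mul_pow 159 (K * m) 2, mul_pow K m 2, sq_nonneg (K * m)]
  have hlen : √(sqInt (fun _ => 1) ζ q) ≤ 3 / 2 * √ζ := by
    rw [sqInt_one]
    refine Real.sqrt_le_iff.2 ⟨by positivity, ?_⟩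
    rw [mul_pow, Real.sq_sqrt hζ.le]
    linarith [t.len]
  have hsub : ∀ x ∈ Icc ζ q, x ∈ Icc a q := fun x hx => ⟨t.haζ.trans hx.1, hx.2⟩
  have b1 : |∫ z in ζ..q, p z * η' z| ≤ 6000 * (K * m) / √ζ := by
    refine (abs_integral_le_of_abs_le_mul (M := 25 / ζ) t.hζq (by positivity) (by fun_prop) cp
      (continuous_const (y := (1 : ℝ))) fun x hx => ?_).trans ?_
    · rw [abs_mul, abs_one, mul_one, mul_comm]
      exact mul_le_mul_of_nonneg_right (t.bound' x (hsub x hx)) (abs_nonneg _)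
    · calc _ ≤ 25 / ζ * (159 * (K * m) * (3 / 2 * √ζ)) := by gcongr
        _ = 5962.5 * (K * m) * √ζ / (√ζ * √ζ) := by rw [hζζ]; ring
        _ = 5962.5 * (K * m) / √ζ := by field_simp
        _ ≤ _ := by gcongr; norm_num
  have b2 : |∫ z in ζ..q, (lam - 1) * (ψ z * η z)| ≤ 500 * K ^ 2 * m / √ζ := by
    rw [intervalIntegral.integral_const_mul, abs_mul, abs_of_nonneg hlam]
    have h1 := abs_integral_le_of_abs_le_mul (H := fun z => ψ z * η z) (M := 2) t.hζq
      (by positivity) (by fun_prop) cψ (continuous_const (y := (1 : ℝ))) fun x hx => by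
        rw [abs_mul, abs_one, mul_one, mul_comm]
        exact mul_le_mul_of_nonneg_right (t.bound x (hsub x hx)) (abs_nonneg _)
    calc _ ≤ (lam - 1) * (2 * (√(sqInt ψ ζ q) * (3 / 2 * √ζ))) := by
          gcongr; exact h1.trans (by gcongr)
      _ = 3 * (√(lam - 1) * √(lam - 1)) * √(sqInt ψ ζ q) * √ζ := by
          rw [Real.mul_self_sqrt hlam]; ring
      _ = 3 * (√(lam - 1) * (√ζ * √ζ)) * (√(lam - 1) * √(sqInt ψ ζ q)) / √ζ := by
          field_simp
      _ ≤ 3 * K * (159 * (K * m)) / √ζ := by rw [hζζ]; gcongr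
      _ = 477 * K ^ 2 * m / √ζ := by ring
      _ ≤ _ := by gcongr; norm_num
  have b3 : |∫ z in ζ..q, Real.cos ζ *
      (regInv (ζ * ε) (Real.cos z - Real.cos ζ) * ((ψ z - ψ ζ) * η z))| ≤
      21000 * (K * m) / √ζ := by
    have hH : √(sqInt (fun x => (ψ x - ψ ζ) / (|x - ζ| + ε)) ζ q) ≤ 2 * (159 * (K * m)) := by
      refine (Real.sqrt_le_sqrt (hardy_interior h.hψ cp le_rfl t.hζq hε)).trans ?_
      rw [Real.sqrt_mul (by norm_num), show (4 : ℝ) = 2 ^ 2 by norm_num,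
        Real.sqrt_sq (by norm_num)]
      gcongr
    refine (abs_integral_le_of_abs_le_mul (M := 44 / ζ) t.hζq (by positivity) (by fun_prop) cH
      (continuous_const (y := (1 : ℝ))) fun x hx => ?_).trans ?_
    · have hr := abs_regInv_cos_le (z := x) ⟨hζ.le.trans hx.1, hx.2.trans t.hq⟩ hζ hζ' hε
      have h3 : 0 < |x - ζ| + ε := by positivity
      rw [abs_mul, abs_mul, abs_mul, abs_div, abs_of_pos h3, abs_one, abs_of_nonneg hμ0]
      calc _ ≤ 1 * (22 / ζ * (1 / (|x - ζ| + ε)) * (|ψ x - ψ ζ| * 2)) := by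
            gcongr; exact t.bound x (hsub x hx)
        _ = _ := by ring
    · calc _ ≤ 44 / ζ * (2 * (159 * (K * m)) * (3 / 2 * √ζ)) := by gcongr
        _ = 20988 * (K * m) * √ζ / (√ζ * √ζ) := by rw [hζζ]; ring
        _ = 20988 * (K * m) / √ζ := by field_simp
        _ ≤ _ := by gcongr; norm_num
  rw [integral_sub_cont (by fun_prop) (by fun_prop), integral_add_cont (by fun_prop) (by fun_prop)]
  have hKm : K * m ≤ K ^ 2 * m := by
    rw [sq]; exact mul_le_mul_of_nonneg_right (le_mul_of_one_le_left (by linarith) hK) hm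
  have hfin : 6000 * (K * m) / √ζ + 500 * K ^ 2 * m / √ζ + 21000 * (K * m) / √ζ ≤
      28000 * K ^ 2 * m / √ζ := by
    rw [← add_div, ← add_div]
    gcongr
    linarith [mul_nonneg (sq_nonneg K) hm]
  have a1 := abs_le.1 b1
  have a2 := abs_le.1 b2
  have a3 := abs_le.1 b3
  rw [abs_le]
  constructor <;> linarith

end Rayleigh

lemma abs_integral_le_of_abs_le {H F : ℝ → ℝ} {a b M l : ℝ} (hab : a ≤ b) (hM : 0 ≤ M)
    (hH : Continuous H) (hF : Continuous F) (hl : b - a ≤ l)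
    (h : ∀ x ∈ Icc a b, |H x| ≤ M * |F x|) : |∫ x in a..b, H x| ≤ M * (√l * √(sqInt F a b)) := by
  refine (abs_integral_le_of_abs_le_mul hab hM hH hF (continuous_const (y := (1 : ℝ)))
    fun x hx => ?_).trans ?_
  · rw [abs_one, mul_one]; exact h x hx
  · rw [sqInt_one, mul_comm √(sqInt F a b)]
    gcongr

section Coefficient

variable {lam ζ ε m K a q : ℝ} {ψ p w v g η η' : ℝ → ℝ}

/-- The ground state is almost a zero mode of the flux functional except for its slope. -/
lemma CriticalBound.crossing_coefficient_le (c : CriticalBound ζ ε lam m K ψ w g)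
    (t : CrossingTest ζ a q η η') :
    |∫ z in a..ζ, (Real.cos z - Real.cos ζ * (regInv (ζ * ε) (Real.cos z - Real.cos ζ) *
      groundState ζ ((ζ * ε) ^ 2) z)) * η z| ≤ 17 / 50 * Real.sin ζ := by
  have hζ := c.hζ
  have hζ' := c.hζ'
  have hε := c.hε
  have hεζ := c.hεζ
  have hpi := Real.pi_lt_d4
  have hs : 0 < ζ * ε := by positivity
  have cr := continuous_regInv hs
  have cη := continuous_of_hasDerivAt t.deriv
  have hβ0 := half_le_sin hζ.le hζ'
  have hβ1 := Real.sin_le_one ζ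
  have hβp : 0 ≤ Real.sin ζ := by linarith
  have hμ0 : 0 ≤ Real.cos ζ :=
    Real.cos_nonneg_of_neg_pi_div_two_le_of_le (by linarith [Real.pi_pos]) hζ'
  have hμ1 := Real.cos_le_one ζ
  have hne : ∀ x : ℝ, |x - ζ| + 11 * ε ≠ 0 := fun x => by positivity
  have cG : Continuous fun x => 1 / (|x - ζ| + 11 * ε) := by fun_prop (disch := exact hne _)
  have hpt : ∀ z ∈ Icc a ζ, |(Real.cos z - Real.cos ζ *
      (regInv (ζ * ε) (Real.cos z - Real.cos ζ) * groundState ζ ((ζ * ε) ^ 2) z)) * η z| ≤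
      (Real.sin ζ ^ 2 / 5 + ζ * ε) + 484 * ε ^ 2 * (1 / (|z - ζ| + 11 * ε)) ^ 2 := by
    intro z hz
    have hz' : z ∈ Icc 0 ζ := ⟨t.ha.trans hz.1, hz.2⟩
    have h1 := cos_sub_cos_nonneg hζ' hz'
    have h2 := t.level z hz
    have h3 := abs_regInv_mul_scale_le hs (Real.cos z - Real.cos ζ)
    rw [abs_of_nonneg (regInv_nonneg hs h1)] at h3
    have hr0 := regInv_nonneg hs h1
    have h4 := mul_regInv_mem hs (Real.cos z - Real.cos ζ)
    have hk : 1 - (Real.cos z - Real.cos ζ) * regInv (ζ * ε) (Real.cos z - Real.cos ζ) ≤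
        484 * ε ^ 2 * (1 / (|z - ζ| + 11 * ε)) ^ 2 := by
      rcases le_total (11 * ε) |z - ζ| with h5 | h5
      · have h6 := mul_abs_le_abs_cos_sub_cos (z := z) (ζ := ζ)
          ⟨hz'.1, by linarith [hz'.2, Real.pi_pos]⟩ ⟨hζ.le, hζ'⟩
        rw [one_sub_mul_regInv_eq_zero hs]
        · positivity
        · refine le_trans ?_ h6
          rw [le_div_iff₀ (by norm_num)]
          calc ζ * ε * 11 = ζ * (11 * ε) := by ring
            _ ≤ _ := by gcongr
      · have h7 : 1 ≤ 484 * ε ^ 2 * (1 / (|z - ζ| + 11 * ε)) ^ 2 := by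
          rw [one_div, inv_pow, ← div_eq_mul_inv, le_div_iff₀ (by positivity), one_mul]
          calc (|z - ζ| + 11 * ε) ^ 2 ≤ (11 * ε + 11 * ε) ^ 2 := by gcongr
            _ = _ := by ring
        linarith
    rw [groundState_eq hζ' hz', abs_mul, abs_of_nonneg (t.nonneg z hz)]
    refine (mul_le_of_le_one_right (abs_nonneg _) (t.le_one z hz)).trans ?_
    set b := Real.cos z - Real.cos ζ with hb
    set r := regInv (ζ * ε) b
    -- Three small terms: `b` is at most `sin² ζ / 5` by `level`, `1 - b r` vanishes at distance `11
    -- ε` from `ζ`, and the last one is at most `ζ ε`.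
    have e : Real.cos z - Real.cos ζ * (r * (b + (ζ * ε) ^ 2)) =
        b + Real.cos ζ * (1 - b * r) - Real.cos ζ * (r * (ζ * ε) * (ζ * ε)) := by
      rw [hb]; ring
    have h5 : r * (ζ * ε) * (ζ * ε) ≤ 1 * (ζ * ε) := by gcongr
    have h6 : Real.cos ζ * (r * (ζ * ε) * (ζ * ε)) ≤ ζ * ε :=
      (mul_le_of_le_one_left (by positivity) hμ1).trans (by linarith)
    have h7 : 0 ≤ Real.cos ζ * (r * (ζ * ε) * (ζ * ε)) := by positivity
    have h8 : 0 ≤ Real.cos ζ * (1 - b * r) := mul_nonneg hμ0 (by linarith [h4.2])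
    have h9 : Real.cos ζ * (1 - b * r) ≤ 1 - b * r :=
      mul_le_of_le_one_left (by linarith [h4.2]) hμ1
    rw [e, abs_le]
    constructor <;> linarith [sq_nonneg (Real.sin ζ)]
  have hGS : Continuous (groundState ζ ((ζ * ε) ^ 2)) := continuous_groundState
  calc _ ≤ ∫ z in a..ζ, |(Real.cos z - Real.cos ζ * (regInv (ζ * ε) (Real.cos z - Real.cos ζ) *
        groundState ζ ((ζ * ε) ^ 2) z)) * η z| :=
        intervalIntegral.abs_integral_le_integral_abs t.haζ
    _ ≤ ∫ z in a..ζ, ((Real.sin ζ ^ 2 / 5 + ζ * ε) +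
        484 * ε ^ 2 * (1 / (|z - ζ| + 11 * ε)) ^ 2) :=
        integral_mono_cont t.haζ (by fun_prop) (by fun_prop) hpt
    _ = (ζ - a) * (Real.sin ζ ^ 2 / 5 + ζ * ε) +
        484 * ε ^ 2 * sqInt (fun z => 1 / (|z - ζ| + 11 * ε)) a ζ := by
        rw [integral_add_cont (by fun_prop) (by fun_prop), intervalIntegral.integral_const_mul]
        simp [sqInt]
        ring
    _ ≤ ζ * (Real.sin ζ ^ 2 / 5 + ζ * ε) + 484 * ε ^ 2 * (2 / (11 * ε)) := by
        gcongr
        · linarith [t.ha]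
        · exact sqInt_inv_le t.haζ le_rfl (by positivity)
    _ = ζ * Real.sin ζ * Real.sin ζ / 5 + ζ * ζ * ε + 88 * ε := by field_simp; ring
    -- The first term is below `0.3142 sin ζ`; the others are covered by `ε ≤ ζ / 10⁴` and `ζ ≤ 5
    -- sin ζ / 3`. What matters is `17/50 < 1`: the flux `sin ζ` of the ground state is not
    -- cancelled.
    _ ≤ 1.5708 * 1 * Real.sin ζ / 5 + 1.5708 * 1.5708 * ε + 88 * ε := by
        have : ζ ≤ 1.5708 := by linarith
        gcongr
    _ ≤ _ := by linarith

end Coefficient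

/-! ### The inner side of the flux -/

namespace Rayleigh

variable {lam ζ ε m K a q : ℝ} {ψ p w v g η η' : ℝ → ℝ}

set_option maxHeartbeats 1600000 in
/-- The inner side of the flux controls the amplitude of the ground state. -/
lemma crossing_inner_le (h : Rayleigh (Real.cos ζ) lam 0 ψ p w v g)
    (c : CriticalBound ζ ε lam m K ψ w g) (t : CrossingTest ζ a q η η') {F : ℝ → ℝ}
    (hF : ∀ x, F x = ψ x - ψ ζ) {D Y : ℝ} (hD0 : 0 ≤ D) (hY0 : 0 ≤ Y)
    (hD : sqInt (groundDeriv ζ ((ζ * ε) ^ 2) F p) 0 ζ ≤ D ^ 2)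
    (hY : (lam - 1) * sqInt F 0 ζ ≤ Y ^ 2) :
    33 / 50 * Real.sin ζ * |F 0 / groundState ζ ((ζ * ε) ^ 2) 0| ≤
      |∫ z in a..ζ, (p z * η' z + (lam - 1) * (ψ z * η z) - Real.cos ζ *
        (regInv (ζ * ε) (Real.cos z - Real.cos ζ) * ((ψ z - ψ ζ) * η z)))| +
      (619 * D + K * Y + K ^ 2 * m) / √ζ := by
  have hζ := c.hζ
  have hζ' := c.hζ'
  have hε := c.hε
  have hm := c.hm
  have hK := c.hK
  have hpi := Real.pi_lt_d4
  have hlam : 0 ≤ lam - 1 := by linarith [c.hlam]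
  have hs : 0 < ζ * ε := by positivity
  have hεζ : ε ≤ ζ / 10 ^ 4 := c.hεζ
  have hsle : ζ * ε ≤ 1 := by
    calc ζ * ε ≤ ζ * (ζ / 10 ^ 4) := by gcongr
      _ ≤ 2 * (2 / 10 ^ 4) := by gcongr <;> linarith
      _ ≤ 1 := by norm_num
  have hτ : 0 < (ζ * ε) ^ 2 := by positivity
  have hne := fun z => (groundState_pos (ζ := ζ) hτ z).ne'
  have cr := continuous_regInv hs
  have cη := continuous_of_hasDerivAt t.deriv
  have cη' := t.cont
  have cψ := h.cψ
  have cp := h.cp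
  have dF : ∀ x, HasDerivAt F (p x) x := fun x => by
    rw [funext hF]
    exact (h.hψ x).sub_const _
  have cF := continuous_of_hasDerivAt dF
  have cd := continuous_groundDeriv (ζ := ζ) hτ cF cp
  have hsζ : 0 < √ζ := Real.sqrt_pos.2 hζ
  have hζζ : √ζ * √ζ = ζ := Real.mul_self_sqrt hζ.le
  have hμ0 : 0 ≤ Real.cos ζ :=
    Real.cos_nonneg_of_neg_pi_div_two_le_of_le (by linarith [Real.pi_pos]) hζ'
  have hμ1 := Real.cos_le_one ζ
  have hsub : ∀ x ∈ Icc a ζ, x ∈ Icc a q := fun x hx => ⟨hx.1, hx.2.trans t.hζq⟩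
  have hsub0 : ∀ x ∈ Icc a ζ, x ∈ Icc 0 ζ := fun x hx => ⟨t.ha.trans hx.1, hx.2⟩
  have hlen : ζ - a ≤ ζ := by linarith [t.ha]
  have hq := sqInt_ground_quotient_le hζ hζ' hτ dF cp
  have hcoef := c.crossing_coefficient_le t
  set B := groundState ζ ((ζ * ε) ^ 2) with hB
  have cB : Continuous B := continuous_groundState
  set d := groundDeriv ζ ((ζ * ε) ^ 2) F p with hd
  set φ₀ := F 0 / B 0 with hφ₀
  obtain ⟨φ, hφ⟩ : ∃ φ : ℝ → ℝ, ∀ z, φ z = F z / B z - φ₀ := ⟨_, fun _ => rfl⟩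
  rw [← funext hφ] at hq
  have cφ : Continuous φ := by rw [funext hφ]; fun_prop (disch := exact hne _)
  -- Decomposition `F = B (φ₀ + φ)`: `φ₀` is the amplitude of the ground state, and the deviation
  -- `φ` is controlled by `D`.
  have hpd : ∀ z, p z = d z - Real.sin z * (φ₀ + φ z) := fun z => by
    rw [hφ, hd, groundDeriv, ← hB]; ring
  have hFB : ∀ z, F z = B z * (φ₀ + φ z) := fun z => by
    have := hne z
    rw [hφ, ← hB] at *
    field_simp
    ring
  clear_value φ₀ d
  have hsd : √(sqInt d a ζ) ≤ D := by
    refine Real.sqrt_le_iff.2 ⟨hD0, (sqInt_mono_interval t.ha t.haζ le_rfl cd).trans hD⟩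
  have hsφ : √(sqInt φ a ζ) ≤ 22 / ζ * D := by
    refine Real.sqrt_le_iff.2 ⟨by positivity, ?_⟩
    refine (sqInt_mono_interval t.ha t.haζ le_rfl cφ).trans (hq.trans ?_)
    calc _ ≤ 484 / ζ ^ 2 * D ^ 2 := by gcongr
      _ = _ := by ring
  have hsF : √(lam - 1) * √(sqInt F a ζ) ≤ Y := by
    rw [← Real.sqrt_mul hlam]
    refine Real.sqrt_le_iff.2 ⟨hY0, ?_⟩
    exact (mul_le_mul_of_nonneg_left (sqInt_mono_interval t.ha t.haζ le_rfl cF) hlam).trans hY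
  have hsl : √(lam - 1) * ζ ≤ K := by
    refine abs_le_of_sq_le_sq' ?_ (by linarith) |>.2
    rw [mul_pow, Real.sq_sqrt hlam]
    exact c.freq
  have hrB : ∀ z ∈ Icc a ζ, |regInv (ζ * ε) (Real.cos z - Real.cos ζ) * B z| ≤ 2 := by
    intro z hz
    have hz' := hsub0 z hz
    have h1 := cos_sub_cos_nonneg hζ' hz'
    have h3 := abs_regInv_mul_scale_le hs (Real.cos z - Real.cos ζ)
    rw [abs_of_nonneg (regInv_nonneg hs h1)] at h3
    have hr0 := regInv_nonneg hs h1
    have h4 := mul_regInv_mem hs (Real.cos z - Real.cos ζ)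
    rw [hB, groundState_eq hζ' hz', abs_of_nonneg (by positivity)]
    set b := Real.cos z - Real.cos ζ
    set r := regInv (ζ * ε) b
    have h5 : r * (ζ * ε) * (ζ * ε) ≤ 1 * 1 := by gcongr
    have e : r * (b + (ζ * ε) ^ 2) = b * r + r * (ζ * ε) * (ζ * ε) := by ring
    rw [e]
    linarith [h4.2]
  have hη1 : ∀ z ∈ Icc a ζ, |η z| ≤ 1 := fun z hz => by
    rw [abs_of_nonneg (t.nonneg z hz)]; exact t.le_one z hz
  have hsin : ∀ z ∈ Icc a ζ, |Real.sin z| ≤ ζ := fun z hz => by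
    refine Real.abs_sin_le_abs.trans ?_
    rw [abs_of_nonneg (hsub0 z hz).1]; exact hz.2
  have b1 : |∫ z in a..ζ, d z * η' z| ≤ 25 * D / √ζ := by
    refine (abs_integral_le_of_abs_le (M := 25 / ζ) t.haζ (by positivity) (by fun_prop) cd hlen
      fun x hx => ?_).trans ?_
    · rw [abs_mul, mul_comm]
      exact mul_le_mul_of_nonneg_right (t.bound' x (hsub x hx)) (abs_nonneg _)
    · calc _ ≤ 25 / ζ * (√ζ * D) := by gcongr
        _ = 25 * D * √ζ / (√ζ * √ζ) := by rw [hζζ]; ring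
        _ = _ := by field_simp
  have b2 : |∫ z in a..ζ, Real.sin z * (φ z * η' z)| ≤ 550 * D / √ζ := by
    refine (abs_integral_le_of_abs_le (M := 25) t.haζ (by positivity) (by fun_prop) cφ hlen
      fun x hx => ?_).trans ?_
    · rw [abs_mul, abs_mul]
      calc _ ≤ ζ * (|φ x| * (25 / ζ)) := by
            gcongr
            · exact hsin x hx
            · exact t.bound' x (hsub x hx)
        _ = _ := by field_simp
    · calc _ ≤ 25 * (√ζ * (22 / ζ * D)) := by gcongr
        _ = 550 * D * √ζ / (√ζ * √ζ) := by rw [hζζ]; ring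
        _ = _ := by field_simp
  have b3 : |∫ z in a..ζ, Real.cos ζ * (regInv (ζ * ε) (Real.cos z - Real.cos ζ) *
      B z * (φ z * η z))| ≤ 44 * D / √ζ := by
    refine (abs_integral_le_of_abs_le (M := 2) t.haζ (by positivity) (by fun_prop) cφ hlen
      fun x hx => ?_).trans ?_
    · rw [abs_mul, abs_mul, abs_mul (φ x), abs_of_nonneg hμ0]
      calc _ ≤ 1 * (2 * (|φ x| * 1)) := by
            gcongr
            · exact hrB x hx
            · exact hη1 x hx
        _ = _ := by ring
    · calc _ ≤ 2 * (√ζ * (22 / ζ * D)) := by gcongr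
        _ = 44 * D * √ζ / (√ζ * √ζ) := by rw [hζζ]; ring
        _ = _ := by field_simp
  have b4 : |∫ z in a..ζ, (lam - 1) * (F z * η z)| ≤ K * Y / √ζ := by
    rw [intervalIntegral.integral_const_mul, abs_mul, abs_of_nonneg hlam]
    have h1 := abs_integral_le_of_abs_le (H := fun z => F z * η z) (M := 1) t.haζ
      (by positivity) (by fun_prop) cF hlen fun x hx => by
        rw [abs_mul, mul_comm]
        exact mul_le_mul_of_nonneg_right (hη1 x hx) (abs_nonneg _)
    calc _ ≤ (lam - 1) * (1 * (√ζ * √(sqInt F a ζ))) := by gcongr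
      _ = (√(lam - 1) * √(lam - 1)) * √(sqInt F a ζ) * √ζ := by
          rw [Real.mul_self_sqrt hlam]; ring
      _ = (√(lam - 1) * (√ζ * √ζ)) * (√(lam - 1) * √(sqInt F a ζ)) / √ζ := by
          field_simp
      _ ≤ K * Y / √ζ := by rw [hζζ]; gcongr
  have b5 : |∫ z in a..ζ, (lam - 1) * (ψ ζ * η z)| ≤ K ^ 2 * m / √ζ := by
    rw [intervalIntegral.integral_const_mul, abs_mul, abs_of_nonneg hlam]
    have h1 := abs_integral_le_of_abs_le (H := fun z => ψ ζ * η z) (F := fun _ => 1)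
      (M := |ψ ζ|) t.haζ
      (by positivity) (by fun_prop) continuous_const hlen fun x hx => by
        rw [abs_mul, abs_one]
        exact mul_le_mul_of_nonneg_left (hη1 x hx) (abs_nonneg _)
    rw [sqInt_one] at h1
    calc _ ≤ (lam - 1) * (√ζ * m * (√ζ * √ζ)) := by
          gcongr
          refine h1.trans ?_
          gcongr
          exact c.value
      _ = (lam - 1) * (√ζ * √ζ) ^ 2 * m / √ζ := by field_simp
      _ = (lam - 1) * ζ ^ 2 * m / √ζ := by rw [hζζ]
      _ ≤ _ := by gcongr; exact c.freq
  -- For the ground state `F' = -sin z`, and its flux is a total derivative up to the error of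
  -- `crossing_coefficient_le`. Hence `φ₀` enters the flux with the factor `-(sin ζ - Q)`, of
  -- modulus at least `33/50 sin ζ`.
  have e0 : ∫ z in a..ζ, (Real.sin z * η' z + Real.cos z * η z) = Real.sin ζ := by
    have hder : ∀ x ∈ uIcc a ζ, HasDerivAt (fun z => Real.sin z * η z)
        (Real.sin x * η' x + Real.cos x * η x) x := fun x _ =>
      ((Real.hasDerivAt_sin x).mul (t.deriv x)).congr_deriv (by ring)
    rw [intervalIntegral.integral_eq_sub_of_hasDerivAt hder
      (Continuous.intervalIntegrable (by fun_prop) _ _), t.left, t.mid]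
    ring
  have e1 : ∫ z in a..ζ, (p z * η' z + (lam - 1) * (ψ z * η z) - Real.cos ζ *
        (regInv (ζ * ε) (Real.cos z - Real.cos ζ) * ((ψ z - ψ ζ) * η z))) =
      (∫ z in a..ζ, d z * η' z) - (∫ z in a..ζ, Real.sin z * (φ z * η' z)) -
      (∫ z in a..ζ, Real.cos ζ * (regInv (ζ * ε) (Real.cos z - Real.cos ζ) *
        B z * (φ z * η z))) + (∫ z in a..ζ, (lam - 1) * (F z * η z)) +
      (∫ z in a..ζ, (lam - 1) * (ψ ζ * η z)) -
      φ₀ * (∫ z in a..ζ, (Real.sin z * η' z + Real.cos z * η z)) +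
      φ₀ * (∫ z in a..ζ, (Real.cos z - Real.cos ζ *
        (regInv (ζ * ε) (Real.cos z - Real.cos ζ) * B z)) * η z) := by
    rw [← intervalIntegral.integral_const_mul φ₀, ← intervalIntegral.integral_const_mul φ₀,
      ← integral_sub_cont (by fun_prop) (by fun_prop),
      ← integral_sub_cont (by fun_prop) (by fun_prop),
      ← integral_add_cont (by fun_prop) (by fun_prop),
      ← integral_add_cont (by fun_prop) (by fun_prop),
      ← integral_sub_cont (by fun_prop) (by fun_prop),
      ← integral_add_cont (by fun_prop) (by fun_prop)]
    refine intervalIntegral.integral_congr fun z _ => ?_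
    have h1 := hFB z
    have h2 := hF z
    have h3 : ψ z = B z * (φ₀ + φ z) + ψ ζ := by rw [← h1, h2]; ring
    simp only [hpd z, h1, h3]
    ring
  rw [e0] at e1
  set I := ∫ z in a..ζ, (p z * η' z + (lam - 1) * (ψ z * η z) - Real.cos ζ *
        (regInv (ζ * ε) (Real.cos z - Real.cos ζ) * ((ψ z - ψ ζ) * η z)))
  set Q := ∫ z in a..ζ, (Real.cos z - Real.cos ζ *
        (regInv (ζ * ε) (Real.cos z - Real.cos ζ) * B z)) * η z
  set R := (∫ z in a..ζ, d z * η' z) - (∫ z in a..ζ, Real.sin z * (φ z * η' z)) -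
      (∫ z in a..ζ, Real.cos ζ * (regInv (ζ * ε) (Real.cos z - Real.cos ζ) *
        B z * (φ z * η z))) + (∫ z in a..ζ, (lam - 1) * (F z * η z)) +
      (∫ z in a..ζ, (lam - 1) * (ψ ζ * η z)) with hR
  have hRb : |R| ≤ (619 * D + K * Y + K ^ 2 * m) / √ζ := by
    have a1 := abs_le.1 b1
    have a2 := abs_le.1 b2
    have a3 := abs_le.1 b3
    have a4 := abs_le.1 b4
    have a5 := abs_le.1 b5
    have e : (619 * D + K * Y + K ^ 2 * m) / √ζ = 25 * D / √ζ + 550 * D / √ζ + 44 * D / √ζ +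
      K * Y / √ζ + K ^ 2 * m / √ζ := by ring
    rw [e, abs_le]
    constructor <;> linarith
  have h1 : φ₀ * (Real.sin ζ - Q) = R - I := by linarith
  have h2 : |φ₀| * |Real.sin ζ - Q| ≤ |I| + |R| := by
    rw [← abs_mul, h1]
    linarith [abs_sub R I]
  have h3 : 33 / 50 * Real.sin ζ ≤ |Real.sin ζ - Q| := by
    have := abs_le.1 hcoef
    refine le_trans ?_ (le_abs_self _)
    linarith
  calc _ = |φ₀| * (33 / 50 * Real.sin ζ) := by ring
    _ ≤ |φ₀| * |Real.sin ζ - Q| := by gcongr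
    _ ≤ |I| + |R| := h2
    _ ≤ _ := by gcongr

end Rayleigh

/-! ### Closing the estimate in the non-perturbative regime -/

namespace Rayleigh

variable {lam ζ ε m K : ℝ} {ψ p w v g : ℝ → ℝ}

/-- Inside the critical point, odd case. -/
lemma inner_dirichlet_le (h : Rayleigh (Real.cos ζ) lam 0 ψ p w v g) (h0 : ψ 0 = 0)
    (c : CriticalBound ζ ε lam m K ψ w g) :
    sqInt p 0 ζ ≤ 5 * 10 ^ 19 * (K ^ 2 * m) ^ 2 ∧
      (lam - 1) * sqInt ψ 0 ζ ≤ 5 * 10 ^ 19 * (K ^ 2 * m) ^ 2 := by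
  have hζ := c.hζ
  have hm := c.hm
  have hK := c.hK
  have hlam : 0 ≤ lam - 1 := by linarith [c.hlam]
  have hτ : 0 < (ζ * ε) ^ 2 := pow_pos (mul_pos hζ c.hε) 2
  -- A linear profile vanishing at `0`: then `F 0 = 0`, and the amplitude term in
  -- `sqInt_deriv_le_ground` disappears.
  have hL : ∀ x, HasDerivAt (fun z : ℝ => z / ζ) (1 / ζ) x := fun x =>
    (hasDerivAt_id x).div_const ζ
  have hL2 : sqInt (fun z : ℝ => z / ζ) 0 ζ ≤ ζ := by
    have h1 := sqInt_mono (F := fun z : ℝ => z / ζ) (G := fun _ => 1) hζ.le (by fun_prop)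
      continuous_const fun x hx => by
        refine pow_le_pow_left₀ (div_nonneg hx.1 hζ.le) ((div_le_one hζ).2 hx.2) 2
    rw [sqInt_one] at h1
    linarith
  have hL2' : sqInt (fun _ : ℝ => 1 / ζ) 0 ζ ≤ 4 / ζ := by
    simp only [sqInt, intervalIntegral.integral_const, sub_zero, smul_eq_mul]
    have : ζ * (1 / ζ) ^ 2 = 1 / ζ := by field_simp
    rw [this]
    gcongr
    norm_num
  obtain ⟨F, hF⟩ : ∃ F : ℝ → ℝ, ∀ x, F x = ψ x - ψ ζ * (x / ζ) := ⟨_, fun _ => rfl⟩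
  obtain ⟨F', hF'⟩ : ∃ F' : ℝ → ℝ, ∀ x, F' x = p x - ψ ζ * (1 / ζ) := ⟨_, fun _ => rfl⟩
  have hF0 : F 0 = 0 := by rw [hF, h0]; simp
  have cp := h.cp
  have dF : ∀ x, HasDerivAt F (F' x) x := fun x => by
    rw [funext hF, hF' x]
    exact (h.hψ x).sub ((hL x).const_mul _)
  have cF' : Continuous F' := by rw [funext hF']; fun_prop
  have hform := h.inner_form_le c hL continuous_const (div_self hζ.ne') hL2 hL2' hF hF'
    (by rw [hF0, mul_zero])
  have hgr := sqInt_deriv_le_ground hζ c.hζ' hτ dF cF'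
  have hun := h.unlift_le c hζ.le (by fun_prop) continuous_const hL2 hL2' hF hF'
  rw [hF0, zero_div] at hgr
  have hX2 := Real.sq_sqrt (sqInt_nonneg (F := F') hζ.le)
  have hX0 := Real.sqrt_nonneg (sqInt F' 0 ζ)
  have hD := sqInt_nonneg (F := groundDeriv ζ ((ζ * ε) ^ 2) F F') hζ.le
  have hΨ := mul_nonneg hlam (sqInt_nonneg (F := F) hζ.le)
  set X := √(sqInt F' 0 ζ)
  set M := K ^ 2 * m with hM
  have hK1 : 1 ≤ K ^ 2 := one_le_pow₀ hK
  have hmM : m ≤ M := le_mul_of_one_le_left hm hK1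
  have hM0 : 0 ≤ M := hm.trans hmM
  have hmM2 : m ^ 2 ≤ M ^ 2 := pow_le_pow_left₀ hm hmM 2
  have hKM : K ^ 2 * m ^ 2 ≤ M ^ 2 := by
    calc K ^ 2 * m ^ 2 = M * m := by rw [hM]; ring
      _ ≤ M * M := by gcongr
      _ = _ := by ring
  have hmX : m * X ≤ M * X := by gcongr
  have h1 : X ^ 2 ≤ 424000 * (M * X) + 2000 * M ^ 2 := by linarith
  have h2 : X ^ 2 ≤ 2 * 10 ^ 11 * M ^ 2 := by
    linarith [sq_nonneg (X - 424000 * M), sub_sq X (424000 * M), mul_pow 424000 M 2, sq_nonneg M]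
  have h3 : 2 * (M * X) ≤ X ^ 2 + M ^ 2 := by linarith [sq_nonneg (X - M), sub_sq X M]
  constructor
  · linarith [hun.1, sq_nonneg M]
  · linarith [hun.2, sq_nonneg M]

set_option maxHeartbeats 800000 in
/-- Inside the critical point, even case. -/
lemma inner_neumann_le (h : Rayleigh (Real.cos ζ) lam 0 ψ p w v g) (hB : BoundaryCond ψ p)
    (h0 : p 0 = 0) (c : CriticalBound ζ ε lam m K ψ w g) :
    sqInt p 0 ζ ≤ 5 * 10 ^ 19 * (K ^ 2 * m) ^ 2 ∧
      (lam - 1) * sqInt ψ 0 ζ ≤ 5 * 10 ^ 19 * (K ^ 2 * m) ^ 2 := by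
  have hζ := c.hζ
  have hζ' := c.hζ'
  have hm := c.hm
  have hK := c.hK
  have hε := c.hε
  have hlam : 0 ≤ lam - 1 := by linarith [c.hlam]
  have hs : 0 < ζ * ε := mul_pos hζ c.hε
  have cr := continuous_regInv hs
  have hτ : 0 < (ζ * ε) ^ 2 := pow_pos hs 2
  -- A constant profile: `F' = p` keeps the Neumann condition at `0`, but `F 0` does not vanish and
  -- the flux identity is needed.
  have hL : ∀ x, HasDerivAt (fun _ : ℝ => (1 : ℝ)) 0 x := fun x => hasDerivAt_const x 1
  have hL2 : sqInt (fun _ : ℝ => 1) 0 ζ ≤ ζ := by rw [sqInt_one]; linarith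
  have hL2' : sqInt (fun _ : ℝ => 0) 0 ζ ≤ 4 / ζ := by
    have : sqInt (fun _ : ℝ => 0) 0 ζ = 0 := by simp [sqInt]
    rw [this]; positivity
  obtain ⟨F, hF⟩ : ∃ F : ℝ → ℝ, ∀ x, F x = ψ x - ψ ζ * 1 := ⟨_, fun _ => rfl⟩
  have hF' : ∀ x, p x = p x - ψ ζ * 0 := fun x => by ring
  have hF1 : ∀ x, F x = ψ x - ψ ζ := fun x => by rw [hF, mul_one]
  have cp := h.cp
  have cψ := h.cψ
  have dF : ∀ x, HasDerivAt F (p x) x := fun x => by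
    rw [funext hF1]
    exact (h.hψ x).sub_const _
  have hform := h.inner_form_le c hL continuous_const rfl hL2 hL2' hF hF'
    (by rw [h0, zero_mul])
  have hgr := sqInt_deriv_le_ground hζ c.hζ' hτ dF cp
  have hun := h.unlift_le c hζ.le continuous_const continuous_const hL2 hL2' hF hF'
  have hX2 := Real.sq_sqrt (sqInt_nonneg (F := p) hζ.le)
  have hX0 := Real.sqrt_nonneg (sqInt p 0 ζ)
  have hD := sqInt_nonneg (F := groundDeriv ζ ((ζ * ε) ^ 2) F p) hζ.le
  have hΨ := mul_nonneg hlam (sqInt_nonneg (F := F) hζ.le)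
  obtain ⟨a, q, η, η', t⟩ := exists_crossingTest hζ hζ'
  have cη := continuous_of_hasDerivAt t.deriv
  have cη' := t.cont
  set Q := sqInt (groundDeriv ζ ((ζ * ε) ^ 2) F p) 0 ζ + (lam - 1) * sqInt F 0 ζ with hQ
  have hQ0 : 0 ≤ Q := add_nonneg hD hΨ
  have hq2 := Real.sq_sqrt hQ0
  have hq0 := Real.sqrt_nonneg Q
  have hfull := h.crossing_identity c t
  have hout := h.crossing_outer_le hB c t
  have hin := h.crossing_inner_le c t hF1 hq0 hq0 (by rw [hq2, hQ]; linarith)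
    (by rw [hq2, hQ]; linarith)
  rw [← integral_adjacent_cont (by fun_prop) a ζ q] at hfull
  set I := ∫ z in a..ζ, (p z * η' z + (lam - 1) * (ψ z * η z) - Real.cos ζ *
        (regInv (ζ * ε) (Real.cos z - Real.cos ζ) * ((ψ z - ψ ζ) * η z)))
  set J := ∫ z in ζ..q, (p z * η' z + (lam - 1) * (ψ z * η z) - Real.cos ζ *
        (regInv (ζ * ε) (Real.cos z - Real.cos ζ) * ((ψ z - ψ ζ) * η z)))
  set X := √(sqInt p 0 ζ)
  set φ₀ := F 0 / groundState ζ ((ζ * ε) ^ 2) 0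
  set y := √Q
  set M := K ^ 2 * m with hM
  have hK1 : 1 ≤ K ^ 2 := one_le_pow₀ hK
  have hmM : m ≤ M := le_mul_of_one_le_left hm hK1
  have hM0 : 0 ≤ M := hm.trans hmM
  have hmM2 : m ^ 2 ≤ M ^ 2 := pow_le_pow_left₀ hm hmM 2
  have hKM : K ^ 2 * m ^ 2 ≤ M ^ 2 := by
    calc K ^ 2 * m ^ 2 = M * m := by rw [hM]; ring
      _ ≤ M * M := by gcongr
      _ = _ := by ring
  have hmX : m * X ≤ M * X := by gcongr
  have hsζ : 0 < √ζ := Real.sqrt_pos.2 hζ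
  have hζζ : √ζ * √ζ = ζ := Real.mul_self_sqrt hζ.le
  have hβ := half_le_sin hζ.le hζ'
  -- The total flux and its outer part are bounded, hence so is the inner part, hence the amplitude.
  -- The quantity on the left is the square root of the term `ζ³ φ₀²` in `sqInt_deriv_le_ground`.
  have hφ : ζ * √ζ * |φ₀| ≤ 71500 * M + 1600 * (K * y) := by
    have h1 : |I| ≤ 98 * m / √ζ + 28000 * K ^ 2 * m / √ζ := by
      have : I = (I + J) - J := by ring
      rw [this]
      exact (abs_sub _ _).trans (add_le_add hfull hout)
    have h2 : 33 / 50 * (3 / 5 * ζ) * |φ₀| ≤ (28100 * M + 620 * (K * y)) / √ζ := by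
      calc _ ≤ 33 / 50 * Real.sin ζ * |φ₀| := by gcongr
        _ ≤ |I| + (619 * y + K * y + K ^ 2 * m) / √ζ := hin
        _ ≤ 98 * m / √ζ + 28000 * K ^ 2 * m / √ζ + (619 * y + K * y + K ^ 2 * m) / √ζ := by gcongr
        _ = (98 * m + 28001 * M + 619 * y + K * y) / √ζ := by rw [hM]; ring
        _ ≤ _ := by
          refine div_le_div_of_nonneg_right ?_ hsζ.le
          linarith [le_mul_of_one_le_left hq0 hK]
    rw [le_div_iff₀ hsζ] at h2
    have h3 : 0 ≤ K * y := by positivity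
    linarith
  have hφ2 : ζ ^ 3 * φ₀ ^ 2 ≤ 2 * (71500 * M) ^ 2 + 2 * (1600 * (K * y)) ^ 2 := by
    have h1 := pow_le_pow_left₀ (by positivity) hφ 2
    have e : (ζ * √ζ * |φ₀|) ^ 2 = ζ ^ 3 * φ₀ ^ 2 := by
      rw [mul_pow, mul_pow, Real.sq_sqrt hζ.le, sq_abs]; ring
    rw [e] at h1
    linarith [sq_nonneg (71500 * M - 1600 * (K * y)), sub_sq (71500 * M) (1600 * (K * y)),
      add_sq (71500 * M) (1600 * (K * y))]
  have hKQ : K ^ 2 * Q ≤ 212 * (M * X) + M ^ 2 := by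
    calc K ^ 2 * Q ≤ K ^ 2 * (212 * m * X + K ^ 2 * m ^ 2) := by gcongr
      _ = _ := by rw [hM]; ring
  have hQK : Q ≤ K ^ 2 * Q := le_mul_of_one_le_left hQ0 hK1
  have hKy : (K * y) ^ 2 = K ^ 2 * Q := by rw [mul_pow, hq2]
  -- Since `(K y)² = K² Q` is linear in `X` by `hKQ`, the amplitude bound closes to a quadratic
  -- inequality for `X`.
  have h1 : X ^ 2 ≤ 45 * 10 ^ 8 * (M * X) + 5 * 10 ^ 10 * M ^ 2 := by
    rw [mul_pow 71500, mul_pow 1600, hKy] at hφ2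
    linarith [sq_nonneg M, mul_nonneg hM0 hX0]
  have h2 : X ^ 2 ≤ 21 * 10 ^ 18 * M ^ 2 := by
    linarith [sq_nonneg (X - 45 * 10 ^ 8 * M), sub_sq X (45 * 10 ^ 8 * M),
      mul_pow (45 * 10 ^ 8) M 2, sq_nonneg M]
  have h3 : 2 * (M * X) ≤ X ^ 2 + M ^ 2 := by linarith [sq_nonneg (X - M), sub_sq X M]
  have hMX : M * X ≤ 5 * 10 ^ 9 * M ^ 2 := by
    have : X ≤ 5 * 10 ^ 9 * M := by
      refine abs_le_of_sq_le_sq' ?_ (by positivity) |>.2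
      linarith [mul_pow (5 * 10 ^ 9) M 2, sq_nonneg M]
    calc M * X ≤ M * (5 * 10 ^ 9 * M) := by gcongr
      _ = _ := by ring
  constructor
  · linarith [hun.1, sq_nonneg M]
  · linarith [hun.2, sq_nonneg M]

/-- The energy in terms of the critical quantities. -/
lemma energy_le_of_criticalBound (h : Rayleigh (Real.cos ζ) lam 0 ψ p w v g)
    (hB : BoundaryCond ψ p) (c : CriticalBound ζ ε lam m K ψ w g) :
    sqInt p 0 π ≤ 10 ^ 20 * (K ^ 2 * m) ^ 2 ∧
      (lam - 1) * sqInt ψ 0 π ≤ 10 ^ 20 * (K ^ 2 * m) ^ 2 := by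
  have hm := c.hm
  have hK1 : 1 ≤ K ^ 2 := one_le_pow₀ c.hK
  obtain ⟨ho1, ho2⟩ := h.outer_le hB c
  have hin : sqInt p 0 ζ ≤ 5 * 10 ^ 19 * (K ^ 2 * m) ^ 2 ∧
      (lam - 1) * sqInt ψ 0 ζ ≤ 5 * 10 ^ 19 * (K ^ 2 * m) ^ 2 := by
    rcases id hB with hN | hD
    · exact h.inner_neumann_le hB hN.1 c
    · exact h.inner_dirichlet_le hD.1 c
  have hKM : K ^ 2 * m ^ 2 ≤ (K ^ 2 * m) ^ 2 := by
    calc K ^ 2 * m ^ 2 = K ^ 2 * m * m := by ring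
      _ ≤ K ^ 2 * m * (K ^ 2 * m) := by gcongr; exact le_mul_of_one_le_left hm hK1
      _ = _ := by ring
  have e1 := sqInt_add_adjacent h.cp 0 ζ π
  have e2 := sqInt_add_adjacent h.cψ 0 ζ π
  rw [← e1, ← e2, mul_add]
  have := sq_nonneg (K ^ 2 * m)
  constructor <;> linarith [hin.1, hin.2]

/-- The key estimate when the nonlocal term is not a perturbation. -/
lemma key_nonperturbative (h : Rayleigh (Real.cos ζ) lam 0 ψ p w v g) (hB : BoundaryCond ψ p)
    (hζ : 0 < ζ) (hζ' : ζ ≤ π / 2) (hlam : 1 ≤ lam)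
    (hθ : 1 / 10 ^ 5 * √lam * Real.sin ζ ≤ Real.cos ζ) (hε : 0 < ε) (hεζ : ε ≤ ζ / 10 ^ 64) :
    sqInt p 0 π + (lam - 1) * sqInt ψ 0 π + ψ ζ ^ 2 / ζ ≤
      10 ^ 64 * rhsT ζ ε (sqInt g 0 π) (sqInt v 0 π) := by
  have hpi := Real.pi_gt_three
  have hεζ' : ε ≤ ζ / 44 := hεζ.trans (by gcongr; norm_num)
  have hA := sqInt_nonneg (F := g) Real.pi_pos.le
  have hP := sqInt_nonneg (F := p) Real.pi_pos.le
  have hV := sqInt_nonneg (F := v) Real.pi_pos.le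
  have hT := rhsT_nonneg hζ hε hA hV
  have hχ := h.critical_value_le hζ hζ' hε hεζ'
  have hZ := h.sqInt_w_critical_le' hζ hζ' hε hεζ'
  have hβ := half_le_sin hζ.le hζ'
  have hβ0 : 0 < Real.sin ζ := by linarith
  have hsl : 1 ≤ √lam := Real.one_le_sqrt.2 hlam
  have hsl2 : √lam ^ 2 = lam := Real.sq_sqrt (by linarith)
  have hsc := Real.sin_sq_add_cos_sq ζ
  have hμ1 := Real.cos_le_one ζ
  have hμβ : 1 / 10 ^ 5 * Real.sin ζ ≤ Real.cos ζ := by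
    refine le_trans ?_ hθ
    calc _ = 1 / 10 ^ 5 * 1 * Real.sin ζ := by ring
      _ ≤ _ := by gcongr
  have hμ0 : 0 ≤ Real.cos ζ := le_trans (by positivity) hμβ
  -- In this regime `cos ζ` is at least `sin ζ / 10⁵`, so it is bounded below and the bound on `cos
  -- ζ · ψ ζ` becomes one on `ψ ζ`. The same hypothesis bounds `lam ζ²`, which gives `K = 10⁶`.
  have hμ2 : 1 / 10 ^ 12 ≤ Real.cos ζ ^ 2 := by
    have h1 := pow_le_pow_left₀ (by positivity) hμβ 2
    rw [mul_pow] at h1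
    linarith
  have hfreq : (lam - 1) * ζ ^ 2 ≤ (10 ^ 6) ^ 2 := by
    have h1 : 1 / 10 ^ 5 * √lam * (3 / 5 * ζ) ≤ 1 :=
      le_trans (by gcongr) (hθ.trans hμ1)
    have h2 := pow_le_one₀ (by positivity) h1 (n := 2)
    have e : (1 / 10 ^ 5 * √lam * (3 / 5 * ζ)) ^ 2 = 9 / 25 / 10 ^ 10 * (√lam ^ 2 * ζ ^ 2) := by
      ring
    rw [e, hsl2] at h2
    linarith [sq_nonneg ζ]
  set T := rhsT ζ ε (sqInt g 0 π) (sqInt v 0 π) with hTd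
  set Y := T + ε / ζ * sqInt p 0 π with hY
  have hY0 : 0 ≤ Y := by positivity
  have hψζ : ψ ζ ^ 2 / ζ ≤ 10 ^ 17 * Y := by
    have e : (0 + Real.cos ζ * ψ ζ) ^ 2 / ζ = Real.cos ζ ^ 2 * (ψ ζ ^ 2 / ζ) := by ring
    rw [e] at hχ
    have h1 : 1 / 10 ^ 12 * (ψ ζ ^ 2 / ζ) ≤ Real.cos ζ ^ 2 * (ψ ζ ^ 2 / ζ) := by gcongr
    linarith
  have hm2 : √(10 ^ 17 * Y) ^ 2 = 10 ^ 17 * Y := Real.sq_sqrt (by positivity)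
  have hgT : sqInt g 0 π ≤ ζ * ε * T := by
    have h1 : sqInt g 0 π / (ζ * ε) ≤ T := by
      rw [hTd, rhsT]
      have : 0 ≤ ζ * ε ^ 3 * sqInt v 0 π := by positivity
      linarith
    rw [div_le_iff₀ (by positivity)] at h1
    linarith
  have hTY : T ≤ Y := by rw [hY]; linarith [show 0 ≤ ε / ζ * sqInt p 0 π by positivity]
  -- `10¹⁷ = 10⁵ · 10¹²`, from `critical_value_le` and the lower bound on `cos² ζ`.
  have c : CriticalBound ζ ε lam √(10 ^ 17 * Y) (10 ^ 6) ψ w g := by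
    refine ⟨hζ, hζ', hε, hεζ.trans (by gcongr <;> norm_num), hlam, Real.sqrt_nonneg _, by norm_num,
      ?_, ?_, ?_, hfreq⟩
    · rw [← Real.sqrt_mul hζ.le]
      refine Real.abs_le_sqrt ?_
      rw [div_le_iff₀ hζ] at hψζ
      linarith
    · rw [hm2]
      refine hgT.trans ?_
      gcongr
      linarith
    · rw [hm2]; linarith
  obtain ⟨h1, h2⟩ := h.energy_le_of_criticalBound hB c
  rw [mul_pow, hm2] at h1 h2
  -- The constants multiply to `10²⁰ · (10⁶)⁴ · 10¹⁷ = 10⁶¹` in front of `Y`; with `ε ≤ ζ / 10⁶⁴`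
  -- the part of `Y` containing `∫ p²` is absorbed.
  have hfin : ε / ζ * sqInt p 0 π ≤ 1 / 10 ^ 64 * sqInt p 0 π := by
    refine mul_le_mul_of_nonneg_right ?_ hP
    rw [div_le_iff₀ hζ]; linarith
  rw [hY] at h1 h2 hψζ
  norm_num at h1 h2 hψζ hfin ⊢
  linarith

end Rayleigh

/-! ### Estimates away from the endpoints of the spectrum -/

/-- The cases in which the estimates hold: no zero mode, or no constant in the forcing, or a
stream function with a zero. -/
def Admissible (μ lam c₀ : ℝ) (ψ p : ℝ → ℝ) : Prop :=
  BoundaryCond ψ p ∧ ((c₀ = 0 ∧ 4 ≤ lam) ∨ (c₀ = 0 ∧ lam = 1 ∧ 1 / 2 ≤ μ) ∨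
    (lam = 1 ∧ μ < 1 / 2 ∧ (∃ x ∈ Icc 0 π, ψ x = 0) ∧ (c₀ = 0 ∨ (p 0 = 0 ∧ p π = 0))))

lemma Admissible.one_le {μ lam c₀ : ℝ} {ψ p : ℝ → ℝ} (h : Admissible μ lam c₀ ψ p) : 1 ≤ lam := by
  rcases h.2 with h1 | h1 | h1
  · linarith [h1.2]
  · exact h1.2.1.ge
  · exact h1.1.ge

lemma pi_sq_le : π ^ 2 ≤ 10 := by
  have h1 := Real.pi_lt_d4
  have h2 := Real.pi_pos
  nlinarith

/-- A Poincaré inequality with a prescribed value at a point. -/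
lemma sqInt_le_of_value {F p : ℝ → ℝ} (hF : ∀ x, HasDerivAt F (p x) x) (hp : Continuous p)
    {x₀ : ℝ} (hx : x₀ ∈ Icc 0 π) :
    sqInt F 0 π ≤ 20 * sqInt p 0 π + 2 * π * F x₀ ^ 2 := by
  have cF := continuous_of_hasDerivAt hF
  have hP := sqInt_nonneg (F := p) Real.pi_pos.le
  have h1 := sqInt_le_of_zero (F := fun x => F x - F x₀) (fun x => (hF x).sub_const _) hp hx
    (sub_self _)
  have h2 := sqInt_add_le (F := fun x => F x - F x₀) (G := fun _ => F x₀) Real.pi_pos.le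
    (by fun_prop) continuous_const
  have e : sqInt (fun _ => F x₀) 0 π = π * F x₀ ^ 2 := by simp [sqInt]
  simp only [sub_add_cancel, e, sub_zero] at h1 h2
  have h3 : π ^ 2 * sqInt p 0 π ≤ 10 * sqInt p 0 π := by gcongr; exact pi_sq_le
  linarith

/-! ### The energy estimate in all admissible cases, and its consequence for `w` -/

namespace Rayleigh

variable {μ lam c₀ ζ ε m : ℝ} {ψ p w v g : ℝ → ℝ}

/-- The key estimate. -/
lemma energy_le (h : Rayleigh (Real.cos ζ) lam c₀ ψ p w v g)
    (hA : Admissible (Real.cos ζ) lam c₀ ψ p) (hζ : 0 < ζ) (hζ' : ζ ≤ π / 2) (hε : 0 < ε)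
    (hεζ : ε ≤ ζ / 10 ^ 64) :
    sqInt p 0 π + lam * sqInt ψ 0 π ≤
      10 ^ 66 * rhsT ζ ε (sqInt g 0 π) (sqInt v 0 π) := by
  have hpi := Real.pi_lt_d4
  have hpi0 := Real.pi_pos
  have hT := rhsT_nonneg hζ hε (sqInt_nonneg (F := g) hpi0.le) (sqInt_nonneg (F := v) hpi0.le)
  have hP := sqInt_nonneg (F := p) hpi0.le
  have hΨ := sqInt_nonneg (F := ψ) hpi0.le
  have hlam := hA.one_le
  obtain ⟨hB, hcase⟩ := hA
  set T := rhsT ζ ε (sqInt g 0 π) (sqInt v 0 π)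
  have hΨ0 : (∃ x ∈ Icc 0 π, ψ x = 0) → sqInt ψ 0 π ≤ 10 * sqInt p 0 π := by
    rintro ⟨x, hx, hx0⟩
    have h1 := sqInt_le_of_zero h.hψ h.cp hx hx0
    rw [sub_zero] at h1
    refine h1.trans ?_
    gcongr
    exact pi_sq_le
  by_cases hθ : Real.cos ζ ≤ 1 / 10 ^ 5 * √lam * Real.sin ζ
  -- Coercivity: clear for `lam ≥ 4`; for `lam = 1` with a zero of `ψ` it is Poincaré with `π² ≤
  -- 10`; and `lam = 1`, `cos ζ ≥ 1/2` is incompatible with the perturbative regime.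
  · have hN : sqInt p 0 π + lam * sqInt ψ 0 π ≤
        11 * (sqInt p 0 π + (lam - 1) * sqInt ψ 0 π) := by
      rcases hcase with ⟨-, h4⟩ | ⟨-, h1, h2⟩ | ⟨h1, -, hz, -⟩
      · linarith [mul_nonneg (by linarith : 0 ≤ lam - 4) hΨ]
      · rw [h1, Real.sqrt_one] at hθ
        linarith [Real.sin_le_one ζ]
      · rw [h1]
        linarith [hΨ0 hz]
    have := h.key_perturbative hB hζ hζ' hlam hN hθ hε (hεζ.trans (by gcongr <;> norm_num))
    linarith
  · push Not at hθ
    rcases hcase with ⟨h0, h4⟩ | ⟨h0, h1, h2⟩ | ⟨h1, -, hz, h0 | hN⟩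
    · subst h0
      have := h.key_nonperturbative hB hζ hζ' hlam hθ.le hε hεζ
      have h3 : 0 ≤ ψ ζ ^ 2 / ζ := by positivity
      linarith [mul_nonneg (by linarith : 0 ≤ lam - 4) hΨ]
    · subst h0 h1
      have := h.key_nonperturbative hB hζ hζ' hlam hθ.le hε hεζ
      have h3 := sqInt_le_of_value h.hψ h.cp (x₀ := ζ) ⟨hζ.le, by linarith⟩
      have h4 : ψ ζ ^ 2 ≤ 2 * (ψ ζ ^ 2 / ζ) := by
        rw [← mul_div_assoc, le_div_iff₀ hζ]
        nlinarith [sq_nonneg (ψ ζ)]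
      have h5 : 0 ≤ ψ ζ ^ 2 / ζ := by positivity
      have h6 : 2 * π * ψ ζ ^ 2 ≤ 2 * 4 * (2 * (ψ ζ ^ 2 / ζ)) := by gcongr; linarith
      linarith
    · subst h0 h1
      have := h.key_nonperturbative hB hζ hζ' hlam hθ.le hε hεζ
      have h3 : 0 ≤ ψ ζ ^ 2 / ζ := by positivity
      linarith [hΨ0 hz]
    · subst h1
      have hμ : 0 < Real.cos ζ := by
        refine lt_of_le_of_lt ?_ hθ
        have := half_le_sin hζ.le hζ'
        have : 0 ≤ Real.sin ζ := by linarith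
        positivity
      -- As `lam = 1`, adding a constant to `ψ` preserves the relation between `ψ` and `w` and the
      -- Neumann condition, so `c₀` can be absorbed into `ψ`.
      have hs : Rayleigh (Real.cos ζ) 1 0 (fun x => ψ x + c₀ / Real.cos ζ) p w v g := by
        refine ⟨fun x => (h.hψ x).add_const _, fun x => ?_, h.hw, h.hv, fun x => ?_⟩
        · exact (h.hp x).congr_deriv (by ring)
        · have := h.eq x
          field_simp
          linarith
      have := hs.key_nonperturbative (Or.inl hN) hζ hζ' hlam hθ.le hε hεζ
      have h3 : 0 ≤ (ψ ζ + c₀ / Real.cos ζ) ^ 2 / ζ := by positivity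
      linarith [hΨ0 hz]

/-- The energy estimate bounds the remaining terms of `sqInt_w_le` and `sqInt_sin_mul_w_le` by
multiples of `rhsT`, and dividing `rhsT` by `ζ ε` gives the bracket on the right. -/
lemma interior_w_le (h : Rayleigh (Real.cos ζ) lam c₀ ψ p w v g)
    (hA : Admissible (Real.cos ζ) lam c₀ ψ p) (hζ : 0 < ζ) (hζ' : ζ ≤ π / 2) (hε : 0 < ε)
    (hεζ : ε ≤ ζ / 10 ^ 64) :
    sqInt w 0 π ≤ 10 ^ 76 * (sqInt g 0 π / (ζ * ε) ^ 2 + ε ^ 2 * sqInt v 0 π) ∧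
    sqInt (fun z => Real.sin z * w z) 0 π ≤
      10 ^ 76 * (ζ ^ 2 * (sqInt g 0 π / (ζ * ε) ^ 2 + ε ^ 2 * sqInt v 0 π)) := by
  have hpi0 := Real.pi_pos
  have hT := rhsT_nonneg hζ hε (sqInt_nonneg (F := g) hpi0.le) (sqInt_nonneg (F := v) hpi0.le)
  have hP := sqInt_nonneg (F := p) hpi0.le
  have hΨ := sqInt_nonneg (F := ψ) hpi0.le
  have hE := h.energy_le hA hζ hζ' hε hεζ
  have hlam := hA.one_le
  have hεζ' : ε ≤ ζ / 44 := hεζ.trans (by gcongr; norm_num)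
  have hχ := h.critical_value_le hζ hζ' hε hεζ'
  have hεP : ε / ζ * sqInt p 0 π ≤ sqInt p 0 π := by
    refine mul_le_of_le_one_left hP ((div_le_one hζ).2 ?_)
    linarith
  have hPT : sqInt p 0 π ≤ 10 ^ 66 * rhsT ζ ε (sqInt g 0 π) (sqInt v 0 π) := by
    linarith [mul_nonneg (by linarith : 0 ≤ lam) hΨ]
  have e : rhsT ζ ε (sqInt g 0 π) (sqInt v 0 π) / (ζ * ε) =
      sqInt g 0 π / (ζ * ε) ^ 2 + ε ^ 2 * sqInt v 0 π := by
    rw [rhsT]; field_simp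
  have key : 22000 / (ζ * ε) *
      (rhsT ζ ε (sqInt g 0 π) (sqInt v 0 π) + (c₀ + Real.cos ζ * ψ ζ) ^ 2 / ζ +
        ε / ζ * sqInt p 0 π) ≤
      10 ^ 76 * (sqInt g 0 π / (ζ * ε) ^ 2 + ε ^ 2 * sqInt v 0 π) := by
    rw [← e]
    set T := rhsT ζ ε (sqInt g 0 π) (sqInt v 0 π)
    calc _ ≤ 22000 / (ζ * ε) * (2 * 10 ^ 71 * T) := by
          refine mul_le_mul_of_nonneg_left ?_ (by positivity)
          norm_num at hχ hPT ⊢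
          linarith
      _ = 22000 * (2 * 10 ^ 71) * (T / (ζ * ε)) := by ring
      _ ≤ _ := mul_le_mul_of_nonneg_right (by norm_num) (by positivity)
  refine ⟨(h.sqInt_w_le hζ hζ' hε hεζ').trans key,
    (h.sqInt_sin_mul_w_le hζ hζ' hε hεζ').trans ?_⟩
  calc _ ≤ ζ ^ 2 * (10 ^ 76 * (sqInt g 0 π / (ζ * ε) ^ 2 + ε ^ 2 * sqInt v 0 π)) := by gcongr
    _ = _ := by ring

end Rayleigh

/-- The critical point of a spectral value in `[0, 1)`. -/
lemma exists_critical_point {μ : ℝ} (h0 : 0 ≤ μ) (h1 : μ < 1) :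
    ∃ ζ : ℝ, 0 < ζ ∧ ζ ≤ π / 2 ∧ Real.cos ζ = μ ∧ 2 * (1 - μ) ≤ ζ ^ 2 ∧ ζ ^ 2 ≤ 5 * (1 - μ) := by
  have hc : Real.cos (Real.arccos μ) = μ := Real.cos_arccos (by linarith) h1.le
  have h2 : 0 < Real.arccos μ := Real.arccos_pos.2 h1
  have h3 : Real.arccos μ ≤ π / 2 := Real.arccos_le_pi_div_two.2 h0
  refine ⟨Real.arccos μ, h2, h3, hc, ?_, ?_⟩
  · have := Real.one_sub_sq_div_two_le_cos (x := Real.arccos μ)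
    linarith
  · have := sq_div_five_le h2.le (by linarith [Real.pi_pos])
    linarith

/-! ### Choice of the scale `ε` for each of the three norms -/

namespace Rayleigh

variable {μ lam c₀ ζ ε m : ℝ} {ψ p w v g : ℝ → ℝ}

/-- Take `ε` proportional to `1/(m ζ)`, so that `(ζ ε)⁻²` is of order `m²`. The requirement that `ε`
be small against `ζ` becomes `1/m ≲ ζ²`, which is the hypothesis on `1 - μ`. -/
lemma interior_vorticity_le (h : Rayleigh μ lam c₀ ψ p w v g)
    (hA : Admissible μ lam c₀ ψ p) (hμ : 0 ≤ μ) (hm : 1 ≤ m) (hμm : 1 / 100 / m ≤ 1 - μ) :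
    sqInt w 0 π + (sqInt p 0 π + lam * sqInt ψ 0 π) ≤
      10 ^ 220 * (m ^ 2 * sqInt g 0 π + (m ^ 2)⁻¹ * (1 - μ)⁻¹ * sqInt v 0 π) := by
  have hm0 : 0 < m := by linarith
  have hδ : 0 < 1 - μ := lt_of_lt_of_le (by positivity) hμm
  obtain ⟨ζ, hζ, hζ', rfl, hζ1, hζ2⟩ := exists_critical_point hμ (by linarith)
  have hg := sqInt_nonneg (F := g) Real.pi_pos.le
  have hv := sqInt_nonneg (F := v) Real.pi_pos.le
  have hε : 0 < 1 / 10 ^ 66 / (m * ζ) := by positivity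
  have hεζ : 1 / 10 ^ 66 / (m * ζ) ≤ ζ / 10 ^ 64 := by
    rw [div_le_iff₀ (by positivity)]
    have h1 : 1 / 100 ≤ m * (1 - Real.cos ζ) := by
      rw [div_le_iff₀ hm0] at hμm; linarith
    have h2 : m * (2 * (1 - Real.cos ζ)) ≤ m * ζ ^ 2 := by gcongr
    have e : ζ / 10 ^ 64 * (m * ζ) = m * ζ ^ 2 / 10 ^ 64 := by ring
    rw [e, le_div_iff₀ (by positivity)]
    linarith
  have h1 := (h.interior_w_le hA hζ hζ' hε hεζ).1
  have h2 := h.energy_le hA hζ hζ' hε hεζ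
  have e1 : sqInt g 0 π / (ζ * (1 / 10 ^ 66 / (m * ζ))) ^ 2 +
      (1 / 10 ^ 66 / (m * ζ)) ^ 2 * sqInt v 0 π =
      10 ^ 132 * (m ^ 2 * sqInt g 0 π) + 1 / 10 ^ 132 * ((m ^ 2)⁻¹ * (ζ ^ 2)⁻¹ * sqInt v 0 π) := by
    field_simp
  have e2 : rhsT ζ (1 / 10 ^ 66 / (m * ζ)) (sqInt g 0 π) (sqInt v 0 π) =
      10 ^ 66 * (m * sqInt g 0 π) +
        1 / 10 ^ 198 * (m⁻¹ * ((m ^ 2)⁻¹ * (ζ ^ 2)⁻¹ * sqInt v 0 π)) := by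
    rw [rhsT]; field_simp
  rw [e1] at h1
  rw [e2] at h2
  have h3 : (ζ ^ 2)⁻¹ ≤ (1 - Real.cos ζ)⁻¹ := by
    gcongr; linarith
  have h4 : (m ^ 2)⁻¹ * (ζ ^ 2)⁻¹ * sqInt v 0 π ≤
      (m ^ 2)⁻¹ * (1 - Real.cos ζ)⁻¹ * sqInt v 0 π := by gcongr
  have h5 : 0 ≤ (m ^ 2)⁻¹ * (ζ ^ 2)⁻¹ * sqInt v 0 π := by positivity
  have h6 : m⁻¹ * ((m ^ 2)⁻¹ * (ζ ^ 2)⁻¹ * sqInt v 0 π) ≤ (m ^ 2)⁻¹ * (ζ ^ 2)⁻¹ * sqInt v 0 π :=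
    mul_le_of_le_one_left h5 (inv_le_one_of_one_le₀ hm)
  have h7 : m * sqInt g 0 π ≤ m ^ 2 * sqInt g 0 π := by
    gcongr
    exact le_self_pow₀ hm (by norm_num)
  have h8 : 0 ≤ m ^ 2 * sqInt g 0 π := by positivity
  norm_num at h1 h2 ⊢
  linarith

/-- Take `ε` proportional to `1/m`: the factor `ζ²` of the weighted bound cancels in front of `g`
and stays in front of `v`. Smallness of `ε` against `ζ` now only needs `1/m² ≲ 1 - μ`. -/
lemma interior_velocity_le (h : Rayleigh μ lam c₀ ψ p w v g)
    (hA : Admissible μ lam c₀ ψ p) (hμ : 0 ≤ μ) (hm : 1 ≤ m) (hμm : 1 / 100 / m ^ 2 ≤ 1 - μ) :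
    sqInt (fun z => Real.sin z * w z) 0 π ≤
      10 ^ 220 * (m ^ 2 * sqInt g 0 π + (m ^ 2)⁻¹ * (1 - μ) * sqInt v 0 π) := by
  have hm0 : 0 < m := by linarith
  have hδ : 0 < 1 - μ := lt_of_lt_of_le (by positivity) hμm
  obtain ⟨ζ, hζ, hζ', rfl, hζ1, hζ2⟩ := exists_critical_point hμ (by linarith)
  have hg := sqInt_nonneg (F := g) Real.pi_pos.le
  have hv := sqInt_nonneg (F := v) Real.pi_pos.le
  have hε : 0 < 1 / 10 ^ 66 / m := by positivity
  have hεζ : 1 / 10 ^ 66 / m ≤ ζ / 10 ^ 64 := by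
    have h1 : 1 / 100 / m ≤ ζ := by
      refine abs_le_of_sq_le_sq' ?_ hζ.le |>.2
      have e : (1 / 100 / m) ^ 2 = 1 / 100 * (1 / 100 / m ^ 2) := by field_simp
      rw [e]
      linarith
    calc 1 / 10 ^ 66 / m = 1 / 100 / m / 10 ^ 64 := by field_simp; norm_num
      _ ≤ _ := by gcongr
  have h1 := (h.interior_w_le hA hζ hζ' hε hεζ).2
  have e1 : ζ ^ 2 * (sqInt g 0 π / (ζ * (1 / 10 ^ 66 / m)) ^ 2 +
      (1 / 10 ^ 66 / m) ^ 2 * sqInt v 0 π) =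
      10 ^ 132 * (m ^ 2 * sqInt g 0 π) + 1 / 10 ^ 132 * ((m ^ 2)⁻¹ * ζ ^ 2 * sqInt v 0 π) := by
    field_simp
  rw [e1] at h1
  have h4 : (m ^ 2)⁻¹ * ζ ^ 2 * sqInt v 0 π ≤
      (m ^ 2)⁻¹ * (5 * (1 - Real.cos ζ)) * sqInt v 0 π := by gcongr
  have h5 : 0 ≤ (m ^ 2)⁻¹ * (1 - Real.cos ζ) * sqInt v 0 π := by positivity
  have h8 : 0 ≤ m ^ 2 * sqInt g 0 π := by positivity
  norm_num at h1 ⊢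
  linarith

/-- Take `ε` proportional to `1/(m² ζ)` in the energy estimate: `(ζ ε)⁻¹` is of order `m²` and `ζ
ε³` of order `m⁻⁶ ζ⁻²`. -/
lemma interior_energy_le (h : Rayleigh μ lam c₀ ψ p w v g)
    (hA : Admissible μ lam c₀ ψ p) (hμ : 0 ≤ μ) (hm : 1 ≤ m) (hμm : 1 / 100 / m ^ 2 ≤ 1 - μ) :
    sqInt p 0 π + lam * sqInt ψ 0 π ≤
      10 ^ 220 * (m ^ 2 * sqInt g 0 π + (m ^ 6)⁻¹ * (1 - μ)⁻¹ * sqInt v 0 π) := by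
  have hm0 : 0 < m := by linarith
  have hδ : 0 < 1 - μ := lt_of_lt_of_le (by positivity) hμm
  obtain ⟨ζ, hζ, hζ', rfl, hζ1, hζ2⟩ := exists_critical_point hμ (by linarith)
  have hg := sqInt_nonneg (F := g) Real.pi_pos.le
  have hv := sqInt_nonneg (F := v) Real.pi_pos.le
  have hε : 0 < 1 / 10 ^ 66 / (m ^ 2 * ζ) := by positivity
  have hεζ : 1 / 10 ^ 66 / (m ^ 2 * ζ) ≤ ζ / 10 ^ 64 := by
    rw [div_le_iff₀ (by positivity)]
    have h1 : 1 / 100 ≤ m ^ 2 * (1 - Real.cos ζ) := by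
      rw [div_le_iff₀ (by positivity)] at hμm; linarith
    have h2 : m ^ 2 * (2 * (1 - Real.cos ζ)) ≤ m ^ 2 * ζ ^ 2 := by gcongr
    have e : ζ / 10 ^ 64 * (m ^ 2 * ζ) = m ^ 2 * ζ ^ 2 / 10 ^ 64 := by ring
    rw [e, le_div_iff₀ (by positivity)]
    linarith
  have h2 := h.energy_le hA hζ hζ' hε hεζ
  have e2 : rhsT ζ (1 / 10 ^ 66 / (m ^ 2 * ζ)) (sqInt g 0 π) (sqInt v 0 π) =
      10 ^ 66 * (m ^ 2 * sqInt g 0 π) +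
        1 / 10 ^ 198 * ((m ^ 6)⁻¹ * (ζ ^ 2)⁻¹ * sqInt v 0 π) := by
    rw [rhsT]; field_simp
  rw [e2] at h2
  have h3 : (ζ ^ 2)⁻¹ ≤ (1 - Real.cos ζ)⁻¹ := by
    gcongr; linarith
  have h4 : (m ^ 6)⁻¹ * (ζ ^ 2)⁻¹ * sqInt v 0 π ≤
      (m ^ 6)⁻¹ * (1 - Real.cos ζ)⁻¹ * sqInt v 0 π := by gcongr
  have h5 : 0 ≤ (m ^ 6)⁻¹ * (ζ ^ 2)⁻¹ * sqInt v 0 π := by positivity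
  have h8 : 0 ≤ m ^ 2 * sqInt g 0 π := by positivity
  norm_num at h2 ⊢
  linarith

end Rayleigh

/-! ### Estimates near and beyond the endpoints of the spectrum -/

namespace Rayleigh

variable {μ lam ζ ε m n : ℝ} {ψ p w v g : ℝ → ℝ}

/-- Testing the equation against `w`. -/
lemma vorticity_identity (h : Rayleigh μ lam 0 ψ p w v g) (hB : BoundaryCond ψ p) :
    μ * (sqInt p 0 π + (lam - 1) * sqInt ψ 0 π) + (μ - 1) * sqInt w 0 π +
      (∫ x in 0..π, (1 - Real.cos x) * w x ^ 2) = ∫ x in 0..π, g x * w x := by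
  have cψ := h.cψ
  have cw := h.cw
  have cg := h.cg
  have h1 := h.energy_identity hB
  have e : ∫ x in 0..π, g x * w x = -(μ * ∫ x in 0..π, w x * ψ x) + (μ - 1) * sqInt w 0 π +
      ∫ x in 0..π, (1 - Real.cos x) * w x ^ 2 := by
    rw [sqInt, ← intervalIntegral.integral_const_mul, ← intervalIntegral.integral_const_mul,
      ← intervalIntegral.integral_neg, ← integral_add_cont (by fun_prop) (by fun_prop),
      ← integral_add_cont (by fun_prop) (by fun_prop)]
    refine intervalIntegral.integral_congr fun x _ => ?_
    have := h.eq x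
    linear_combination w x * this
  rw [e, h1]
  ring

lemma weighted_nonneg : 0 ≤ ∫ x in 0..π, (1 - Real.cos x) * w x ^ 2 :=
  intervalIntegral.integral_nonneg Real.pi_pos.le fun x _ =>
    mul_nonneg (by linarith [Real.cos_le_one x]) (sq_nonneg _)

lemma sqInt_sin_mul_w_le_weighted (cw : Continuous w) :
    sqInt (fun z => Real.sin z * w z) 0 π ≤ 2 * ∫ x in 0..π, (1 - Real.cos x) * w x ^ 2 := by
  rw [← intervalIntegral.integral_const_mul]
  refine integral_mono_cont Real.pi_pos.le (by fun_prop) (by fun_prop) fun x _ => ?_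
  have h1 := Real.sin_sq_add_cos_sq x
  have h2 := Real.cos_le_one x
  have h3 := Real.neg_one_le_cos x
  rw [mul_pow, ← mul_assoc]
  refine mul_le_mul_of_nonneg_right ?_ (sq_nonneg _)
  nlinarith

/-- Control of the zero mode. -/
lemma energy_le_form (h : Rayleigh μ lam 0 ψ p w v g) (hA : Admissible μ lam 0 ψ p)
    (hμ : 1 / 2 ≤ μ) :
    sqInt p 0 π + lam * sqInt ψ 0 π ≤
      100 * (sqInt p 0 π + (lam - 1) * sqInt ψ 0 π) + 8 / μ ^ 2 * sqInt g 0 π := by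
  have hpi := Real.pi_lt_d4
  have hpi0 := Real.pi_pos
  have hpi3 := Real.pi_gt_three
  have hP := sqInt_nonneg (F := p) hpi0.le
  have hΨ := sqInt_nonneg (F := ψ) hpi0.le
  have hG := sqInt_nonneg (F := g) hpi0.le
  have hμ0 : 0 < μ := by linarith
  have hG' : 0 ≤ 8 / μ ^ 2 * sqInt g 0 π := by positivity
  obtain ⟨hB, ⟨-, h4⟩ | ⟨-, h1, -⟩ | ⟨-, h2, -⟩⟩ := hA
  · linarith [mul_nonneg (by linarith : 0 ≤ lam - 4) hΨ]
  swap
  · linarith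
  subst h1
  rcases hB with ⟨hp0, hpπ⟩ | ⟨h0, -⟩
  swap
  · have := sqInt_le_of_value h.hψ h.cp (x₀ := 0) ⟨le_rfl, hpi0.le⟩
    rw [h0] at this
    linarith
  have cψ := h.cψ
  have cp := h.cp
  have cw := h.cw
  have cg := h.cg
  -- For `lam = 1` under the Neumann condition the form ignores the mean of `ψ`. It is recovered by
  -- integrating the equation over `[0, π]`: the integral of `w = p'` vanishes and that of `cos · w`
  -- equals that of `sin · p`.
  have e1 : ∫ x in 0..π, w x = 0 := by
    have hd : ∀ x ∈ uIcc 0 π, HasDerivAt p (w x) x := fun x _ =>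
      (h.hp x).congr_deriv (by ring)
    rw [intervalIntegral.integral_eq_sub_of_hasDerivAt hd (cw.intervalIntegrable _ _), hp0, hpπ,
      sub_zero]
  have e2 : ∫ x in 0..π, (Real.cos x * w x - Real.sin x * p x) = 0 := by
    have hd : ∀ x ∈ uIcc 0 π, HasDerivAt (fun x => Real.cos x * p x)
        (Real.cos x * w x - Real.sin x * p x) x := fun x _ =>
      ((Real.hasDerivAt_cos x).mul (h.hp x)).congr_deriv (by ring)
    rw [intervalIntegral.integral_eq_sub_of_hasDerivAt hd
      (Continuous.intervalIntegrable (by fun_prop) _ _), hp0, hpπ]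
    ring
  have e3 : μ * (∫ x in 0..π, ψ x) = -(∫ x in 0..π, 1 * g x) - ∫ x in 0..π, Real.sin x * p x := by
    have e4 : ∫ x in 0..π, (μ * ψ x + (1 * g x) + (Real.sin x * p x) - μ * w x +
        (Real.cos x * w x - Real.sin x * p x)) = 0 := by
      rw [intervalIntegral.integral_congr (g := fun _ => 0), intervalIntegral.integral_zero]
      intro x _
      have := h.eq x
      simp only
      linear_combination this
    rw [integral_add_cont (by fun_prop) (by fun_prop), e2, integral_sub_cont (by fun_prop)
      (by fun_prop), integral_add_cont (by fun_prop) (by fun_prop), integral_add_cont (by fun_prop)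
      (by fun_prop), intervalIntegral.integral_const_mul μ, intervalIntegral.integral_const_mul μ,
      e1] at e4
    linarith
  have b1 : (∫ x in 0..π, 1 * g x) ^ 2 ≤ π * sqInt g 0 π := by
    have := integral_mul_sq_le hpi0.le (continuous_const (y := (1 : ℝ))) cg
    rwa [sqInt_one, sub_zero] at this
  have b2 : (∫ x in 0..π, Real.sin x * p x) ^ 2 ≤ π * sqInt p 0 π := by
    refine (integral_mul_sq_le hpi0.le Real.continuous_sin cp).trans ?_
    gcongr
    have := sqInt_mono hpi0.le Real.continuous_sin (continuous_const (y := (1 : ℝ)))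
      fun x _ => by rw [one_pow]; exact Real.sin_sq_le_one x
    rwa [sqInt_one, sub_zero] at this
  obtain ⟨x₀, hx₀, hval⟩ : ∃ x₀ ∈ Icc 0 π, π * ψ x₀ = ∫ x in 0..π, ψ x := by
    have hFd : ∀ x ∈ Ioo 0 π, HasDerivAt (fun x => ∫ t in 0..x, ψ t) (ψ x) x := fun x _ =>
      (intervalIntegral.integral_hasDerivAt_right (cψ.intervalIntegrable _ _)
        (cψ.stronglyMeasurableAtFilter _ _) cψ.continuousAt)
    obtain ⟨x, hx, hxe⟩ := exists_hasDerivAt_eq_slope (fun x => ∫ t in 0..x, ψ t) ψ hpi0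
      (intervalIntegral.continuous_primitive (fun a b => cψ.intervalIntegrable a b)
        0).continuousOn hFd
    refine ⟨x, Ioo_subset_Icc_self hx, ?_⟩
    rw [hxe]
    simp only [intervalIntegral.integral_same, sub_zero]
    field_simp
  have h3 := sqInt_le_of_value h.hψ h.cp hx₀
  have h5 : π * (μ ^ 2 * ψ x₀ ^ 2) ≤ 2 * sqInt g 0 π + 2 * sqInt p 0 π := by
    have e5 : (μ * (π * ψ x₀)) ^ 2 = π * (π * (μ ^ 2 * ψ x₀ ^ 2)) := by ring
    rw [← hval] at e3
    rw [e3] at e5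
    set I := ∫ x in 0..π, 1 * g x
    set J := ∫ x in 0..π, Real.sin x * p x
    have h6 : (-I - J) ^ 2 ≤ 2 * I ^ 2 + 2 * J ^ 2 := by nlinarith [sq_nonneg (I - J)]
    have h7 : π * (π * (μ ^ 2 * ψ x₀ ^ 2)) ≤ π * (2 * sqInt g 0 π + 2 * sqInt p 0 π) := by
      rw [← e5]; linarith
    exact le_of_mul_le_mul_left h7 hpi0
  have h6 : 2 * π * ψ x₀ ^ 2 ≤ 4 / μ ^ 2 * sqInt g 0 π + 16 * sqInt p 0 π := by
    have h7 : 2 * π * ψ x₀ ^ 2 ≤ 2 / μ ^ 2 * (2 * sqInt g 0 π + 2 * sqInt p 0 π) := by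
      calc 2 * π * ψ x₀ ^ 2 = 2 / μ ^ 2 * (π * (μ ^ 2 * ψ x₀ ^ 2)) := by field_simp
        _ ≤ _ := by gcongr
    have h8 : 2 / μ ^ 2 ≤ 8 := by
      rw [div_le_iff₀ (by positivity)]
      nlinarith
    have h9 : 2 / μ ^ 2 * (2 * sqInt p 0 π) ≤ 8 * (2 * sqInt p 0 π) := by gcongr
    have e : 2 / μ ^ 2 * (2 * sqInt g 0 π + 2 * sqInt p 0 π) =
      4 / μ ^ 2 * sqInt g 0 π + 2 / μ ^ 2 * (2 * sqInt p 0 π) := by ring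
    linarith
  have h7 : 4 / μ ^ 2 * sqInt g 0 π ≤ 8 / μ ^ 2 * sqInt g 0 π := by gcongr; norm_num
  linarith

/-- Resolvent estimates beyond the spectrum. -/
lemma exterior_le (h : Rayleigh μ lam 0 ψ p w v g) (hA : Admissible μ lam 0 ψ p) (hμ : 1 < μ) :
    sqInt w 0 π ≤ 1 / (μ - 1) ^ 2 * sqInt g 0 π ∧
    sqInt (fun z => Real.sin z * w z) 0 π ≤ 1 / (μ - 1) * sqInt g 0 π ∧
    sqInt p 0 π + lam * sqInt ψ 0 π ≤ 100 / (μ * (μ - 1)) * sqInt g 0 π := by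
  have hpi0 := Real.pi_pos
  have hd : 0 < μ - 1 := by linarith
  have hμ0 : 0 < μ := by linarith
  have cw := h.cw
  have hG := sqInt_nonneg (F := g) hpi0.le
  have hW := sqInt_nonneg (F := w) hpi0.le
  have hX := weighted_nonneg (w := w)
  have hid := h.vorticity_identity hA.1
  have hCS := abs_integral_mul_le hpi0.le h.cg cw
  have hI := (le_abs_self _).trans hCS
  have hE := h.energy_le_form hA (by linarith)
  have hN : 0 ≤ sqInt p 0 π + (lam - 1) * sqInt ψ 0 π :=
    add_nonneg (sqInt_nonneg hpi0.le)
      (mul_nonneg (by linarith [hA.one_le]) (sqInt_nonneg hpi0.le))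
  have hS := sqInt_sin_mul_w_le_weighted cw
  have hg2 := Real.sq_sqrt hG
  have hw2 := Real.sq_sqrt hW
  set N := sqInt p 0 π + (lam - 1) * sqInt ψ 0 π
  set X := ∫ x in 0..π, (1 - Real.cos x) * w x ^ 2
  set a := √(sqInt g 0 π)
  set b := √(sqInt w 0 π)
  have ha : 0 ≤ a := Real.sqrt_nonneg _
  have hb : 0 ≤ b := Real.sqrt_nonneg _
  rw [← hw2] at hid
  rw [← hg2] at hE
  rw [← hg2, ← hw2]
  have hμN : 0 ≤ μ * N := by positivity
  refine ⟨?_, ?_, ?_⟩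
  · have h1 : (μ - 1) * b ≤ a := by
      by_contra hc
      push Not at hc
      have hb' : 0 < b := by
        rcases hb.eq_or_lt with h2 | h2
        · rw [← h2] at hc; linarith
        · exact h2
      linarith [mul_lt_mul_of_pos_right hc hb']
    have h2 := pow_le_pow_left₀ (by positivity) h1 2
    rw [one_div_mul_eq_div, le_div_iff₀ (by positivity)]
    linarith [mul_pow (μ - 1) b 2]
  -- The identity gives `X ≤ a b - (μ - 1) b²`, and the maximum over `b` of the right-hand side is
  -- `a² / (4 (μ - 1))`. The bound for `μ N` below is the same.
  · have h1 : X ≤ 1 / (4 * (μ - 1)) * a ^ 2 := by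
      rw [one_div_mul_eq_div, le_div_iff₀ (by positivity)]
      have h2 : X * (4 * (μ - 1)) ≤ (a * b - (μ - 1) * b ^ 2) * (4 * (μ - 1)) := by
        gcongr; linarith
      linarith [sq_nonneg (a - 2 * ((μ - 1) * b)), sub_sq a (2 * ((μ - 1) * b))]
    calc _ ≤ 2 * (1 / (4 * (μ - 1)) * a ^ 2) := hS.trans (by gcongr)
      _ = 1 / 2 * (1 / (μ - 1) * a ^ 2) := by field_simp; ring
      _ ≤ _ := by
        have : 0 ≤ 1 / (μ - 1) * a ^ 2 := by positivity
        linarith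
  · have h1 : N ≤ 1 / (4 * (μ * (μ - 1))) * a ^ 2 := by
      rw [one_div_mul_eq_div, le_div_iff₀ (by positivity)]
      have h2 : μ * N * (4 * (μ - 1)) ≤ (a * b - (μ - 1) * b ^ 2) * (4 * (μ - 1)) := by
        gcongr; linarith
      linarith [sq_nonneg (a - 2 * ((μ - 1) * b)), sub_sq a (2 * ((μ - 1) * b))]
    have h2 : 8 / μ ^ 2 ≤ 8 / (μ * (μ - 1)) := by
      gcongr
      nlinarith
    calc _ ≤ 100 * N + 8 / μ ^ 2 * a ^ 2 := hE
      _ ≤ 100 * (1 / (4 * (μ * (μ - 1))) * a ^ 2) + 8 / (μ * (μ - 1)) * a ^ 2 := by gcongr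
      _ = 33 / (μ * (μ - 1)) * a ^ 2 := by field_simp; ring
      _ ≤ _ := by gcongr; norm_num

/-- Localization of the vorticity at the maximum of the profile. -/
lemma sqInt_w_le_weighted (h : Rayleigh μ lam 0 ψ p w v g) (hn : 1 ≤ n) :
    sqInt w 0 π ≤ 15 * (n * ∫ x in 0..π, (1 - Real.cos x) * w x ^ 2) + 4 * (sqInt v 0 π / n) := by
  have hpi0 := Real.pi_pos
  have hpi3 := Real.pi_gt_three
  have hn0 : 0 < n := by linarith
  have cw := h.cw
  -- For `x ≥ ρ` one has `1 - cos x ≥ ρ²/5 = 1/(5n)`, so the weighted integral controls `w`; the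
  -- interval `[0, ρ]` is reached from `[ρ, 2ρ]` by `sqInt_le_shell`.
  set ρ := 1 / √n with hρ
  have hsn : 1 ≤ √n := Real.one_le_sqrt.2 hn
  have hρ0 : 0 < ρ := by positivity
  have hρ1 : ρ ≤ 1 := by rw [hρ, div_le_one (by positivity)]; exact hsn
  have hρ2 : ρ ^ 2 * n = 1 := by rw [hρ, div_pow, Real.sq_sqrt hn0.le]; field_simp
  set X := ∫ x in 0..π, (1 - Real.cos x) * w x ^ 2 with hX
  have hXn := weighted_nonneg (w := w)
  have hout : ∀ b, ρ ≤ b → b ≤ π → sqInt w ρ b ≤ 5 * (n * X) := by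
    intro b hb1 hb2
    have h1 : ∫ x in ρ..b, (1 - Real.cos x) * w x ^ 2 ≤ X :=
      integral_subinterval hρ0.le hb1 hb2 (Continuous.continuousOn (by fun_prop)) fun x _ =>
        mul_nonneg (by linarith [Real.cos_le_one x]) (sq_nonneg _)
    have h2 : sqInt w ρ b ≤ ∫ x in ρ..b, 5 * n * ((1 - Real.cos x) * w x ^ 2) := by
      refine integral_mono_cont hb1 (by fun_prop) (by fun_prop) fun x hx => ?_
      have h3 := sq_div_five_le (hρ0.le.trans hx.1) (hx.2.trans hb2)
      have h4 : ρ ^ 2 ≤ x ^ 2 := pow_le_pow_left₀ hρ0.le hx.1 2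
      have h5 : 1 ≤ 5 * n * (1 - Real.cos x) := by
        calc 1 = 5 * n * (ρ ^ 2 / 5) := by linarith
          _ ≤ 5 * n * (1 - Real.cos x) := by gcongr; linarith
      rw [← mul_assoc]
      exact le_mul_of_one_le_left (sq_nonneg _) h5
    rw [intervalIntegral.integral_const_mul] at h2
    calc _ ≤ 5 * n * X := h2.trans (by gcongr)
      _ = _ := by ring
  have hsh := sqInt_le_shell h.hw h.hv (a := 0) (p := ρ) (b := 2 * ρ) (a' := 0) (b' := π)
    hρ0.le (by linarith) le_rfl (by linarith)
  have e1 : 2 * ((ρ - 0) / (2 * ρ - ρ)) = 2 := by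
    have : 2 * ρ - ρ = ρ := by ring
    rw [this, sub_zero, div_self hρ0.ne']; ring
  have e2 : 2 * (ρ - 0) * (2 * ρ - 0) * sqInt v 0 π = 4 * (sqInt v 0 π / n) := by
    have : ρ ^ 2 = 1 / n := by field_simp; linarith
    calc _ = 4 * ρ ^ 2 * sqInt v 0 π := by ring
      _ = _ := by rw [this]; ring
  rw [e1, e2] at hsh
  have h1 := hout (2 * ρ) (by linarith) (by linarith)
  have h2 := hout π (by linarith) le_rfl
  rw [← sqInt_add_adjacent cw 0 ρ π]
  linarith

/-- Estimates at the edge of the spectrum. -/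
lemma edge_le (h : Rayleigh μ lam 0 ψ p w v g) (hA : Admissible μ lam 0 ψ p) (hμ : 1 / 2 ≤ μ)
    (hn : 1 ≤ n) (hμn : 1 - μ ≤ 1 / 100 / n) :
    sqInt w 0 π ≤ 10 ^ 5 * (n ^ 2 * sqInt g 0 π + sqInt v 0 π / n) ∧
    sqInt (fun z => Real.sin z * w z) 0 π ≤ 10 ^ 5 * (n * sqInt g 0 π + sqInt v 0 π / n ^ 2) ∧
    sqInt p 0 π + lam * sqInt ψ 0 π ≤ 10 ^ 5 * (n * sqInt g 0 π + sqInt v 0 π / n ^ 2) := by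
  have hpi0 := Real.pi_pos
  have hn0 : 0 < n := by linarith
  have cw := h.cw
  have hG := sqInt_nonneg (F := g) hpi0.le
  have hV := sqInt_nonneg (F := v) hpi0.le
  have hW := sqInt_nonneg (F := w) hpi0.le
  have hX := weighted_nonneg (w := w)
  have hid := h.vorticity_identity hA.1
  have hCS := abs_integral_mul_le hpi0.le h.cg cw
  have hI := (le_abs_self _).trans hCS
  have hE := h.energy_le_form hA (by linarith)
  have hN : 0 ≤ sqInt p 0 π + (lam - 1) * sqInt ψ 0 π :=
    add_nonneg (sqInt_nonneg hpi0.le)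
      (mul_nonneg (by linarith [hA.one_le]) (sqInt_nonneg hpi0.le))
  have hS := sqInt_sin_mul_w_le_weighted cw
  have hloc := h.sqInt_w_le_weighted hn
  have hg2 := Real.sq_sqrt hG
  have hw2 := Real.sq_sqrt hW
  set N := sqInt p 0 π + (lam - 1) * sqInt ψ 0 π
  set X := ∫ x in 0..π, (1 - Real.cos x) * w x ^ 2
  set a := √(sqInt g 0 π)
  set b := √(sqInt w 0 π)
  have hlocn : sqInt w 0 π / n ≤ 15 * X + 4 * (sqInt v 0 π / n ^ 2) := by
    rw [div_le_iff₀ hn0]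
    refine hloc.trans (le_of_eq ?_)
    field_simp
  -- For `μ < 1` the term `(μ - 1) ∫ w²` has the wrong sign. Here and in the Young inequality below
  -- it costs `1/100` of `∫ w² / n`, hence `15/100` of `X` by `hlocn`; this leaves `7/10 X`.
  have h1 : (1 - μ) * sqInt w 0 π ≤ 1 / 100 * (sqInt w 0 π / n) := by
    calc _ ≤ 1 / 100 / n * sqInt w 0 π := by gcongr
      _ = _ := by ring
  have h2 : a * b ≤ 25 * (n * sqInt g 0 π) + 1 / 100 * (sqInt w 0 π / n) := by
    rw [← hg2, ← hw2]
    have e : 25 * (n * a ^ 2) + 1 / 100 * (b ^ 2 / n) - a * b = (50 * n * a - b) ^ 2 / (100 * n) := by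
      field_simp
      ring
    have : 0 ≤ (50 * n * a - b) ^ 2 / (100 * n) := by positivity
    linarith
  have hV2 : 0 ≤ sqInt v 0 π / n ^ 2 := by positivity
  have hnG : 0 ≤ n * sqInt g 0 π := by positivity
  have hμN : 1 / 2 * N ≤ μ * N := by gcongr
  have h3 : 1 / 2 * N + 7 / 10 * X ≤ 25 * (n * sqInt g 0 π) + 8 / 100 * (sqInt v 0 π / n ^ 2) := by
    linarith
  refine ⟨?_, ?_, ?_⟩
  · have h4 : n * X ≤ n * (50 * (n * sqInt g 0 π) + sqInt v 0 π / n ^ 2) := by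
      gcongr; linarith
    have e : n * (50 * (n * sqInt g 0 π) + sqInt v 0 π / n ^ 2) =
        50 * (n ^ 2 * sqInt g 0 π) + sqInt v 0 π / n := by field_simp
    have h5 : 0 ≤ sqInt v 0 π / n := by positivity
    have h6 : 0 ≤ n ^ 2 * sqInt g 0 π := by positivity
    linarith
  · linarith
  · have h4 : 8 / μ ^ 2 * sqInt g 0 π ≤ 32 * (n * sqInt g 0 π) := by
      have h5 : 8 / μ ^ 2 ≤ 32 := by
        rw [div_le_iff₀ (by positivity)]
        nlinarith
      calc _ ≤ 32 * sqInt g 0 π := by gcongr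
        _ ≤ _ := by linarith [le_mul_of_one_le_left hG hn]
    linarith

end Rayleigh

/-! ### The estimates on a half period -/

lemma rpow_neg_half_sq {x : ℝ} (hx : 0 ≤ x) : (x ^ (-(1 / 2) : ℝ)) ^ 2 = x⁻¹ := by
  rw [← Real.rpow_natCast, ← Real.rpow_mul hx]
  norm_num
  exact Real.rpow_neg_one x

lemma rpow_half_sq {x : ℝ} (hx : 0 ≤ x) : (x ^ (1 / 2 : ℝ)) ^ 2 = x := by
  rw [← Real.sqrt_eq_rpow, Real.sq_sqrt hx]

/-- The resolvent bounds, as relations between the squared norms `U`, `S`, `E` of the vorticity,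
the weighted velocity and the energy, and the squared norms `A`, `V` of the right-hand side and of
the derivative. -/
structure ResolventBounds (C μ U S E A V : ℝ) : Prop where
  vorticity : ∀ m : ℝ, 1 ≤ m → |μ| ≤ 1 + 1 / 100 / m →
    U ≤ C * (m ^ 2 * A + h1 (1 / 100) m μ ^ 2 * V)
  velocity : ∀ m : ℝ, 1 ≤ m → |μ| ≤ 1 + 1 / 100 / m ^ 2 →
    S ≤ C * (m ^ 2 * A + h2 (1 / 100) m μ ^ 2 * V)
  energy : ∀ m : ℝ, 1 ≤ m → |μ| ≤ 1 + 1 / 100 / m ^ 2 →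
    E ≤ C * (m ^ 2 * A + h3 (1 / 100) m μ ^ 2 * V)
  ext_vorticity : 1 < |μ| → U ≤ C / (|μ| - 1) ^ 2 * A
  ext_velocity : 1 < |μ| → S ≤ C / (|μ| - 1) * A
  ext_energy : 1 < |μ| → E ≤ C / (|μ| * (|μ| - 1)) * A

namespace ResolventBounds

variable {C μ U S E A V U' S' E' A' V' : ℝ}

/-- All bounds are linear in the five squared norms, so the real components of a complex function
can be estimated one by one and summed. -/
lemma add (h : ResolventBounds C μ U S E A V) (h' : ResolventBounds C μ U' S' E' A' V') :
    ResolventBounds C μ (U + U') (S + S') (E + E') (A + A') (V + V') where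
  vorticity m hm hμ := by
    linear_combination h.vorticity m hm hμ + h'.vorticity m hm hμ
  velocity m hm hμ := by
    linear_combination h.velocity m hm hμ + h'.velocity m hm hμ
  energy m hm hμ := by
    linear_combination h.energy m hm hμ + h'.energy m hm hμ
  ext_vorticity hμ := by linear_combination h.ext_vorticity hμ + h'.ext_vorticity hμ
  ext_velocity hμ := by linear_combination h.ext_velocity hμ + h'.ext_velocity hμ
  ext_energy hμ := by linear_combination h.ext_energy hμ + h'.ext_energy hμ

lemma const_mul (h : ResolventBounds C μ U S E A V) {c : ℝ} (hc : 0 ≤ c) :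
    ResolventBounds C μ (c * U) (c * S) (c * E) (c * A) (c * V) where
  vorticity m hm hμ := by
    linear_combination c * h.vorticity m hm hμ
  velocity m hm hμ := by
    linear_combination c * h.velocity m hm hμ
  energy m hm hμ := by
    linear_combination c * h.energy m hm hμ
  ext_vorticity hμ := by linear_combination c * h.ext_vorticity hμ
  ext_velocity hμ := by linear_combination c * h.ext_velocity hμ
  ext_energy hμ := by linear_combination c * h.ext_energy hμ

lemma mono (h : ResolventBounds C μ U S E A V) (hC : 0 ≤ C) (hV : V ≤ V') :
    ResolventBounds C μ U S E A V' where
  vorticity m hm hμ := (h.vorticity m hm hμ).trans (by gcongr)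
  velocity m hm hμ := (h.velocity m hm hμ).trans (by gcongr)
  energy m hm hμ := (h.energy m hm hμ).trans (by gcongr)
  ext_vorticity := h.ext_vorticity
  ext_velocity := h.ext_velocity
  ext_energy := h.ext_energy

open Filter in
-- `V` is held fixed: it is a bound for the derivative common to all truncations, so no convergence
-- of derivatives is needed.
lemma of_tendsto {ι : Type*} {l : Filter ι} [l.NeBot] {u s e a : ι → ℝ}
    (h : ∀ i, ResolventBounds C μ (u i) (s i) (e i) (a i) V) (hu : Tendsto u l (nhds U))
    (hs : Tendsto s l (nhds S)) (he : Tendsto e l (nhds E)) (ha : Tendsto a l (nhds A)) :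
    ResolventBounds C μ U S E A V where
  vorticity m hm hμ := le_of_tendsto_of_tendsto' hu
    (((ha.const_mul (m ^ 2)).add_const _).const_mul C) fun i => (h i).vorticity m hm hμ
  velocity m hm hμ := le_of_tendsto_of_tendsto' hs
    (((ha.const_mul (m ^ 2)).add_const _).const_mul C) fun i => (h i).velocity m hm hμ
  energy m hm hμ := le_of_tendsto_of_tendsto' he
    (((ha.const_mul (m ^ 2)).add_const _).const_mul C) fun i => (h i).energy m hm hμ
  ext_vorticity hμ := le_of_tendsto_of_tendsto' hu (ha.const_mul _) fun i => (h i).ext_vorticity hμ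
  ext_velocity hμ := le_of_tendsto_of_tendsto' hs (ha.const_mul _) fun i => (h i).ext_velocity hμ
  ext_energy hμ := le_of_tendsto_of_tendsto' he (ha.const_mul _) fun i => (h i).ext_energy hμ

end ResolventBounds

/-- The resolvent bounds for one real component. -/
abbrev HalfPeriodEstimates (C μ lam : ℝ) (ψ p w v g : ℝ → ℝ) : Prop :=
  ResolventBounds C μ (sqInt (fun x => w x - ψ x) 0 π) (sqInt (fun x => Real.sin x * w x) 0 π)
    (sqInt p 0 π + lam * sqInt ψ 0 π) (sqInt g 0 π) (sqInt v 0 π)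

lemma Admissible.c₀_eq {μ lam c₀ : ℝ} {ψ p : ℝ → ℝ} (h : Admissible μ lam c₀ ψ p)
    (hμ : 1 / 2 ≤ μ) : c₀ = 0 := by
  rcases h.2 with h1 | h1 | h1
  · exact h1.1
  · exact h1.1
  · linarith [h1.2.1]

namespace Rayleigh

variable {μ lam c₀ : ℝ} {ψ p w v g : ℝ → ℝ}

/-- `w - ψ` is `u` itself; the `ψ` part is dominated by the energy because `lam ≥ 1`. -/
lemma sqInt_sub_le (h : Rayleigh μ lam c₀ ψ p w v g) (hlam : 1 ≤ lam) :
    sqInt (fun x => w x - ψ x) 0 π ≤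
      2 * sqInt w 0 π + 2 * (sqInt p 0 π + lam * sqInt ψ 0 π) := by
  have h1 := sqInt_add_le (F := w) (G := fun x => -ψ x) Real.pi_pos.le h.cw h.cψ.neg
  have e : sqInt (fun x => -ψ x) 0 π = sqInt ψ 0 π := by simp [sqInt]
  rw [e] at h1
  simp only [← sub_eq_add_neg] at h1
  have hP := sqInt_nonneg (F := p) Real.pi_pos.le
  have hΨ := sqInt_nonneg (F := ψ) Real.pi_pos.le
  linarith [mul_le_mul_of_nonneg_right hlam hΨ]

/-- The branches of each `h_j` match the available estimates: the middle one is `edge_le` with `n =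
m` for the vorticity and `n = m²` otherwise, the lower one is the interior estimate. At and beyond
the edge `μ ≥ 1/2`, which forces `c₀ = 0`. -/
lemma halfPeriodEstimates_of_nonneg (h : Rayleigh μ lam c₀ ψ p w v g)
    (hA : Admissible μ lam c₀ ψ p) (hμ : 0 ≤ μ) :
    HalfPeriodEstimates (10 ^ 230) μ lam ψ p w v g := by
  have hμa : |μ| = μ := abs_of_nonneg hμ
  have hG := sqInt_nonneg (F := g) Real.pi_pos.le
  have hV := sqInt_nonneg (F := v) Real.pi_pos.le
  have hsub := h.sqInt_sub_le hA.one_le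
  have hE0 : 0 ≤ sqInt p 0 π + lam * sqInt ψ 0 π :=
    add_nonneg (sqInt_nonneg Real.pi_pos.le)
      (mul_nonneg (by linarith [hA.one_le]) (sqInt_nonneg Real.pi_pos.le))
  have hle : ∀ a b C : ℝ, 0 ≤ b → C ≤ 10 ^ 230 → a ≤ C * b → a ≤ 10 ^ 230 * b :=
    fun a b C hb hC h => h.trans (mul_le_mul_of_nonneg_right hC hb)
  have hsmall : ∀ n : ℝ, 1 ≤ n → (1 : ℝ) / 100 / n ≤ 1 / 100 := fun n hn =>
    div_le_self (by norm_num) hn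
  constructor
  · intro m hm hμm
    have hm0 : 0 < m := by linarith
    rw [h1, hμa] at *
    rw [if_neg (not_lt.2 hμm)]
    split_ifs with hc
    · have hμ2 : 1 / 2 ≤ μ := by linarith [hsmall m hm]
      obtain rfl := hA.c₀_eq hμ2
      obtain ⟨e1, -, e3⟩ := h.edge_le hA hμ2 hm (by linarith)
      rw [rpow_neg_half_sq hm0.le]
      refine hle _ _ (4 * 10 ^ 5) (by positivity) (by norm_num) ?_
      have h3 : m * sqInt g 0 π ≤ m ^ 2 * sqInt g 0 π := by
        gcongr; exact le_self_pow₀ hm (by norm_num)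
      have h4 : sqInt v 0 π / m ^ 2 ≤ sqInt v 0 π / m := by
        gcongr; exact le_self_pow₀ hm (by norm_num)
      have e4 : m⁻¹ * sqInt v 0 π = sqInt v 0 π / m := by ring
      rw [e4]
      linarith
    · have hd : 0 ≤ 1 - μ := by
        have : 0 < 1 / 100 / m := by positivity
        linarith
      have h3 := h.interior_vorticity_le hA hμ hm (by linarith)
      rw [mul_pow, rpow_neg_half_sq hd, inv_pow]
      refine hle _ _ (2 * 10 ^ 220) (by positivity) (by norm_num) ?_
      linarith
  · intro m hm hμm
    have hm0 : 0 < m := by linarith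
    have hm2 : 1 ≤ m ^ 2 := one_le_pow₀ hm
    rw [h2, hμa] at *
    rw [if_neg (not_lt.2 hμm)]
    split_ifs with hc
    · have hμ2 : 1 / 2 ≤ μ := by linarith [hsmall _ hm2]
      obtain rfl := hA.c₀_eq hμ2
      obtain ⟨-, e2, -⟩ := h.edge_le hA hμ2 hm2 (by linarith)
      refine hle _ _ (10 ^ 5) (by positivity) (by norm_num) ?_
      have e4 : (m ^ 2)⁻¹ ^ 2 * sqInt v 0 π = sqInt v 0 π / (m ^ 2) ^ 2 := by
        rw [inv_pow]; ring
      rw [e4]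
      exact e2
    · have hd : 0 ≤ 1 - μ := by
        have : 0 < 1 / 100 / m ^ 2 := by positivity
        linarith
      have h3 := h.interior_velocity_le hA hμ hm (by linarith)
      rw [mul_pow, rpow_half_sq hd, inv_pow]
      exact hle _ _ (10 ^ 220) (by positivity) (by norm_num) h3
  · intro m hm hμm
    have hm0 : 0 < m := by linarith
    have hm2 : 1 ≤ m ^ 2 := one_le_pow₀ hm
    rw [Kolmogorov.h3, hμa] at *
    rw [if_neg (not_lt.2 hμm)]
    split_ifs with hc
    · have hμ2 : 1 / 2 ≤ μ := by linarith [hsmall _ hm2]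
      obtain rfl := hA.c₀_eq hμ2
      obtain ⟨-, -, e3⟩ := h.edge_le hA hμ2 hm2 (by linarith)
      refine hle _ _ (10 ^ 5) (by positivity) (by norm_num) ?_
      have e4 : (m ^ 2)⁻¹ ^ 2 * sqInt v 0 π = sqInt v 0 π / (m ^ 2) ^ 2 := by
        rw [inv_pow]; ring
      rw [e4]
      exact e3
    · have hd : 0 ≤ 1 - μ := by
        have : 0 < 1 / 100 / m ^ 2 := by positivity
        linarith
      have h3 := h.interior_energy_le hA hμ hm (by linarith)
      rw [mul_pow, rpow_neg_half_sq hd, inv_pow, ← pow_mul]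
      exact hle _ _ (10 ^ 220) (by positivity) (by norm_num) h3
  all_goals
    intro hμ1
    rw [hμa] at *
    obtain rfl := hA.c₀_eq (by linarith)
    obtain ⟨e1, e2, e3⟩ := h.exterior_le hA hμ1
    have hd : 0 < μ - 1 := by linarith
  · rw [div_mul_eq_mul_div, mul_div_assoc]
    refine hle _ _ 202 (by positivity) (by norm_num) ?_
    have h5 : 100 / (μ * (μ - 1)) * sqInt g 0 π ≤ 100 / (μ - 1) ^ 2 * sqInt g 0 π := by
      gcongr
      rw [sq]
      gcongr
      linarith
    have e : 202 * (sqInt g 0 π / (μ - 1) ^ 2) = 2 * (1 / (μ - 1) ^ 2 * sqInt g 0 π) +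
      2 * (100 / (μ - 1) ^ 2 * sqInt g 0 π) := by ring
    rw [e]
    linarith
  · refine e2.trans ?_
    gcongr
    norm_num
  · refine e3.trans ?_
    gcongr
    norm_num

/-- The reflection `z ↦ π - z` changes the sign of `μ`. -/
lemma reflect (h : Rayleigh μ lam c₀ ψ p w v g) :
    Rayleigh (-μ) lam (-c₀) (fun x => ψ (π - x)) (fun x => -p (π - x)) (fun x => w (π - x))
      (fun x => -v (π - x)) (fun x => -g (π - x)) := by
  have hr : ∀ {F F' : ℝ → ℝ}, (∀ x, HasDerivAt F (F' x) x) →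
      ∀ x, HasDerivAt (fun x => F (π - x)) (-F' (π - x)) x := fun {F F'} hF x => by
    have h1 : HasDerivAt (fun x => F (π - x)) _ x :=
      (hF (π - x)).comp x ((hasDerivAt_id x).const_sub π)
    exact h1.congr_deriv (by ring)
  refine ⟨hr h.hψ, fun x => ?_, hr h.hw, ?_, fun x => ?_⟩
  · exact ((hr h.hp x).neg).congr_deriv (by ring)
  · have := h.hv
    fun_prop
  · have := h.eq (π - x)
    rw [Real.cos_pi_sub] at this
    linarith

lemma sqInt_reflect (F : ℝ → ℝ) : sqInt (fun x => F (π - x)) 0 π = sqInt F 0 π := by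
  simp only [sqInt]
  rw [intervalIntegral.integral_comp_sub_left (fun x => F x ^ 2) π]
  simp

lemma sqInt_reflect_neg (F : ℝ → ℝ) : sqInt (fun x => -F (π - x)) 0 π = sqInt F 0 π := by
  rw [← sqInt_reflect F]
  simp [sqInt]

lemma halfPeriodEstimates (h : Rayleigh μ lam c₀ ψ p w v g)
    (hA : Admissible |μ| lam c₀ ψ p) : HalfPeriodEstimates (10 ^ 230) μ lam ψ p w v g := by
  rcases le_total 0 μ with hμ | hμ
  · rw [abs_of_nonneg hμ] at hA
    exact h.halfPeriodEstimates_of_nonneg hA hμ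
  · have hA' : Admissible (-μ) lam (-c₀) (fun x => ψ (π - x)) (fun x => -p (π - x)) := by
      rw [abs_of_nonpos hμ] at hA
      refine ⟨?_, ?_⟩
      · rcases hA.1 with ⟨h1, h2⟩ | ⟨h1, h2⟩
        · left; simp [h1, h2]
        · right; simp [h1, h2]
      · rcases hA.2 with h1 | h1 | ⟨h1, h2, ⟨x, hx, hx0⟩, h4⟩
        · left; simpa using h1
        · right; left; simpa using h1
        · right; right
          refine ⟨h1, h2, ⟨π - x, ⟨by linarith [hx.2], by linarith [hx.1]⟩, by simpa using hx0⟩, ?_⟩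
          rcases h4 with h5 | ⟨h5, h6⟩
          · left; simp [h5]
          · right; simp [h5, h6]
    have key := h.reflect.halfPeriodEstimates_of_nonneg hA' (by linarith)
    have r1 := sqInt_reflect (fun x => w x - ψ x)
    have r2 := sqInt_reflect (fun x => Real.sin x * w x)
    simp only [Real.sin_pi_sub] at r2
    have k1 : ∀ m, h1 (1 / 100) m (-μ) = h1 (1 / 100) m μ := fun m => by
      simp only [h1, abs_neg]
    have k2 : ∀ m, h2 (1 / 100) m (-μ) = h2 (1 / 100) m μ := fun m => by
      simp only [h2, abs_neg]
    have k3 : ∀ m, h3 (1 / 100) m (-μ) = h3 (1 / 100) m μ := fun m => by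
      simp only [h3, abs_neg]
    obtain ⟨a1, a2, a3, a4, a5, a6⟩ := key
    simp only [r1, r2, k1, k2, k3, sqInt_reflect_neg, sqInt_reflect, abs_neg] at a1 a2 a3 a4 a5 a6
    exact ⟨a1, a2, a3, a4, a5, a6⟩

end Rayleigh

/-! ### Complex periodic functions -/

/-- The squared `L²` norm over a period. -/
def periodSq (F : ℝ → ℂ) : ℝ := ∫ z in -π..π, ‖F z‖ ^ 2

/-- A real component of the even (`σ = 1`) or odd (`σ = -1`) part of `F`. -/
def part (σ : ℝ) (R : ℂ →L[ℝ] ℝ) (F : ℝ → ℂ) (z : ℝ) : ℝ := R ((1 / 2 : ℝ) • (F z + σ • F (-z)))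

section Parts

variable {σ : ℝ} {R : ℂ →L[ℝ] ℝ} {F F' : ℝ → ℂ}

lemma continuous_part (hF : Continuous F) : Continuous (part σ R F) := by
  unfold part; fun_prop

/-- Differentiation exchanges even and odd parts, hence `-σ`. -/
lemma hasDerivAt_part (hF : ∀ z, HasDerivAt F (F' z) z) (z : ℝ) :
    HasDerivAt (part σ R F) (part (-σ) R F' z) z := by
  have h1 : HasDerivAt (fun z => F (-z)) (-F' (-z)) z := by
    have := (hF (-z)).scomp z (hasDerivAt_neg z)
    refine this.congr_deriv ?_
    simp
  have h2 : HasDerivAt (fun z => (1 / 2 : ℝ) • (F z + σ • F (-z)))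
      ((1 / 2 : ℝ) • (F' z + σ • (-F' (-z)))) z := ((hF z).add (h1.const_smul σ)).const_smul (1 / 2 : ℝ)
  have h3 := R.hasFDerivAt.comp_hasDerivAt z h2
  refine h3.congr_deriv ?_
  simp [part]

/-- The parallelogram identity pointwise; the factor `1/2` appears because the squares on `[0, π]`
are compared with those on `[-π, π]`. -/
lemma sum_sqInt_part (hF : Continuous F) :
    sqInt (part 1 Complex.reCLM F) 0 π + sqInt (part 1 Complex.imCLM F) 0 π +
      (sqInt (part (-1) Complex.reCLM F) 0 π + sqInt (part (-1) Complex.imCLM F) 0 π) =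
      1 / 2 * periodSq F := by
  have c1 := continuous_part (σ := 1) (R := Complex.reCLM) hF
  have c2 := continuous_part (σ := 1) (R := Complex.imCLM) hF
  have c3 := continuous_part (σ := -1) (R := Complex.reCLM) hF
  have c4 := continuous_part (σ := -1) (R := Complex.imCLM) hF
  have e1 : periodSq F = (∫ z in 0..π, ‖F (-z)‖ ^ 2) + ∫ z in 0..π, ‖F z‖ ^ 2 := by
    rw [intervalIntegral.integral_comp_neg (fun z => ‖F z‖ ^ 2), neg_zero,
      integral_adjacent_cont (by fun_prop)]
    rfl
  rw [e1]
  simp only [sqInt]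
  rw [← integral_add_cont (by fun_prop) (by fun_prop),
    ← integral_add_cont (by fun_prop) (by fun_prop),
    ← integral_add_cont (by fun_prop) (by fun_prop),
    ← integral_add_cont (by fun_prop) (by fun_prop), ← intervalIntegral.integral_const_mul]
  refine intervalIntegral.integral_congr fun z _ => ?_
  simp only [part, Complex.sq_norm, Complex.normSq_apply]
  simp
  ring

end Parts

/-- The complex form of the Rayleigh equation for `2π`-periodic functions. -/
structure ComplexRayleigh (μ lam : ℝ) (c₀ : ℂ) (Ψ P W V G : ℝ → ℂ) : Prop where
  hΨ : ∀ z, HasDerivAt Ψ (P z) z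
  hP : ∀ z, HasDerivAt P (W z + (lam - 1) * Ψ z) z
  hW : ∀ z, HasDerivAt W (V z) z
  hV : Continuous V
  perΨ : Ψ (-π) = Ψ π
  perP : P (-π) = P π
  eq : ∀ z, G z + (c₀ + μ * Ψ z) + (Real.cos z - μ) * W z = 0
  adm : (c₀ = 0 ∧ 4 ≤ lam) ∨ (c₀ = 0 ∧ lam = 1 ∧ 1 / 2 ≤ |μ|) ∨
    (lam = 1 ∧ |μ| < 1 / 2 ∧ ∃ Θ : ℝ → ℂ, (∀ z, HasDerivAt Θ (Ψ z) z) ∧ Θ (-π) = Θ π)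

namespace ComplexRayleigh

variable {μ lam : ℝ} {c₀ : ℂ} {Ψ P W V G : ℝ → ℂ}

lemma cΨ (h : ComplexRayleigh μ lam c₀ Ψ P W V G) : Continuous Ψ :=
  continuous_iff_continuousAt.2 fun x => (h.hΨ x).continuousAt

lemma cP (h : ComplexRayleigh μ lam c₀ Ψ P W V G) : Continuous P :=
  continuous_iff_continuousAt.2 fun x => (h.hP x).continuousAt

lemma cW (h : ComplexRayleigh μ lam c₀ Ψ P W V G) : Continuous W :=
  continuous_iff_continuousAt.2 fun x => (h.hW x).continuousAt

lemma cG (h : ComplexRayleigh μ lam c₀ Ψ P W V G) : Continuous G := by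
  have h1 := h.cΨ
  have h2 := h.cW
  have : G = fun z => -(c₀ + μ * Ψ z) - (Real.cos z - μ) * W z := by
    funext z; linear_combination h.eq z
  rw [this]
  fun_prop

/-- The coefficients are real and even in `z`, so each component solves the same equation. The
constant `c₀` survives only in the even part. -/
lemma rayleigh_part (h : ComplexRayleigh μ lam c₀ Ψ P W V G) {σ : ℝ} (R : ℂ →L[ℝ] ℝ) :
    Rayleigh μ lam ((1 + σ) / 2 * R c₀) (part σ R Ψ) (part (-σ) R P) (part σ R W) (part (-σ) R V)
      (part σ R G) := by
  have hR : ∀ (a : ℝ) (x : ℂ), R ((a : ℂ) * x) = a * R x := fun a x => by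
    rw [← Complex.real_smul, map_smul, smul_eq_mul]
  refine ⟨hasDerivAt_part h.hΨ, fun z => ?_, hasDerivAt_part h.hW, continuous_part h.hV,
    fun z => ?_⟩
  · refine (hasDerivAt_part h.hP z).congr_deriv ?_
    have e : ∀ x, R ((lam - 1) * x) = (lam - 1) * R x := fun x => by
      rw [← hR]; push_cast; rfl
    simp only [part, map_smul, map_add, neg_neg, smul_eq_mul, e]
    ring
  · have e1 := congrArg R (h.eq z)
    have e2 := congrArg R (h.eq (-z))
    rw [Real.cos_neg] at e2
    have e : ∀ x, R ((Real.cos z - μ) * x) = (Real.cos z - μ) * R x := fun x => by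
      rw [← hR]; push_cast; rfl
    simp only [map_add, map_zero, hR, e] at e1 e2
    simp only [part, map_smul, map_add, smul_eq_mul]
    linear_combination 1 / 2 * e1 + σ / 2 * e2

/-- By periodicity an odd function vanishes at `0` and `π`, which gives Neumann conditions for the
even part of `Ψ` and Dirichlet conditions for the odd one. In the third alternative the even part of
`Ψ` is the derivative of the odd part of the periodic `Θ`, so Rolle's theorem provides a zero; the
odd part vanishes at `0` and carries no constant. -/
lemma admissible_part (h : ComplexRayleigh μ lam c₀ Ψ P W V G) {σ : ℝ} (hσ : σ = 1 ∨ σ = -1)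
    (R : ℂ →L[ℝ] ℝ) :
    Admissible |μ| lam ((1 + σ) / 2 * R c₀) (part σ R Ψ) (part (-σ) R P) := by
  have hodd : ∀ {F : ℝ → ℂ}, F (-π) = F π → part (-1) R F 0 = 0 ∧ part (-1) R F π = 0 := by
    intro F hF
    constructor
    · simp [part]
    · simp [part, hF]
  refine ⟨?_, ?_⟩
  · rcases hσ with rfl | rfl
    · exact Or.inl (hodd h.perP)
    · exact Or.inr (hodd h.perΨ)
  · rcases h.adm with ⟨h1, h2⟩ | ⟨h1, h2⟩ | ⟨h1, h2, Θ, hΘ, hper⟩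
    · left; simp [h1, h2]
    · right; left; simpa [h1] using h2
    · right; right
      refine ⟨h1, h2, ?_, ?_⟩
      · rcases hσ with rfl | rfl
        · obtain ⟨h3, h4⟩ := hodd hper
          have hd : ∀ x ∈ Ioo 0 π, HasDerivAt (part (-1) R Θ) (part 1 R Ψ x) x := fun x _ => by
            have := hasDerivAt_part (σ := -1) (R := R) hΘ x
            rwa [neg_neg] at this
          have hc : Continuous Θ := continuous_iff_continuousAt.2 fun x => (hΘ x).continuousAt
          obtain ⟨x, hx, hx0⟩ := exists_hasDerivAt_eq_zero Real.pi_pos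
            (continuous_part hc).continuousOn (h3.trans h4.symm) hd
          exact ⟨x, Ioo_subset_Icc_self hx, hx0⟩
        · exact ⟨0, ⟨le_rfl, Real.pi_pos.le⟩, (hodd h.perΨ).1⟩
      · rcases hσ with rfl | rfl
        · exact Or.inr (hodd h.perP)
        · left; simp

lemma halfPeriodEstimates_part (h : ComplexRayleigh μ lam c₀ Ψ P W V G) {σ : ℝ}
    (hσ : σ = 1 ∨ σ = -1) (R : ℂ →L[ℝ] ℝ) :
    HalfPeriodEstimates (10 ^ 230) μ lam (part σ R Ψ) (part (-σ) R P) (part σ R W)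
      (part (-σ) R V) (part σ R G) :=
  (h.rayleigh_part R).halfPeriodEstimates (h.admissible_part hσ R)

end ComplexRayleigh

lemma ComplexRayleigh.periodEstimates {μ lam : ℝ} {c₀ : ℂ} {Ψ P W V G : ℝ → ℂ}
    (h : ComplexRayleigh μ lam c₀ Ψ P W V G) :
    ResolventBounds (10 ^ 230) μ (periodSq fun z => W z - Ψ z)
      (periodSq fun z => Real.sin z * W z) (periodSq P + lam * periodSq Ψ) (periodSq G)
      (periodSq V) := by
  have e1 := h.halfPeriodEstimates_part (Or.inl rfl) Complex.reCLM
  have e2 := h.halfPeriodEstimates_part (Or.inl rfl) Complex.imCLM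
  have e3 := h.halfPeriodEstimates_part (Or.inr rfl) Complex.reCLM
  have e4 := h.halfPeriodEstimates_part (Or.inr rfl) Complex.imCLM
  rw [neg_neg] at e3 e4
  have cΨ := h.cΨ
  have cW := h.cW
  have sΨ := sum_sqInt_part h.cΨ
  have sP := sum_sqInt_part h.cP
  have sV := sum_sqInt_part h.hV
  have sG := sum_sqInt_part h.cG
  have sU := sum_sqInt_part (show Continuous fun z => W z - Ψ z by fun_prop)
  have sS := sum_sqInt_part (show Continuous fun z => (Real.sin z : ℂ) * W z by fun_prop)
  have rU : ∀ (σ : ℝ) (R : ℂ →L[ℝ] ℝ), part σ R (fun z => W z - Ψ z) =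
      fun x => part σ R W x - part σ R Ψ x := fun σ R => by
    funext x
    simp only [part, map_smul, map_add, map_sub, smul_eq_mul]
    ring
  -- Multiplication by the odd function `sin` exchanges the parities; in the sum over both parities
  -- the total is unaffected.
  have rS : ∀ (σ : ℝ) (R : ℂ →L[ℝ] ℝ), part σ R (fun z => (Real.sin z : ℂ) * W z) =
      fun x => Real.sin x * part (-σ) R W x := fun σ R => by
    have hR : ∀ (a : ℝ) (x : ℂ), R ((a : ℂ) * x) = a * R x := fun a x => by
      rw [← Complex.real_smul, map_smul, smul_eq_mul]
    funext x
    simp only [part, map_smul, map_add, smul_eq_mul, Real.sin_neg, hR]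
    ring
  simp only [rU] at sU
  simp only [rS, neg_neg] at sS
  have hsum := ((e1.add e2).add (e3.add e4)).const_mul (c := 2) (by norm_num)
  have sΨ' := congrArg (lam * ·) sΨ
  beta_reduce at sΨ'
  convert hsum using 1 <;> linarith

/-! ### Trigonometric polynomials -/

/-- The trigonometric polynomial with coefficients `c` on `S`, as a continuous function. -/
def trigC (S : Finset ℤ) (c : ℤ → ℂ) : C(Torus, ℂ) := ∑ k ∈ S, c k • fourier k

/-- A continuous function on the torus as an element of `L²`. -/
def toL2 (F : C(Torus, ℂ)) : L2 := ContinuousMap.toLp 2 AddCircle.haarAddCircle ℂ F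

/-- The trigonometric polynomial with coefficients `c` on `S`, as an element of `L²`. -/
def trigL2 (S : Finset ℤ) (c : ℤ → ℂ) : L2 := ∑ k ∈ S, c k • fourierBasis k

/-- Functions on the torus in the variable `z = y - π / 2`. -/
def pull (F : C(Torus, ℂ)) (z : ℝ) : ℂ := F ((z + π / 2 : ℝ) : Torus)

lemma toL2_trigC (S : Finset ℤ) (c : ℤ → ℂ) : toL2 (trigC S c) = trigL2 S c := by
  simp [toL2, trigC, trigL2, fourierLp]

lemma repr_trigL2 (S : Finset ℤ) (c : ℤ → ℂ) (j : ℤ) :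
    fourierBasis.repr (trigL2 S c) j = if j ∈ S then c j else 0 := by
  rw [trigL2, map_sum, lp.coeFn_sum, Finset.sum_apply]
  simp only [map_smul, HilbertBasis.repr_self, lp.coeFn_smul, Pi.smul_apply, smul_eq_mul,
    lp.single_apply, Pi.single_apply, mul_ite, mul_one, mul_zero]
  exact Finset.sum_ite_eq S j c

lemma norm_trigL2_sq (S : Finset ℤ) (c : ℤ → ℂ) : ‖trigL2 S c‖ ^ 2 = ∑ k ∈ S, ‖c k‖ ^ 2 := by
  have h := (fourierBasis (T := 2 * π)).orthonormal.inner_sum c c S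
  have e : ∀ k, (starRingEnd ℂ) (c k) * c k = ((‖c k‖ ^ 2 : ℝ) : ℂ) := fun k => by
    rw [mul_comm, Complex.mul_conj, Complex.normSq_eq_norm_sq]
  simp only [e] at h
  rw [inner_self_eq_norm_sq_to_K, ← Complex.ofReal_sum] at h
  exact Complex.ofReal_injective ((Complex.ofReal_pow _ _).trans h)

/-- The factor `(2π)⁻¹` is the normalization of Haar measure; the translation by `π/2` is harmless
by periodicity. -/
lemma norm_toL2_sq (F : C(Torus, ℂ)) : ‖toL2 F‖ ^ 2 = (2 * π)⁻¹ * periodSq (pull F) := by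
  have h1 : ((‖toL2 F‖ ^ 2 : ℝ) : ℂ) = ∫ x, F x * (starRingEnd ℂ) (F x) ∂AddCircle.haarAddCircle := by
    rw [← ContinuousMap.inner_toLp, ← toL2, inner_self_eq_norm_sq_to_K]
    norm_cast
  have h2 : ∫ x, F x * (starRingEnd ℂ) (F x) ∂AddCircle.haarAddCircle =
      ((∫ x, ‖F x‖ ^ 2 ∂AddCircle.haarAddCircle : ℝ) : ℂ) := by
    refine (integral_congr_ae (Filter.Eventually.of_forall fun x => ?_)).trans
      (integral_complex_ofReal (f := fun x => ‖F x‖ ^ 2))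
    simp only [Complex.mul_conj, Complex.normSq_eq_norm_sq]
  rw [h2] at h1
  have h3 : ‖toL2 F‖ ^ 2 = ∫ x, ‖F x‖ ^ 2 ∂AddCircle.haarAddCircle := by exact_mod_cast h1
  rw [h3, AddCircle.integral_haarAddCircle, smul_eq_mul,
    ← AddCircle.intervalIntegral_preimage (2 * π) (-π + π / 2), periodSq]
  congr 1
  have e : -π + π / 2 + 2 * π = π + π / 2 := by ring
  rw [e]
  exact (intervalIntegral.integral_comp_add_right (fun y : ℝ => ‖F (y : Torus)‖ ^ 2)
    (π / 2)).symm

lemma pull_trigC (S : Finset ℤ) (c : ℤ → ℂ) (z : ℝ) :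
    pull (trigC S c) z = ∑ k ∈ S, c k * Complex.exp (Complex.I * k * ((z + π / 2 : ℝ) : ℂ)) := by
  have hpi : (π : ℂ) ≠ 0 := by exact_mod_cast Real.pi_ne_zero
  rw [pull, trigC, ContinuousMap.sum_apply]
  refine Finset.sum_congr rfl fun k _ => ?_
  rw [ContinuousMap.smul_apply, smul_eq_mul, fourier_coe_apply]
  congr 2
  push_cast
  field_simp

lemma hasDerivAt_pull_trigC (S : Finset ℤ) (c : ℤ → ℂ) (z : ℝ) :
    HasDerivAt (pull (trigC S c)) (pull (trigC S fun k => Complex.I * k * c k) z) z := by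
  rw [funext (pull_trigC S c), pull_trigC]
  refine HasDerivAt.fun_sum fun k _ => ?_
  have h1 : HasDerivAt (fun z : ℝ => ((z + π / 2 : ℝ) : ℂ)) 1 z :=
    ((hasDerivAt_id z).add_const (π / 2)).ofReal_comp
  have h2 := (((h1.const_mul (Complex.I * k)).cexp).const_mul (c k))
  refine h2.congr_deriv ?_
  ring

lemma periodSq_pull_trigC (S : Finset ℤ) (c : ℤ → ℂ) :
    (2 * π)⁻¹ * periodSq (pull (trigC S c)) = ∑ k ∈ S, ‖c k‖ ^ 2 := by
  rw [← norm_toL2_sq, toL2_trigC, norm_trigL2_sq]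

lemma continuous_pull (F : C(Torus, ℂ)) : Continuous (pull F) := by
  unfold pull
  have : Continuous fun z : ℝ => ((z + π / 2 : ℝ) : Torus) :=
    (AddCircle.continuous_mk' _).comp (by fun_prop)
  exact F.continuous.comp this

lemma pull_neg_pi (F : C(Torus, ℂ)) : pull F (-π) = pull F π := by
  unfold pull
  congr 1
  rw [← AddCircle.coe_add_period (2 * π) (-π + π / 2)]
  congr 1
  ring

/-- A real continuous function as a complex one. -/
def toC (g : C(Torus, ℝ)) : C(Torus, ℂ) := ⟨fun y => (g y : ℂ), by fun_prop⟩

lemma mulOp_toL2 (g : C(Torus, ℝ)) (F : C(Torus, ℂ)) : mulOp g (toL2 F) = toL2 (toC g * F) := by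
  apply Lp.ext
  have h1 : mulOp g (toL2 F) =ᵐ[AddCircle.haarAddCircle] fun y => (g y : ℂ) * toL2 F y :=
    MemLp.coeFn_toLp (memLp_mul g (toL2 F))
  have h2 : toL2 F =ᵐ[AddCircle.haarAddCircle] F := ContinuousMap.coeFn_toLp _ _
  have h3 : toL2 (toC g * F) =ᵐ[AddCircle.haarAddCircle] toC g * F := ContinuousMap.coeFn_toLp _ _
  filter_upwards [h1, h2, h3] with y e1 e2 e3
  rw [e1, e2, e3]
  rfl

lemma pull_sin (z : ℝ) : pull (toC sinT) z = Real.cos z := by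
  have : pull (toC sinT) z = Real.sin (z + π / 2) := rfl
  rw [this, Real.sin_add_pi_div_two]

lemma pull_cos (z : ℝ) : pull (toC cosT) z = -Real.sin z := by
  have : pull (toC cosT) z = Real.cos (z + π / 2) := rfl
  rw [this, Real.cos_add_pi_div_two]
  push_cast
  rfl

/-! ### The operators on trigonometric polynomials -/

lemma opB2_repr (l : ℤ) (u : L2) (k : ℤ) : fourierBasis.repr (opB2 l u) k =
    (1 - ((k : ℂ) ^ 2 + (l : ℂ) ^ 2)⁻¹) * fourierBasis.repr u k := by
  rw [opB2, LinearMap.add_apply, LinearMap.id_apply, map_add, lp.coeFn_add, Pi.add_apply,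
    invA_repr]
  ring

lemma opB2_trigL2 (l : ℤ) (S : Finset ℤ) (c : ℤ → ℂ) : opB2 l (trigL2 S c) =
    trigL2 S fun k => (1 - ((k : ℂ) ^ 2 + (l : ℂ) ^ 2)⁻¹) * c k := by
  refine repr_ext fun k => ?_
  rw [opB2_repr, repr_trigL2, repr_trigL2, mul_ite, mul_zero]

lemma negAPowBdd_repr (l : ℤ) (s : ℝ) (hs : s ≤ 0) (u : L2) (k : ℤ) :
    fourierBasis.repr (negAPowBdd l s hs u) k =
      (((k : ℝ) ^ 2 + (l : ℝ) ^ 2) ^ s : ℝ) * fourierBasis.repr u k :=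
  fourierMultiplier_repr _ (⟨u, negAPow_domain l hs u⟩ : (negAPow l s).domain) k

lemma negAPowBdd_trigL2 (l : ℤ) (s : ℝ) (hs : s ≤ 0) (S : Finset ℤ) (c : ℤ → ℂ) :
    negAPowBdd l s hs (trigL2 S c) =
      trigL2 S fun k => (((k : ℝ) ^ 2 + (l : ℝ) ^ 2) ^ s : ℝ) * c k := by
  refine repr_ext fun k => ?_
  rw [negAPowBdd_repr, repr_trigL2, repr_trigL2, mul_ite, mul_zero]

lemma projQ_of_ne {l : ℤ} (hl : ¬(l = 1 ∨ l = -1)) (f : L2) : projQ l f = f :=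
  Submodule.starProjection_eq_self_iff.2 fun h => absurd h hl

/-- For `l = ±1` the projection removes the zeroth Fourier mode, so the projected residual is the
residual minus a constant. This constant becomes `c₀` in the Rayleigh equation. -/
lemma projQ_of_eq {l : ℤ} (hl : l = 1 ∨ l = -1) (f : L2) :
    projQ l f = f - fourierBasis.repr f 0 • fourierBasis 0 := by
  refine Submodule.eq_starProjection_of_mem_of_inner_eq_zero (fun _ => ?_) fun x hx => ?_
  · rw [integral_eq_repr]
    rw [map_sub, map_smul, HilbertBasis.repr_self, lp.coeFn_sub, Pi.sub_apply, lp.coeFn_smul,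
      Pi.smul_apply, lp.single_apply, Pi.single_eq_same, smul_eq_mul, mul_one, sub_self]
  · have h1 := hx hl
    rw [integral_eq_repr, HilbertBasis.repr_apply_apply] at h1
    rw [sub_sub_cancel, inner_smul_left, h1, mul_zero]

/-! ### The estimates for trigonometric polynomials -/

/-- The Fourier coefficients of the stream function `A_l⁻¹ u`. -/
def streamCoeff (l : ℤ) (a : ℤ → ℂ) (k : ℤ) : ℂ := -((k : ℂ) ^ 2 + (l : ℂ) ^ 2)⁻¹ * a k

/-- The Fourier coefficients of `B_{2,l} u`. -/
def b2Coeff (l : ℤ) (a : ℤ → ℂ) (k : ℤ) : ℂ := (1 - ((k : ℂ) ^ 2 + (l : ℂ) ^ 2)⁻¹) * a k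

/-- The residual `(μ - Λ̂_l) u - c₀` of a trigonometric polynomial `u`. -/
def residualC (μ : ℝ) (l : ℤ) (c₀ : ℂ) (S : Finset ℤ) (a : ℤ → ℂ) : C(Torus, ℂ) :=
  (μ : ℂ) • trigC S a - toC sinT * trigC S (b2Coeff l a) - c₀ • fourier 0

lemma pull_trigC_add (S : Finset ℤ) (a b : ℤ → ℂ) (z : ℝ) :
    pull (trigC S fun k => a k + b k) z = pull (trigC S a) z + pull (trigC S b) z := by
  simp only [pull_trigC, add_mul, Finset.sum_add_distrib]

lemma pull_trigC_mul (S : Finset ℤ) (c : ℂ) (a : ℤ → ℂ) (z : ℝ) :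
    pull (trigC S fun k => c * a k) z = c * pull (trigC S a) z := by
  simp only [pull_trigC, Finset.mul_sum, mul_assoc]

lemma pull_b2Coeff (l : ℤ) (S : Finset ℤ) (a : ℤ → ℂ) (z : ℝ) :
    pull (trigC S (b2Coeff l a)) z =
      pull (trigC S a) z + pull (trigC S (streamCoeff l a)) z := by
  rw [← pull_trigC_add]
  congr 2
  funext k
  rw [b2Coeff, streamCoeff]
  ring

lemma pull_residualC (μ : ℝ) (l : ℤ) (c₀ : ℂ) (S : Finset ℤ) (a : ℤ → ℂ) (z : ℝ) :
    pull (residualC μ l c₀ S a) z =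
      μ * pull (trigC S a) z - Real.cos z * pull (trigC S (b2Coeff l a)) z - c₀ := by
  have h : pull (residualC μ l c₀ S a) z = μ * pull (trigC S a) z -
      pull (toC sinT) z * pull (trigC S (b2Coeff l a)) z -
        c₀ * fourier 0 ((z + π / 2 : ℝ) : Torus) := rfl
  rw [h, pull_sin, fourier_zero, mul_one]

lemma sq_add_sq_ne_zero {l : ℤ} (hl : l ≠ 0) (k : ℤ) : (k : ℂ) ^ 2 + (l : ℂ) ^ 2 ≠ 0 := by
  have : k ^ 2 + l ^ 2 ≠ 0 := by positivity
  exact_mod_cast this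

lemma one_le_sq_add_sq {l : ℤ} (hl : l ≠ 0) (k : ℤ) : 1 ≤ (k : ℝ) ^ 2 + (l : ℝ) ^ 2 := by
  have : 0 < k ^ 2 + l ^ 2 := by positivity
  exact_mod_cast this

lemma norm_one_sub_inv_le {l : ℤ} (hl : l ≠ 0) (k : ℤ) :
    ‖1 - ((k : ℂ) ^ 2 + (l : ℂ) ^ 2)⁻¹‖ ≤ 1 := by
  have hk := one_le_sq_add_sq hl k
  have e : 1 - ((k : ℂ) ^ 2 + (l : ℂ) ^ 2)⁻¹ =
      ((1 - ((k : ℝ) ^ 2 + (l : ℝ) ^ 2)⁻¹ : ℝ) : ℂ) := by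
    push_cast; rfl
  have h0 : 0 ≤ ((k : ℝ) ^ 2 + (l : ℝ) ^ 2)⁻¹ := by positivity
  have h1 := inv_le_one_of_one_le₀ hk
  rw [e, Complex.norm_real, Real.norm_of_nonneg (by linarith)]
  linarith

lemma toL2_residualC (μ : ℝ) (l : ℤ) (c₀ : ℂ) (S : Finset ℤ) (a : ℤ → ℂ) :
    toL2 (residualC μ l c₀ S a) =
      (μ : ℂ) • trigL2 S a - opLam l (trigL2 S a) - c₀ • fourierBasis 0 := by
  have h : toL2 (residualC μ l c₀ S a) = (μ : ℂ) • toL2 (trigC S a) -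
      toL2 (toC sinT * trigC S (b2Coeff l a)) - c₀ • toL2 (fourier 0) := by
    simp only [toL2, residualC, map_sub, map_smul]
  rw [h, ← mulOp_toL2, toL2_trigC, toL2_trigC, opLam, LinearMap.comp_apply, opB2_trigL2,
    coe_fourierBasis]
  rfl

/-- The admissibility of the frequency, the spectral parameter and the mean of the residual. -/
def ModeAdmissible (μ : ℝ) (l : ℤ) (c₀ a₀ : ℂ) : Prop :=
  (c₀ = 0 ∧ (1 / 2 ≤ |μ| ∨ ¬(l = 1 ∨ l = -1))) ∨ ((l = 1 ∨ l = -1) ∧ |μ| < 1 / 2 ∧ a₀ = 0)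

lemma complexRayleigh_trig {μ : ℝ} {l : ℤ} (hl : l ≠ 0) {c₀ : ℂ} (S : Finset ℤ) {a : ℤ → ℂ}
    (h : ModeAdmissible μ l c₀ (a 0)) :
    ComplexRayleigh μ ((l : ℝ) ^ 2) c₀ (pull (trigC S (streamCoeff l a)))
      (pull (trigC S fun k => Complex.I * k * streamCoeff l a k)) (pull (trigC S (b2Coeff l a)))
      (pull (trigC S fun k => Complex.I * k * b2Coeff l a k)) (pull (residualC μ l c₀ S a)) where
  hΨ := hasDerivAt_pull_trigC S _
  hP z := by
    refine (hasDerivAt_pull_trigC S _ z).congr_deriv ?_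
    rw [← pull_trigC_mul, ← pull_trigC_add]
    congr 2
    funext k
    have hk := sq_add_sq_ne_zero hl k
    rw [b2Coeff, streamCoeff]
    push_cast
    field_simp
    linear_combination (-(k : ℂ) ^ 2 * a k) * Complex.I_sq
  hW := hasDerivAt_pull_trigC S _
  hV := continuous_pull _
  perΨ := pull_neg_pi _
  perP := pull_neg_pi _
  eq z := by
    rw [pull_residualC, pull_b2Coeff]
    ring
  adm := by
    have h1 : l = 1 ∨ l = -1 → (l : ℝ) ^ 2 = 1 := by
      rintro (rfl | rfl) <;> norm_num
    have h4 : ¬(l = 1 ∨ l = -1) → 4 ≤ (l : ℝ) ^ 2 := by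
      intro hn
      have : 4 ≤ l ^ 2 := by
        have : 2 ≤ l ∨ l ≤ -2 := by omega
        rcases this with h | h <;> nlinarith
      exact_mod_cast this
    rcases h with ⟨hc, hμ | hn⟩ | ⟨hl1, hμ, ha⟩
    · by_cases hl1 : l = 1 ∨ l = -1
      · exact Or.inr (Or.inl ⟨hc, h1 hl1, hμ⟩)
      · exact Or.inl ⟨hc, h4 hl1⟩
    · exact Or.inl ⟨hc, h4 hn⟩
    -- The periodic primitive of the stream function, obtained by dividing its coefficients by `i
    -- k`. At `k = 0` the quotient is `0` by convention, which is consistent because `a 0 = 0`.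
    · refine Or.inr (Or.inr ⟨h1 hl1, hμ, pull (trigC S fun k =>
        streamCoeff l a k / (Complex.I * k)), fun z => ?_, pull_neg_pi _⟩)
      refine (hasDerivAt_pull_trigC S _ z).congr_deriv ?_
      congr 2
      funext k
      rcases eq_or_ne k 0 with rfl | hk
      · simp [streamCoeff, ha]
      · exact mul_div_cancel₀ _ (mul_ne_zero Complex.I_ne_zero (by exact_mod_cast hk))

lemma norm_velocity_trig (l : ℤ) (S : Finset ℤ) (a : ℤ → ℂ) :
    ‖mulOp cosT (opB2 l (trigL2 S a))‖ ^ 2 =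
      (2 * π)⁻¹ * periodSq fun z => Real.sin z * pull (trigC S (b2Coeff l a)) z := by
  rw [opB2_trigL2, ← toL2_trigC, mulOp_toL2, norm_toL2_sq, periodSq, periodSq]
  congr 1
  refine intervalIntegral.integral_congr fun z _ => ?_
  have h : pull (toC cosT * trigC S (b2Coeff l a)) z =
    pull (toC cosT) z * pull (trigC S (b2Coeff l a)) z := rfl
  change ‖pull (toC cosT * trigC S (b2Coeff l a)) z‖ ^ 2 = _
  rw [h, pull_cos, neg_mul, norm_neg]

lemma norm_energy_trig {l : ℤ} (hl : l ≠ 0) (S : Finset ℤ) (a : ℤ → ℂ) :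
    ‖negAPowBdd l (-(1 / 2)) (by norm_num) (trigL2 S a)‖ ^ 2 =
      (2 * π)⁻¹ * (periodSq (pull (trigC S fun k => Complex.I * k * streamCoeff l a k)) +
        (l : ℝ) ^ 2 * periodSq (pull (trigC S (streamCoeff l a)))) := by
  rw [negAPowBdd_trigL2, norm_trigL2_sq, mul_add, mul_left_comm, periodSq_pull_trigC,
    periodSq_pull_trigC, Finset.mul_sum, ← Finset.sum_add_distrib]
  refine Finset.sum_congr rfl fun k _ => ?_
  have hk := one_le_sq_add_sq hl k
  have hk0 : (k : ℝ) ^ 2 + (l : ℝ) ^ 2 ≠ 0 := by positivity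
  have e : ‖((k : ℂ) ^ 2 + (l : ℂ) ^ 2)⁻¹‖ = ((k : ℝ) ^ 2 + (l : ℝ) ^ 2)⁻¹ := by
    have : ((k : ℂ) ^ 2 + (l : ℂ) ^ 2)⁻¹ = ((((k : ℝ) ^ 2 + (l : ℝ) ^ 2)⁻¹ : ℝ) : ℂ) := by
      push_cast; rfl
    rw [this, Complex.norm_real, Real.norm_of_nonneg (by positivity)]
  rw [streamCoeff, norm_mul, norm_mul, norm_mul, norm_mul, norm_neg, e, Complex.norm_I,
    Complex.norm_real, Complex.norm_intCast, one_mul, Real.rpow_neg (by positivity),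
    ← Real.sqrt_eq_rpow, Real.norm_of_nonneg (by positivity), mul_pow, mul_pow, mul_pow, inv_pow,
    Real.sq_sqrt (by positivity), sq_abs]
  field_simp

/-- Mode by mode, `|k| |1 - 1/(k² + l²)| ≤ √(k² + l²)`, and the sum over `S` is part of the full
norm. The bound does not depend on `S`. -/
lemma norm_gradient_trig_le {l : ℤ} (hl : l ≠ 0) (S : Finset ℤ)
    (u : (negAPow l (1 / 2)).domain) :
    (2 * π)⁻¹ * periodSq (pull (trigC S fun k => Complex.I * k *
      b2Coeff l (fourierBasis.repr (u : L2)) k)) ≤ ‖negAPow l (1 / 2) u‖ ^ 2 := by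
  have h := lp.sum_rpow_le_norm_rpow (by norm_num)
    (fourierBasis.repr (negAPow l (1 / 2) u)) S
  rw [LinearIsometryEquiv.norm_map] at h
  simp only [ENNReal.toReal_ofNat, Real.rpow_ofNat] at h
  rw [periodSq_pull_trigC]
  refine le_trans (Finset.sum_le_sum fun k _ => ?_) h
  have e : fourierBasis.repr (negAPow l (1 / 2) u) k =
    (((k : ℝ) ^ 2 + (l : ℝ) ^ 2) ^ (1 / 2 : ℝ) : ℝ) * fourierBasis.repr (u : L2) k :=
    fourierMultiplier_repr _ u k
  have hk := one_le_sq_add_sq hl k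
  have hb : ‖1 - ((k : ℂ) ^ 2 + (l : ℂ) ^ 2)⁻¹‖ ≤ 1 := norm_one_sub_inv_le hl k
  rw [e, b2Coeff, norm_mul, norm_mul, norm_mul, norm_mul, Complex.norm_I, one_mul,
    Complex.norm_intCast, Complex.norm_real, ← Real.sqrt_eq_rpow,
    Real.norm_of_nonneg (Real.sqrt_nonneg _)]
  refine pow_le_pow_left₀ (by positivity) ?_ 2
  rw [← mul_assoc]
  refine mul_le_mul_of_nonneg_right ?_ (norm_nonneg _)
  calc |(k : ℝ)| * ‖1 - ((k : ℂ) ^ 2 + (l : ℂ) ^ 2)⁻¹‖ ≤ |(k : ℝ)| * 1 := by gcongr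
    _ ≤ √((k : ℝ) ^ 2 + (l : ℝ) ^ 2) := by
      rw [mul_one]
      exact Real.abs_le_sqrt (le_add_of_nonneg_right (sq_nonneg _))

lemma resolventBounds_trig {μ : ℝ} {l : ℤ} (hl : l ≠ 0) {c₀ : ℂ} (S : Finset ℤ)
    (u : (negAPow l (1 / 2)).domain)
    (h : ModeAdmissible μ l c₀ (fourierBasis.repr (u : L2) 0)) :
    ResolventBounds (10 ^ 230) μ (‖trigL2 S (fourierBasis.repr (u : L2))‖ ^ 2)
      (‖mulOp cosT (opB2 l (trigL2 S (fourierBasis.repr (u : L2))))‖ ^ 2)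
      (‖negAPowBdd l (-(1 / 2)) (by norm_num) (trigL2 S (fourierBasis.repr (u : L2)))‖ ^ 2)
      (‖(μ : ℂ) • trigL2 S (fourierBasis.repr (u : L2)) -
        opLam l (trigL2 S (fourierBasis.repr (u : L2))) - c₀ • fourierBasis 0‖ ^ 2)
      (‖negAPow l (1 / 2) u‖ ^ 2) := by
  have h1 := ((complexRayleigh_trig hl S h).periodEstimates.const_mul
    (inv_nonneg.2 Real.two_pi_pos.le)).mono (by positivity) (norm_gradient_trig_le hl S u)
  rw [← norm_velocity_trig, ← norm_energy_trig hl, ← norm_toL2_sq, toL2_residualC] at h1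
  have e : (fun z => pull (trigC S (b2Coeff l (fourierBasis.repr (u : L2)))) z -
      pull (trigC S (streamCoeff l (fourierBasis.repr (u : L2)))) z) =
      pull (trigC S (fourierBasis.repr (u : L2))) := by
    funext z
    rw [pull_b2Coeff, add_sub_cancel_right]
  rwa [e, periodSq_pull_trigC, ← norm_trigL2_sq] at h1

/-! ### Passage to the limit -/

lemma norm_le_of_repr_le {u v : L2}
    (h : ∀ k : ℤ, ‖fourierBasis.repr u k‖ ≤ ‖fourierBasis.repr v k‖) : ‖u‖ ≤ ‖v‖ := by
  rw [← fourierBasis.repr.norm_map u, ← fourierBasis.repr.norm_map v]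
  exact lp.norm_mono two_ne_zero h

lemma continuous_opB2 {l : ℤ} (hl : l ≠ 0) : Continuous (opB2 l) := by
  refine AddMonoidHomClass.continuous_of_bound (opB2 l) 1 fun u => ?_
  rw [one_mul]
  refine norm_le_of_repr_le fun k => ?_
  rw [opB2_repr, norm_mul]
  exact mul_le_of_le_one_left (norm_nonneg _) (norm_one_sub_inv_le hl k)

lemma continuous_negAPowBdd {l : ℤ} (hl : l ≠ 0) (s : ℝ) (hs : s ≤ 0) :
    Continuous (negAPowBdd l s hs) := by
  refine AddMonoidHomClass.continuous_of_bound (negAPowBdd l s hs) 1 fun u => ?_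
  rw [one_mul]
  refine norm_le_of_repr_le fun k => ?_
  have hk := one_le_sq_add_sq hl k
  rw [negAPowBdd_repr, norm_mul, Complex.norm_real, Real.norm_of_nonneg (by positivity)]
  exact mul_le_of_le_one_left (norm_nonneg _) (Real.rpow_le_one_of_one_le_of_nonpos hk hs)

lemma continuous_mulOp (g : C(Torus, ℝ)) : Continuous (mulOp g) := by
  refine AddMonoidHomClass.continuous_of_bound (mulOp g) ‖g‖ fun u => ?_
  refine Lp.norm_le_mul_norm_of_ae_le_mul ?_
  have h1 : mulOp g u =ᵐ[AddCircle.haarAddCircle] fun y => (g y : ℂ) * u y :=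
    MemLp.coeFn_toLp (memLp_mul g u)
  filter_upwards [h1] with y e1
  rw [e1, norm_mul, Complex.norm_real]
  exact mul_le_mul_of_nonneg_right (g.norm_coe_le_norm y) (norm_nonneg _)

lemma continuous_opLam {l : ℤ} (hl : l ≠ 0) : Continuous (opLam l) :=
  (continuous_mulOp sinT).comp (continuous_opB2 hl)

lemma tendsto_trigL2 (u : L2) :
    Filter.Tendsto (fun S => trigL2 S (fourierBasis.repr u)) Filter.atTop (nhds u) :=
  fourierBasis.hasSum_repr u

/-- The resolvent estimates for `u`, with the residual given by a continuous map `R`. -/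
lemma resolventBounds_of_continuous {μ : ℝ} {l : ℤ} (hl : l ≠ 0)
    (u : (negAPow l (1 / 2)).domain) {R : L2 → L2} (hR : Continuous R)
    (h : ∀ S : Finset ℤ, ∃ c₀ : ℂ, ModeAdmissible μ l c₀ (fourierBasis.repr (u : L2) 0) ∧
      R (trigL2 S (fourierBasis.repr (u : L2))) =
        (μ : ℂ) • trigL2 S (fourierBasis.repr (u : L2)) -
          opLam l (trigL2 S (fourierBasis.repr (u : L2))) - c₀ • fourierBasis 0) :
    ResolventBounds (10 ^ 230) μ (‖(u : L2)‖ ^ 2) (‖mulOp cosT (opB2 l u)‖ ^ 2)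
      (‖negAPowBdd l (-(1 / 2)) (by norm_num) u‖ ^ 2) (‖R u‖ ^ 2)
      (‖negAPow l (1 / 2) u‖ ^ 2) := by
  have key : ∀ {T : L2 → L2}, Continuous T → Filter.Tendsto
      (fun S => ‖T (trigL2 S (fourierBasis.repr (u : L2)))‖ ^ 2) Filter.atTop
        (nhds (‖T u‖ ^ 2)) := fun hT =>
    ((hT.norm.pow 2).tendsto (u : L2)).comp (tendsto_trigL2 u)
  have k1 := key continuous_id
  have k2 := key ((continuous_mulOp cosT).comp (continuous_opB2 hl))
  have k3 := key (continuous_negAPowBdd hl (-(1 / 2)) (by norm_num))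
  have k4 := key hR
  refine ResolventBounds.of_tendsto (fun S => ?_) k1 k2 k3 k4
  obtain ⟨c₀, hc, e⟩ := h S
  rw [e]
  exact resolventBounds_trig hl S u hc

lemma continuous_residual (μ : ℝ) {l : ℤ} (hl : l ≠ 0) :
    Continuous fun u : L2 => (μ : ℂ) • u - opLam l u :=
  (continuous_const_smul _).sub (continuous_opLam hl)

lemma resolventBounds_of_half_le {μ : ℝ} (hμ : 1 / 2 ≤ |μ|) {l : ℤ} (hl : l ≠ 0)
    (u : (negAPow l (1 / 2)).domain) :
    ResolventBounds (10 ^ 230) μ (‖(u : L2)‖ ^ 2) (‖mulOp cosT (opB2 l u)‖ ^ 2)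
      (‖negAPowBdd l (-(1 / 2)) (by norm_num) u‖ ^ 2) (‖(μ : ℂ) • (u : L2) - opLam l u‖ ^ 2)
      (‖negAPow l (1 / 2) u‖ ^ 2) := by
  refine resolventBounds_of_continuous hl u (R := fun v => (μ : ℂ) • v - opLam l v)
    (continuous_residual μ hl) fun S => ⟨0, Or.inl ⟨rfl, Or.inl hμ⟩, ?_⟩
  rw [zero_smul, sub_zero]

/-- For `l = ±1`, `c₀` is the mean of the truncated residual and thus varies with `S`; the bounds do
not involve it, so the limit can be taken. -/
lemma resolventBounds_of_lt_half {μ : ℝ} (hμ : |μ| < 1 / 2) {l : ℤ} (hl : l ≠ 0)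
    (u : (negAPow l (1 / 2)).domain) (hu : (u : L2) ∈ spaceY l) :
    ResolventBounds (10 ^ 230) μ (‖(u : L2)‖ ^ 2) (‖mulOp cosT (opB2 l u)‖ ^ 2)
      (‖negAPowBdd l (-(1 / 2)) (by norm_num) u‖ ^ 2)
      (‖projQ l ((μ : ℂ) • (u : L2) - opLam l u)‖ ^ 2) (‖negAPow l (1 / 2) u‖ ^ 2) := by
  refine resolventBounds_of_continuous hl u (R := fun v => projQ l ((μ : ℂ) • v - opLam l v))
    ((projQ l).continuous.comp (continuous_residual μ hl)) fun S => ?_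
  by_cases hl1 : l = 1 ∨ l = -1
  · exact ⟨_, Or.inr ⟨hl1, hμ, (integral_eq_repr u).symm.trans (hu hl1)⟩, projQ_of_eq hl1 _⟩
  · refine ⟨0, Or.inl ⟨rfl, Or.inr hl1⟩, ?_⟩
    rw [projQ_of_ne hl1, zero_smul, sub_zero]

end

end Kolmogorov

theorem mainTheorem6 :
    ∃ C κ : ℝ, 0 < C ∧ 0 < κ ∧ κ < 1 ∧ ∀ (μ : ℝ) (l : ℤ), l ≠ 0 →
      (∀ m : ℝ, 1 ≤ m →
        (1 / 2 ≤ |μ| → |μ| ≤ 1 + κ / m →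
          ∀ (u : Kolmogorov.L2) (hu : Kolmogorov.MemH1 u),
            ‖u‖ ^ 2 ≤ C * (m ^ 2 * ‖(μ : ℂ) • u - Kolmogorov.opLam l u‖ ^ 2 +
              Kolmogorov.h1 κ m μ ^ 2 *
                ‖Kolmogorov.negAPow l (1 / 2) ⟨u, hu.mem_domain l⟩‖ ^ 2)) ∧
        (|μ| < 1 / 2 →
          ∀ (u : Kolmogorov.L2) (hu : Kolmogorov.MemH1 u), u ∈ Kolmogorov.spaceY l →
            ‖u‖ ^ 2 ≤ C * (m ^ 2 *
                ‖Kolmogorov.projQ l ((μ : ℂ) • u - Kolmogorov.opLam l u)‖ ^ 2 +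
              Kolmogorov.h1 κ m μ ^ 2 *
                ‖Kolmogorov.negAPow l (1 / 2) ⟨u, hu.mem_domain l⟩‖ ^ 2)) ∧
        (1 / 2 ≤ |μ| → |μ| ≤ 1 + κ / m ^ 2 →
          ∀ (u : Kolmogorov.L2) (hu : Kolmogorov.MemH1 u),
            ‖Kolmogorov.mulOp Kolmogorov.cosT (Kolmogorov.opB2 l u)‖ ^ 2 ≤
              C * (m ^ 2 * ‖(μ : ℂ) • u - Kolmogorov.opLam l u‖ ^ 2 +
                Kolmogorov.h2 κ m μ ^ 2 *
                  ‖Kolmogorov.negAPow l (1 / 2) ⟨u, hu.mem_domain l⟩‖ ^ 2)) ∧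
        (|μ| < 1 / 2 →
          ∀ (u : Kolmogorov.L2) (hu : Kolmogorov.MemH1 u), u ∈ Kolmogorov.spaceY l →
            ‖Kolmogorov.mulOp Kolmogorov.cosT (Kolmogorov.opB2 l u)‖ ^ 2 ≤
              C * (m ^ 2 * ‖Kolmogorov.projQ l ((μ : ℂ) • u - Kolmogorov.opLam l u)‖ ^ 2 +
                Kolmogorov.h2 κ m μ ^ 2 *
                  ‖Kolmogorov.negAPow l (1 / 2) ⟨u, hu.mem_domain l⟩‖ ^ 2)) ∧
        (1 / 2 ≤ |μ| → |μ| ≤ 1 + κ / m ^ 2 →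
          ∀ (u : Kolmogorov.L2) (hu : Kolmogorov.MemH1 u),
            ‖Kolmogorov.negAPowBdd l (-(1 / 2)) (by norm_num) u‖ ^ 2 ≤
              C * (m ^ 2 * ‖(μ : ℂ) • u - Kolmogorov.opLam l u‖ ^ 2 +
                Kolmogorov.h3 κ m μ ^ 2 *
                  ‖Kolmogorov.negAPow l (1 / 2) ⟨u, hu.mem_domain l⟩‖ ^ 2)) ∧
        (|μ| < 1 / 2 →
          ∀ (u : Kolmogorov.L2) (hu : Kolmogorov.MemH1 u), u ∈ Kolmogorov.spaceY l →
            ‖Kolmogorov.negAPowBdd l (-(1 / 2)) (by norm_num) u‖ ^ 2 ≤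
              C * (m ^ 2 * ‖Kolmogorov.projQ l ((μ : ℂ) • u - Kolmogorov.opLam l u)‖ ^ 2 +
                Kolmogorov.h3 κ m μ ^ 2 *
                  ‖Kolmogorov.negAPow l (1 / 2) ⟨u, hu.mem_domain l⟩‖ ^ 2))) ∧
      (1 < |μ| → ∀ u : Kolmogorov.L2, Kolmogorov.MemH1 u →
        ‖u‖ ^ 2 ≤ C / (|μ| - 1) ^ 2 * ‖(μ : ℂ) • u - Kolmogorov.opLam l u‖ ^ 2 ∧
        ‖Kolmogorov.mulOp Kolmogorov.cosT (Kolmogorov.opB2 l u)‖ ^ 2 ≤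
          C / (|μ| - 1) * ‖(μ : ℂ) • u - Kolmogorov.opLam l u‖ ^ 2 ∧
        ‖Kolmogorov.negAPowBdd l (-(1 / 2)) (by norm_num) u‖ ^ 2 ≤
          C / (|μ| * (|μ| - 1)) * ‖(μ : ℂ) • u - Kolmogorov.opLam l u‖ ^ 2) := by

  refine ⟨10 ^ 230, 1 / 100, by positivity, by norm_num, by norm_num, fun μ l hl =>
    ⟨fun m hm => ?_, fun hμ u hu => ?_⟩⟩
  · have hle : |μ| < 1 / 2 → ∀ x : ℝ, 1 ≤ x → |μ| ≤ 1 + 1 / 100 / x := fun hμ x hx => by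
      have : 0 ≤ 1 / 100 / x := by positivity
      linarith
    have hm2 : 1 ≤ m ^ 2 := one_le_pow₀ hm
    exact ⟨fun hμ hμ' u hu => (Kolmogorov.resolventBounds_of_half_le hμ hl
        ⟨u, hu.mem_domain l⟩).vorticity m hm hμ',
      fun hμ u hu hY => (Kolmogorov.resolventBounds_of_lt_half hμ hl
        ⟨u, hu.mem_domain l⟩ hY).vorticity m hm (hle hμ m hm),
      fun hμ hμ' u hu => (Kolmogorov.resolventBounds_of_half_le hμ hl
        ⟨u, hu.mem_domain l⟩).velocity m hm hμ',
      fun hμ u hu hY => (Kolmogorov.resolventBounds_of_lt_half hμ hl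
        ⟨u, hu.mem_domain l⟩ hY).velocity m hm (hle hμ _ hm2),
      fun hμ hμ' u hu => (Kolmogorov.resolventBounds_of_half_le hμ hl
        ⟨u, hu.mem_domain l⟩).energy m hm hμ',
      fun hμ u hu hY => (Kolmogorov.resolventBounds_of_lt_half hμ hl
        ⟨u, hu.mem_domain l⟩ hY).energy m hm (hle hμ _ hm2)⟩
  · have h := Kolmogorov.resolventBounds_of_half_le (by linarith) hl
      (⟨u, hu.mem_domain l⟩ : (Kolmogorov.negAPow l (1 / 2)).domain) (μ := μ)
    exact ⟨h.ext_vorticity hμ, h.ext_velocity hμ, h.ext_energy hμ⟩
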